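/- **Setting.** Let $G$ be a finite group of order $n$, enumerated as $g_1,\dots,g_n$, let $\mathbb F$ be a field, $A=\mathbb F[G]$, and let $\sigma$ be an $\mathbb F$-algebra automorphism of $A$. Let $A[z;\sigma]$ be the skew polynomial ring with $az=z\sigma(a)$ for $a\in A$, and let $\rho_\sigma:\mathbb F[z]^n\to A[z;\sigma]$ be the bijection $\sum_j z^jw_j\mapsto\sum_j z^j\beta(w_j)$, where $w_j\in\mathbb F^n$ and $\beta(v_1,\dots,v_n)=\sum_i v_ig_i$. A *convolutional code* of length $n$ is a direct summand $\mathcal C$ of the $\mathbb F[z]$-module $\mathbb F[z]^n$; an *encoder* of $\mathcal C$ is a matrix whose rows form an $\mathbb F[z]$-basis of $\mathcal C$. The code has *parameters* $(n,k,\delta)$ if its rank is $k$ and its complexity, i.e. the maximal degree of the $k\times k$ minors of an encoder, is $\delta$. The *Forney indices* of $\mathcal C$ are the row degrees of an encoder for which the sum of the row degrees is the complexity. A convolutional code $\mathcal C$ is a *$(G,\sigma)$-convolutional code* if $\rho_\sigma(\mathcal C)$ is a left ideal of $A[z;\sigma]$ that is a direct summand; it is *minimal* if moreover $\rho_\sigma(\mathcal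 C)$ is indecomposable (in particular nonzero) as a left $A[z;\sigma]$-module. Now let $G=S_3$, enumerated as $I,(1\,2),(1\,3),(2\,3),(1\,2\,3),(1\,3\,2)$ (permutations are composed from right to left), and $A=\mathbb F_5[S_3]$. In coordinates with respect to this enumeration put $\varepsilon_1=(1,1,1,1,1,1)$, $\varepsilon_2=(1,4,4,4,1,1)$, $\varepsilon_3=(2,3,0,2,3,0)$, $\varepsilon_4=(2,2,0,3,0,3)$, and $\varepsilon_{34}=(1\,3)\varepsilon_4$, $\varepsilon_{43}=(1\,3)\varepsilon_3$. Let $f_1=\varepsilon_1$, $f_2=\varepsilon_2$. Let $\mathcal S\subseteq M_2(\mathbb F_5[x])$ be the subring of the matrices whose lower left entry is divisible by $x$, and let $e_{ij}$ be the $2\times 2$ matrix units. For $a_1,a_2,c_1,c_2\in\mathbb F_5[z]$ let $W(a_1,a_2,c_1,c_2)$ be the $2\times 6$ matrix with rows $$(3a_1+2a_2+c_2,\ 2a_1+2a_2+c_2,\ a_2+3c_1+2c_2,\ 3a_1+2a_2+2c_1+2c_2,\ 2a_1+2a_2+3c_1+2c_2,\ a_2+2c_1+2c_2),$$ $$(a_2+2c_1+2c_2,\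 3a_1+2a_2+2c_1+2c_2,\ 2a_1+2a_2+c_2,\ a_2+3c_1+2c_2,\ 3a_1+2a_2+c_2,\ 2a_1+2a_2+3c_1+2c_2).$$ **Theorem.** 1. *(The case $f_1\leftrightarrow f_2$.)* Let $\sigma$ be the automorphism $g\mapsto \mathrm{sign}(g)\,g$ of $A$; then $\sigma(f_1)=f_2$ and $\sigma(f_2)=f_1$. There is a ring isomorphism $\phi:A[z;\sigma]\to\mathcal S\times M_2(\mathbb F_5[x])$ with $$z\mapsto\left(\begin{pmatrix}0&1\\x&0\end{pmatrix},\,x\begin{pmatrix}2&4\\1&3\end{pmatrix}\right),$$ $\varepsilon_1\mapsto(e_{11},0)$, $\varepsilon_2\mapsto(e_{22},0)$, $\varepsilon_3\mapsto(0,e_{11})$, $\varepsilon_{34}\mapsto(0,e_{12})$, $\varepsilon_{43}\mapsto(0,e_{21})$, $\varepsilon_4\mapsto(0,e_{22})$. For every minimal $(S_3,\sigma)$-convolutional code $\mathcal C$ the ideal $\phi(\rho_\sigma(\mathcal C))$ lies in one of the two factors. (a) The minimal codes with $\phi(\rho_\sigma(\mathcal C))\subseteq\mathcal S\times 0$ are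 exactly the codes generated by $$(f(z),f(-z),f(-z),f(-z),f(z),f(z))\quad\text{or}\quad(f(z),-f(-z),-f(-z),-f(-z),f(z),f(z)),$$ with $f\in\mathbb F_5[z]$ such that $f(z)$ and $f(-z)$ are coprime. The given vector is a basis, and the parameters are $(6,1,\deg f)$. (b) The minimal codes with $\phi(\rho_\sigma(\mathcal C))\subseteq 0\times M_2(\mathbb F_5[x])$ are exactly the codes generated by the rows of $W(a_1,a_2,c_1,c_2)$, where $a=\sum\alpha_iz^i$ and $c=\sum\beta_iz^i$ are coprime polynomials in $\mathbb F_5[z]$ and $a_1=\sum 2^i\alpha_{2i}z^{2i}$, $a_2=\sum 2^i\alpha_{2i+1}z^{2i+1}$, $c_1=\sum 2^i\beta_{2i}z^{2i}$, $c_2=\sum 2^i\beta_{2i+1}z^{2i+1}$. The two rows are a basis, and the parameters are $(6,2,\max\{2\deg a,2\deg c\})$. 2. *(The case $\sigma=\mathrm{id}$.)* There is a ring isomorphism $\phi:A[z]\to(\mathbb F_5[x]\times\mathbb F_5[x])\times M_2(\mathbb F_5[x])$ with $z\mapsto((x,x),x\cdot 1)$, $\varepsilon_1\mapsto((1,0),0)$,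 $\varepsilon_2\mapsto((0,1),0)$, $\varepsilon_3\mapsto(0,e_{11})$, $\varepsilon_{34}\mapsto(0,e_{12})$, $\varepsilon_{43}\mapsto(0,e_{21})$, $\varepsilon_4\mapsto(0,e_{22})$. For every minimal $(S_3,\mathrm{id})$-convolutional code $\mathcal C$, $\phi(\rho_{\mathrm{id}}(\mathcal C))$ lies in the factor $\mathbb F_5[x]\times\mathbb F_5[x]$ or in the factor $M_2(\mathbb F_5[x])$. The minimal codes in the first factor are exactly the codes generated by $(1,1,1,1,1,1)$ and by $(1,4,4,4,1,1)$; they have parameters $(6,1,0)$. The minimal codes in the second factor are exactly the codes generated by the rows of $W(a,0,c,0)$ with $a,c\in\mathbb F_5[z]$ coprime; these two rows are a basis, and the parameters are $(6,2,\max\{2\deg a,2\deg c\})$. 3. *(Reduction to the two cases.)* Let $\sigma$ be any $\mathbb F_5$-algebra automorphism of $A$. Then either $\sigma$ fixes $f_1$ and $f_2$, and we put $\sigma_0=\mathrm{id}$, or $\sigma$ interchanges $f_1$ and $f_2$, and we let $\sigma_0$ be the automorphism of part 1. There are a unit $u$ of $A$ with $\sigma(a)=u^{-1}\sigma_0(a)u$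 for all $a\in A$ and a ring isomorphism $\theta:A[z;\sigma]\to A[z;\sigma_0]$ that is the identity on $A$ and maps $z$ to $zu$, such that $\mathcal C$ is a minimal $(S_3,\sigma)$-convolutional code if and only if $\theta(\rho_\sigma(\mathcal C))=\rho_{\sigma_0}(\mathcal C_0)$ for some minimal $(S_3,\sigma_0)$-convolutional code $\mathcal C_0$. If $\sigma$ maps every element of $S_3$ to a scalar multiple of an element of $S_3$, then $u$ and $\theta$ can be chosen so that, in addition, $\theta$ preserves the weight: $\theta(\rho_\sigma(y))=\rho_{\sigma_0}(y_0)$ implies that $y$ and $y_0$ have the same number of nonzero coefficients. 4. *(Parameters.)* For every $\mathbb F_5$-algebra automorphism $\sigma$ of $A$, every minimal $(S_3,\sigma)$-convolutional code has, for some integer $t\ge 0$, parameters $(6,1,t)$ and Forney index $t$, or parameters $(6,2,2t)$ and Forney indices $t,t$. For every $t\ge 0$ there are minimal codes with parameters $(6,1,t)$ and with parameters $(6,2,2t)$ for the automorphism of part 1, and minimal codes with parameters $(6,2,2t)$ for $\sigma=\mathrm{id}$. -/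

import Mathlib

open scoped Polynomial

namespace GroupConv

noncomputable section

/-! ### Skew polynomial rings `A[z; σ]` with `a z = z σ(a)` -/

section Skew

variable {F A : Type*} [CommRing F] [Ring A] [Algebra F A]

/-- A copy of `A` on which `Multiplicative ℕ` acts through the powers of `σ⁻¹`. -/
def Coeff (_σ : A ≃ₐ[F] A) : Type _ := A

instance (σ : A ≃ₐ[F] A) : Ring (Coeff σ) := inferInstanceAs (Ring A)

instance (σ : A ≃ₐ[F] A) : MulSemiringAction (Multiplicative ℕ) (Coeff σ) :=
  MulSemiringAction.compHom A (powersHom (A ≃ₐ[F] A) σ⁻¹)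

/-- The skew polynomial ring `A[z; σ]` with the rule `a z = z σ(a)`. Mathlib's skew polynomials
satisfy `z a = φ(a) z`, so they are taken with `φ = σ⁻¹`. -/
abbrev SkewPoly (σ : A ≃ₐ[F] A) : Type _ := SkewPolynomial (Coeff σ)

/-- The inclusion of the constants `A → A[z; σ]`. -/
def const (σ : A ≃ₐ[F] A) : A →+* SkewPoly σ :=
  (SkewPolynomial.CRingHom : Coeff σ →+* SkewPolynomial (Coeff σ))

/-- The variable `z` of `A[z; σ]`. -/
def zvar (σ : A ≃ₐ[F] A) : SkewPoly σ := SkewPolynomial.X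

/-- The multiplication rule of `A[z; σ]`. -/
theorem const_mul_zvar (σ : A ≃ₐ[F] A) (a : A) :
    const σ a * zvar σ = zvar σ * const σ (σ a) := by
  have key : ∀ b c : Coeff σ, SkewPolynomial.φ c = b →
      SkewPolynomial.C b * SkewPolynomial.X = SkewPolynomial.X * SkewPolynomial.C c := by
    intro b c h
    rw [← SkewPolynomial.monomial_zero_left, ← SkewPolynomial.monomial_zero_left,
      SkewPolynomial.monomial_mul_X, SkewPolynomial.X_mul_monomial, h]
  exact key _ _ (σ.symm_apply_apply a)

end Skew

/-! ### Convolutional codes -/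

section Codes

variable {F : Type*} [CommRing F] {n k : ℕ}

/-- A convolutional code of length `n`: a direct summand of `F[z]ⁿ`. -/
def IsConvCode (C : Submodule F[X] (Fin n → F[X])) : Prop :=
  ∃ K : Submodule F[X] (Fin n → F[X]), IsCompl C K

/-- The submodule generated by the rows of a matrix. -/
def rowCode (M : Matrix (Fin k) (Fin n) F[X]) : Submodule F[X] (Fin n → F[X]) :=
  Submodule.span F[X] (Set.range M.row)

/-- `M` is an encoder (generator matrix) of `C`: its rows are an `F[z]`-basis of `C`. -/
def IsEncoder (M : Matrix (Fin k) (Fin n) F[X]) (C : Submodule F[X] (Fin n → F[X])) : Prop :=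
  LinearIndependent F[X] M.row ∧ rowCode M = C

/-- The maximal degree of the `k`-minors of a `k × n` matrix. -/
def complexity (M : Matrix (Fin k) (Fin n) F[X]) : ℕ :=
  (Finset.univ : Finset (Fin k ↪ Fin n)).sup fun s => (M.submatrix id s).det.natDegree

/-- The weight of a vector of polynomials: the sum of the Hamming weights of the coefficients
`vⱼ ∈ Fⁿ` of `∑ⱼ vⱼ zʲ`, that is, the number of its nonzero coefficients. -/
def weight (y : Fin n → F[X]) : ℕ := ∑ i, (y i).support.card

/-- `C` is an `(n, k, δ)`-convolutional code: a convolutional code of length `n`, of rank `k`,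
whose encoders all have complexity `δ`. -/
def HasParameters (n k δ : ℕ) (C : Submodule F[X] (Fin n → F[X])) : Prop :=
  IsConvCode C ∧ (∃ M : Matrix (Fin k) (Fin n) F[X], IsEncoder M C) ∧
    ∀ M : Matrix (Fin k) (Fin n) F[X], IsEncoder M C → complexity M = δ

/-- The Forney indices of `C` are `ν 0, …, ν (k - 1)`: they are the row degrees of an encoder for
which the sum of the row degrees equals the complexity. -/
def HasForneyIndices (C : Submodule F[X] (Fin n → F[X])) (ν : Fin k → ℕ) : Prop :=
  ∃ M : Matrix (Fin k) (Fin n) F[X], IsEncoder M C ∧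
    (∀ i, (Finset.univ.sup fun j => (M i j).natDegree) = ν i) ∧ complexity M = ∑ i, ν i

end Codes

/-! ### Group convolutional codes -/

section GroupCodes

/-- A module is indecomposable if it is nonzero and is not a direct sum of two nonzero
submodules. -/
def IsIndecomposableModule (R M : Type*) [Ring R] [AddCommGroup M] [Module R M] : Prop :=
  Nontrivial M ∧ ∀ N N' : Submodule R M, IsCompl N N' → N = ⊥ ∨ N' = ⊥

variable {F G : Type*} [CommRing F] [Group G] {n : ℕ}

/-- The map `F[z]ⁿ → F[G][z; σ]` that sends `∑ⱼ zʲ wⱼ`, with `wⱼ ∈ Fⁿ`, to `∑ⱼ zʲ β(wⱼ)`, where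
`β(v) = ∑ᵢ vᵢ gᵢ` for the enumeration `g` of the group `G`. -/
def rho (g : Fin n ≃ G) (σ : MonoidAlgebra F G ≃ₐ[F] MonoidAlgebra F G)
    (y : Fin n → F[X]) : SkewPoly σ :=
  ∑ i, (y i).sum fun j c => zvar σ ^ j * const σ (MonoidAlgebra.single (g i) c)

/-- `(G, σ)`-convolutional codes: the image is a left ideal that is a direct summand.
In a noncommutative ring Mathlib's `Ideal` means left ideal. -/
def IsGroupConvCode (g : Fin n ≃ G) (σ : MonoidAlgebra F G ≃ₐ[F] MonoidAlgebra F G)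
    (C : Submodule F[X] (Fin n → F[X])) : Prop :=
  IsConvCode C ∧
    ∃ I : Ideal (SkewPoly σ), (I : Set (SkewPoly σ)) = rho g σ '' C ∧
      ∃ J : Ideal (SkewPoly σ), IsCompl I J

/-- Minimal `(G, σ)`-convolutional codes: the image is indecomposable as a left module over
`F[G][z; σ]`. -/
def IsMinimalGroupConvCode (g : Fin n ≃ G) (σ : MonoidAlgebra F G ≃ₐ[F] MonoidAlgebra F G)
    (C : Submodule F[X] (Fin n → F[X])) : Prop :=
  IsGroupConvCode g σ C ∧
    ∃ I : Ideal (SkewPoly σ), (I : Set (SkewPoly σ)) = rho g σ '' C ∧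
      IsIndecomposableModule (SkewPoly σ) I

end GroupCodes

/-! ### The group algebra of `S₃` over the field with five elements -/

section S3

/-- The field with five elements. -/
abbrev F5 : Type := ZMod 5

/-- The symmetric group `S₃`, on the letters `0, 1, 2`. -/
abbrev S3 : Type := Equiv.Perm (Fin 3)

/-- The group algebra `A = F₅[S₃]`. -/
abbrev A5 : Type := MonoidAlgebra F5 S3

/-- The enumeration `I, (1 2), (1 3), (2 3), (1 2 3), (1 3 2)` of `S₃` (with letters shifted down
by one). -/
def s3 : Fin 6 ≃ S3 :=
  Equiv.ofBijective
    ![1, Equiv.swap 0 1, Equiv.swap 0 2, Equiv.swap 1 2, c[0, 1, 2], c[0, 2, 1]]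
    (by decide)

/-- The element of `F₅[S₃]` with given coordinates in the basis `s3`. -/
def elt (v : Fin 6 → F5) : A5 := ∑ i, MonoidAlgebra.single (s3 i) (v i)

def ε₁ : A5 := elt ![1, 1, 1, 1, 1, 1]
def ε₂ : A5 := elt ![1, 4, 4, 4, 1, 1]
def ε₃ : A5 := elt ![2, 3, 0, 2, 3, 0]
def ε₄ : A5 := elt ![2, 2, 0, 3, 0, 3]
/-- `(1 3) ε₄` -/
def ε₃₄ : A5 := MonoidAlgebra.single (Equiv.swap 0 2) 1 * ε₄
/-- `(1 3) ε₃` -/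
def ε₄₃ : A5 := MonoidAlgebra.single (Equiv.swap 0 2) 1 * ε₃

/-- The endomorphism `g ↦ sign(g) g` of `F₅[S₃]`. -/
def signHom : A5 →ₐ[F5] A5 :=
  MonoidAlgebra.lift F5 A5 S3
    { toFun := fun g => MonoidAlgebra.single g ((Equiv.Perm.sign g : ℤ) : F5)
      map_one' := by simp [MonoidAlgebra.one_def]
      map_mul' := fun g h => by simp [MonoidAlgebra.single_mul_single] }

theorem signHom_single (g : S3) (c : F5) :
    signHom (MonoidAlgebra.single g c) =
      MonoidAlgebra.single g (c * ((Equiv.Perm.sign g : ℤ) : F5)) := by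
  simp [signHom, MonoidAlgebra.lift_single]

theorem signHom_comp : signHom.comp signHom = AlgHom.id F5 A5 := by
  refine MonoidAlgebra.algHom_ext (fun g => ?_) (Subsingleton.elim _ _)
  have h : ((Equiv.Perm.sign g : ℤ) : F5) * ((Equiv.Perm.sign g : ℤ) : F5) = 1 := by
    rw [← Int.cast_mul, ← Units.val_mul, Int.units_mul_self]; simp
  simp [signHom_single, h]

/-- The automorphism of `F₅[S₃]` that fixes `I, (1 2 3), (1 3 2)` and multiplies
`(1 2), (1 3), (2 3)` by `4`. -/
def signAut : A5 ≃ₐ[F5] A5 :=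
  AlgEquiv.ofAlgHom signHom signHom signHom_comp signHom_comp

/-- The subring `𝒮` of `M₂(F₅[x])` of the matrices whose lower left entry is divisible by `x`. -/
def lowerDivRing : Subring (Matrix (Fin 2) (Fin 2) F5[X]) where
  carrier := {M | Polynomial.X ∣ M 1 0}
  mul_mem' {M N} hM hN := by
    simp only [Set.mem_ofPred_eq, Matrix.mul_apply, Fin.sum_univ_two] at *
    exact dvd_add (hM.mul_right _) (hN.mul_left _)
  one_mem' := by simp
  add_mem' {M N} hM hN := by
    simp only [Set.mem_ofPred_eq, Matrix.add_apply] at *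
    exact dvd_add hM hN
  zero_mem' := by simp
  neg_mem' {M} hM := by
    simp only [Set.mem_ofPred_eq, Matrix.neg_apply] at *
    exact (dvd_neg).2 hM

/-- `f(-z)` -/
def reflect (f : F5[X]) : F5[X] := f.comp (-Polynomial.X)

/-- The `1 × 6` matrix `(f(z), f(-z), f(-z), f(-z), f(z), f(z))`. -/
def encSym (f : F5[X]) : Matrix (Fin 1) (Fin 6) F5[X] :=
  !![f, reflect f, reflect f, reflect f, f, f]

/-- The `1 × 6` matrix `(f(z), -f(-z), -f(-z), -f(-z), f(z), f(z))`. -/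
def encAlt (f : F5[X]) : Matrix (Fin 1) (Fin 6) F5[X] :=
  !![f, -reflect f, -reflect f, -reflect f, f, f]

/-- `∑ᵢ 2ⁱ α₂ᵢ z²ⁱ` for `p = ∑ αᵢ zⁱ` -/
def evenPart (p : F5[X]) : F5[X] :=
  ∑ i ∈ Finset.range (p.natDegree + 1), Polynomial.monomial (2 * i) (2 ^ i * p.coeff (2 * i))

/-- `∑ᵢ 2ⁱ α₂ᵢ₊₁ z²ⁱ⁺¹` for `p = ∑ αᵢ zⁱ` -/
def oddPart (p : F5[X]) : F5[X] :=
  ∑ i ∈ Finset.range (p.natDegree + 1),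
    Polynomial.monomial (2 * i + 1) (2 ^ i * p.coeff (2 * i + 1))

/-- The `2 × 6` matrix whose entries are explicit linear forms in `a₁, a₂, c₁, c₂`. -/
def encPattern (a₁ a₂ c₁ c₂ : F5[X]) : Matrix (Fin 2) (Fin 6) F5[X] :=
  !![3 * a₁ + 2 * a₂ + c₂, 2 * a₁ + 2 * a₂ + c₂, a₂ + 3 * c₁ + 2 * c₂,
      3 * a₁ + 2 * a₂ + 2 * c₁ + 2 * c₂, 2 * a₁ + 2 * a₂ + 3 * c₁ + 2 * c₂,
      a₂ + 2 * c₁ + 2 * c₂;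
    a₂ + 2 * c₁ + 2 * c₂, 3 * a₁ + 2 * a₂ + 2 * c₁ + 2 * c₂, 2 * a₁ + 2 * a₂ + c₂,
      a₂ + 3 * c₁ + 2 * c₂, 3 * a₁ + 2 * a₂ + c₂, 2 * a₁ + 2 * a₂ + 3 * c₁ + 2 * c₂]

/-- The encoder attached to a pair `(a, c)` in the case of the sign automorphism. -/
def encSign (a c : F5[X]) : Matrix (Fin 2) (Fin 6) F5[X] :=
  encPattern (evenPart a) (oddPart a) (evenPart c) (oddPart c)

/-- The encoder attached to a pair `(a, c)` in the case of the identity automorphism. -/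
def encId (a c : F5[X]) : Matrix (Fin 2) (Fin 6) F5[X] :=
  !![3 * a, 2 * a, 3 * c, 3 * a + 2 * c, 2 * a + 3 * c, 2 * c;
    2 * c, 3 * a + 2 * c, 2 * a, 3 * c, 3 * a, 2 * a + 3 * c]

end S3

end

end GroupConv

open GroupConv

/-! A left ideal that is a direct summand of a ring is generated by an idempotent, and it is
indecomposable exactly when that idempotent is primitive. Since `rho` is an F[z]-linear bijection,
minimal codes are therefore the sets of `y` with `rho y * e = rho y` for a primitive idempotent `e`
of A[z;σ] (`isMinimalGroupConvCode_iff`). Everything else is the determination of these idempotents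
and of F[z]-bases of the ideals they generate.

The algebra A splits as F₅ × F₅ × M₂(F₅) through `psiP`, `psiM` and `psi2`. An automorphism fixes or
interchanges the two characters and, by Skolem–Noether, is conjugation by some invertible `m` on the
matrix block (`exists_matrix_of_aut`). Hence A[z;σ] is T × M₂(F₅[x]), where z acts as x·m on the
second factor and T is F₅[x] × F₅[x] or 𝒮 (`fixEquiv`, `swapEquiv`). A primitive idempotent of a
product lives in one factor.

Over the principal ideal domain F₅[x], a nontrivial idempotent 2 × 2 matrix is a product u vᵀ with
v·u = 1 (`exists_rank_one_of_idem`). Its left ideal is the set of all w vᵀ, so only the coprime pair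
v = (a, c) matters. In 𝒮 one needs in addition x ∣ u₁v₀; as x is prime, x divides u₁ or v₀, and
these alternatives are the two families of one-generator codes. Splitting f into even and odd parts
turns v·u = 1 into coprimality of f(z) and f(-z).

In the matrix factor, multiplication by z raises the degree in x by one and twists by the invertible
`m`. So degrees in z and x agree, two constant columns generate all columns w over F₅[z], and the
leading coefficient rows of the resulting encoder are independent. Such an encoder is reduced, and
its row degrees are the Forney indices (`hasParameters_of_reduced`).

Finally, automorphisms with the same effect on the characters differ by an inner one, and z ↦ zu
identifies the skew polynomial rings. If σ is monomial, u can be a group element because every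
automorphism of S₃ is inner; then `theta` multiplies each coefficient by a monomial and preserves
weights. -/

namespace GroupConv

noncomputable section

/-! ### Coefficients and the universal property of skew polynomial rings -/

section SkewBasics

variable {F A B : Type*} [CommRing F] [Ring A] [Algebra F A] [Ring B] (σ : A ≃ₐ[F] A)

/-- The identity map from `A` to the copy on which `σ⁻¹` acts. -/
def toCoeff : A ≃+* Coeff σ := RingEquiv.refl A

theorem ofAdd_smul_toCoeff (j : ℕ) (a : A) :
    Multiplicative.ofAdd j • toCoeff σ a = toCoeff σ ((σ⁻¹ ^ j : A ≃ₐ[F] A) a) := by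
  change (powersHom (A ≃ₐ[F] A) σ⁻¹ (Multiplicative.ofAdd j)) a = _
  simp only [powersHom_apply, toAdd_ofAdd]
  rfl

theorem const_eq_monomial (a : A) :
    const σ a = SkewPolynomial.monomial 0 (toCoeff σ a) := rfl

/-- The coefficient of `zʲ`, where coefficients are written on the right of the variable. -/
def zcoeff (j : ℕ) : SkewPoly σ →+ A where
  toFun p := (σ ^ j : A ≃ₐ[F] A) ((toCoeff σ).symm (p.coeff j))
  map_zero' := by simp
  map_add' p q := by simp [SkewPolynomial.coeff_add]

theorem zcoeff_apply (j : ℕ) (p : SkewPoly σ) :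
    zcoeff σ j p = (σ ^ j : A ≃ₐ[F] A) ((toCoeff σ).symm (p.coeff j)) := rfl

/-- Stored coefficients stand to the left of the variable, whereas codes write them on the right;
moving `a` across zʲ costs σ⁻ʲ, which `zcoeff` undoes. -/
theorem zvar_pow_mul_const (j : ℕ) (a : A) :
    zvar σ ^ j * const σ a =
      SkewPolynomial.monomial j (toCoeff σ ((σ⁻¹ ^ j : A ≃ₐ[F] A) a)) := by
  rw [const_eq_monomial, zvar, SkewPolynomial.X_pow_mul_monomial, SkewPolynomial.φ_iterate_apply,
    ofAdd_smul_toCoeff, zero_add]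

theorem zcoeff_zvar_pow_mul_const (i j : ℕ) (a : A) :
    zcoeff σ i (zvar σ ^ j * const σ a) = if j = i then a else 0 := by
  rw [zvar_pow_mul_const, zcoeff_apply, SkewPolynomial.coeff_monomial]
  split_ifs with h
  · subst h
    rw [inv_pow, RingEquiv.symm_apply_apply]
    exact (σ ^ j).apply_symm_apply a
  · simp

variable {σ}

theorem skew_ext {p q : SkewPoly σ} (h : ∀ j, zcoeff σ j p = zcoeff σ j q) : p = q :=
  SkewPolynomial.ext fun j => (toCoeff σ).symm.injective ((σ ^ j : A ≃ₐ[F] A).injective (h j))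

theorem skew_induction {motive : SkewPoly σ → Prop} (p : SkewPoly σ) (h0 : motive 0)
    (hadd : ∀ p q, motive p → motive q → motive (p + q))
    (hmon : ∀ (j : ℕ) (a : A), motive (zvar σ ^ j * const σ a)) : motive p := by
  have hm : ∀ (j : ℕ) (a : Coeff σ), motive (SkewPolynomial.monomial j a) := by
    intro j a
    have h := hmon j ((σ ^ j : A ≃ₐ[F] A) ((toCoeff σ).symm a))
    rw [zvar_pow_mul_const, inv_pow] at h
    have h2 : ((σ ^ j)⁻¹ : A ≃ₐ[F] A) ((σ ^ j : A ≃ₐ[F] A) ((toCoeff σ).symm a)) =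
      (toCoeff σ).symm a := (σ ^ j).symm_apply_apply _
    rwa [h2, RingEquiv.apply_symm_apply] at h
  exact SkewPolynomial.induction p h0 fun j a q _ _ hq => hadd _ _ (hm j a) hq

/-- The universal property of `A[z; σ]`. -/
def skewLift (ψ : A →+* B) (Z : B) (h : ∀ a, ψ a * Z = Z * ψ (σ a)) : SkewPoly σ →+* B :=
  SkewMonoidAlgebra.liftNCRingHom (ψ.comp (toCoeff σ).symm.toRingHom) (powersHom B Z) (by
    intro a y
    obtain ⟨j, rfl⟩ := Multiplicative.ofAdd.surjective y
    obtain ⟨a, rfl⟩ := (toCoeff σ).surjective a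
    rw [ofAdd_smul_toCoeff, powersHom_apply, toAdd_ofAdd]
    simp only [RingEquiv.toRingHom_eq_coe, RingHom.comp_apply, RingHom.coe_coe,
      RingEquiv.symm_apply_apply]
    -- The relation for a single `Z` iterates to `ψ (σ⁻ʲ a) * Z ^ j = Z ^ j * ψ a`.
    induction j with
    | zero => simp
    | succ j ih =>
      rw [pow_succ', pow_succ', AlgEquiv.mul_apply, ← mul_assoc, h]
      have h2 : σ (σ⁻¹ ((σ⁻¹ ^ j : A ≃ₐ[F] A) a)) = (σ⁻¹ ^ j : A ≃ₐ[F] A) a :=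
        σ.apply_symm_apply _
      rw [h2, mul_assoc, ih, mul_assoc])

theorem skewLift_monomial (ψ : A →+* B) (Z : B) (h : ∀ a, ψ a * Z = Z * ψ (σ a)) (j : ℕ)
    (a : A) : skewLift ψ Z h (SkewPolynomial.monomial j (toCoeff σ a)) = ψ a * Z ^ j := by
  refine (SkewMonoidAlgebra.liftNC_single
    ((ψ.comp (toCoeff σ).symm.toRingHom : Coeff σ →+* B) : Coeff σ →+ B) _ _ _).trans ?_
  rw [powersHom_apply, toAdd_ofAdd]
  simp

@[simp]
theorem skewLift_const (ψ : A →+* B) (Z : B) (h : ∀ a, ψ a * Z = Z * ψ (σ a)) (a : A) :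
    skewLift ψ Z h (const σ a) = ψ a := by
  rw [const_eq_monomial, skewLift_monomial, pow_zero, mul_one]

@[simp]
theorem skewLift_zvar (ψ : A →+* B) (Z : B) (h : ∀ a, ψ a * Z = Z * ψ (σ a)) :
    skewLift ψ Z h (zvar σ) = Z := by
  refine (skewLift_monomial ψ Z h 1 1).trans ?_
  rw [map_one, one_mul, pow_one]

theorem skew_hom_ext {f g : SkewPoly σ →+* B} (hc : ∀ a, f (const σ a) = g (const σ a))
    (hz : f (zvar σ) = g (zvar σ)) : f = g := by
  ext1 p
  induction p using skew_induction with
  | h0 => simp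
  | hadd p q hp hq => simp [hp, hq]
  | hmon j a => simp [hc, hz]

variable (σ)

/-- The automorphism is F-linear, so scalars, unlike general elements of A, commute with z. This is
what makes A[z;σ] a left F[z]-module. -/
theorem commute_const_algebraMap_zvar (c : F) :
    Commute ((const σ).comp (algebraMap F A) c) (zvar σ) := by
  rw [Commute, SemiconjBy, RingHom.comp_apply, const_mul_zvar, AlgEquiv.commutes]

/-- The embedding of `F[z]` into `A[z; σ]`. -/
def polyHom : F[X] →+* SkewPoly σ :=
  Polynomial.eval₂RingHom' ((const σ).comp (algebraMap F A)) (zvar σ)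
    (commute_const_algebraMap_zvar σ)

@[simp]
theorem polyHom_X : polyHom σ Polynomial.X = zvar σ := by
  simp [polyHom, Polynomial.eval₂RingHom']

@[simp]
theorem polyHom_C (c : F) : polyHom σ (Polynomial.C c) = const σ (algebraMap F A c) := by
  simp [polyHom, Polynomial.eval₂RingHom']

theorem polyHom_monomial (j : ℕ) (c : F) :
    polyHom σ (Polynomial.monomial j c) = zvar σ ^ j * const σ (algebraMap F A c) := by
  rw [← Polynomial.C_mul_X_pow_eq_monomial, mul_comm, map_mul, map_pow, polyHom_X, polyHom_C]

theorem zcoeff_polyHom_mul_const (p : F[X]) (a : A) (j : ℕ) :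
    zcoeff σ j (polyHom σ p * const σ a) = p.coeff j • a := by
  induction p using Polynomial.induction_on' with
  | add p q hp hq => simp [add_mul, hp, hq, add_smul]
  | monomial i c =>
    rw [polyHom_monomial, mul_assoc, ← map_mul, zcoeff_zvar_pow_mul_const,
      Polynomial.coeff_monomial, Algebra.smul_def]
    split_ifs <;> simp

end SkewBasics

/-! ### The map `rho` -/

section Rho

variable {F G : Type*} [CommRing F] [Group G] {n : ℕ} (g : Fin n ≃ G)
  (σ : MonoidAlgebra F G ≃ₐ[F] MonoidAlgebra F G)

theorem polyHom_mul_const_eq_sum (p : F[X]) (a : G) :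
    polyHom σ p * const σ (MonoidAlgebra.single a 1) =
      p.sum fun j c => zvar σ ^ j * const σ (MonoidAlgebra.single a c) := by
  conv_lhs => rw [p.as_sum_support, map_sum, Finset.sum_mul]
  refine Finset.sum_congr rfl fun j _ => ?_
  rw [polyHom_monomial, mul_assoc, ← map_mul, ← Algebra.smul_def, MonoidAlgebra.smul_single,
    smul_eq_mul, mul_one]

/-- In this form the F[z]-linearity of `rho` is visible. -/
theorem rho_eq_sum (y : Fin n → F[X]) :
    rho g σ y = ∑ i, polyHom σ (y i) * const σ (MonoidAlgebra.single (g i) 1) :=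
  Finset.sum_congr rfl fun i _ => (polyHom_mul_const_eq_sum σ (y i) (g i)).symm

theorem rho_add (y y' : Fin n → F[X]) : rho g σ (y + y') = rho g σ y + rho g σ y' := by
  simp [rho_eq_sum, add_mul, Finset.sum_add_distrib]

theorem rho_smul (p : F[X]) (y : Fin n → F[X]) : rho g σ (p • y) = polyHom σ p * rho g σ y := by
  simp [rho_eq_sum, Finset.mul_sum, mul_assoc]

@[simp]
theorem rho_zero : rho g σ 0 = 0 := by simp [rho_eq_sum]

theorem zcoeff_rho (y : Fin n → F[X]) (j : ℕ) :
    zcoeff σ j (rho g σ y) = ∑ i, MonoidAlgebra.single (g i) ((y i).coeff j) := by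
  rw [rho_eq_sum, map_sum]
  refine Finset.sum_congr rfl fun i _ => ?_
  rw [zcoeff_polyHom_mul_const, MonoidAlgebra.smul_single, smul_eq_mul, mul_one]

theorem coeff_sum_single (v : Fin n → F) (i : Fin n) :
    (∑ i, MonoidAlgebra.single (g i) (v i) : MonoidAlgebra F G).coeff (g i) = v i := by
  classical
  rw [MonoidAlgebra.coeff_sum, Finsupp.finsetSum_apply, Finset.sum_eq_single i]
  · simp
  · intro b _ hb
    simp [hb]
  · simp

theorem coeff_zcoeff_rho (y : Fin n → F[X]) (j : ℕ) (i : Fin n) :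
    (zcoeff σ j (rho g σ y)).coeff (g i) = (y i).coeff j := by
  rw [zcoeff_rho, coeff_sum_single g (fun i => (y i).coeff j)]

theorem rho_injective : Function.Injective (rho g σ) := by
  intro y y' h
  ext i j
  rw [← coeff_zcoeff_rho g σ, h, coeff_zcoeff_rho]

theorem rho_surjective : Function.Surjective (rho g σ) := by
  intro p
  induction p using skew_induction with
  | h0 => exact ⟨0, rho_zero g σ⟩
  | hadd p q hp hq =>
    obtain ⟨y, rfl⟩ := hp
    obtain ⟨y', rfl⟩ := hq
    exact ⟨y + y', rho_add g σ y y'⟩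
  | hmon j a =>
    refine ⟨fun i => Polynomial.monomial j (a.coeff (g i)), skew_ext fun k => ?_⟩
    ext x
    obtain ⟨i, rfl⟩ := g.surjective x
    rw [coeff_zcoeff_rho, zcoeff_zvar_pow_mul_const, Polynomial.coeff_monomial]
    split_ifs <;> simp

end Rho
end
end GroupConv

namespace GroupConv

noncomputable section

/-! ### Primitive idempotents and indecomposable direct summands -/

section Idempotents

variable {R S : Type*} [Ring R] [Ring S]

/-- An idempotent is primitive if it is nonzero and not a sum of two nonzero orthogonal
idempotents. -/
def IsPrimitiveIdem (e : R) : Prop :=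
  IsIdempotentElem e ∧ e ≠ 0 ∧ ∀ f : R, IsIdempotentElem f → e * f = f → f * e = f → f = 0 ∨ f = e

theorem IsPrimitiveIdem.map {e : R} (he : IsPrimitiveIdem e) (φ : R ≃+* S) :
    IsPrimitiveIdem (φ e) := by
  refine ⟨he.1.map φ, by simpa using he.2.1, fun f hf h1 h2 => ?_⟩
  have h := he.2.2 (φ.symm f) (hf.map φ.symm) (φ.injective (by simpa using h1))
    (φ.injective (by simpa using h2))
  simpa [RingEquiv.symm_apply_eq] using h

/-- The idempotent (a, 0) lies below (a, b), so primitivity forces a = 0 or b = 0. -/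
theorem isPrimitiveIdem_prod_iff {e : R × S} :
    IsPrimitiveIdem e ↔
      (IsPrimitiveIdem e.1 ∧ e.2 = 0) ∨ (e.1 = 0 ∧ IsPrimitiveIdem e.2) := by
  obtain ⟨a, b⟩ := e
  simp only [IsPrimitiveIdem, IsIdempotentElem, Prod.forall, Prod.mk_mul_mk, Prod.mk.injEq, ne_eq,
    Prod.mk_eq_zero]
  constructor
  · rintro ⟨⟨ha, hb⟩, h0, h⟩
    have h1 := h a 0 ⟨ha, by simp⟩ ⟨ha, by simp⟩ ⟨ha, by simp⟩
    by_cases hb0 : b = 0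
    · subst hb0
      refine Or.inl ⟨⟨ha, fun h => h0 ⟨h, rfl⟩, fun f hf h2 h3 => ?_⟩, rfl⟩
      simpa using h f 0 ⟨hf, by simp⟩ ⟨h2, by simp⟩ ⟨h3, by simp⟩
    · have ha0 : a = 0 := by
        rcases h1 with h1 | h1
        · exact h1.1
        · exact absurd h1.2.symm hb0
      subst ha0
      refine Or.inr ⟨rfl, hb, hb0, fun f hf h2 h3 => ?_⟩
      simpa using h 0 f ⟨by simp, hf⟩ ⟨by simp, h2⟩ ⟨by simp, h3⟩
  · rintro (⟨⟨ha, h0, h⟩, rfl⟩ | ⟨rfl, hb, h0, h⟩)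
    · refine ⟨⟨ha, by simp⟩, fun h1 => h0 h1.1, fun f f' hf h2 h3 => ?_⟩
      have hf' : f' = 0 := by simpa using h2.2.symm
      subst hf'
      simpa using h f hf.1 h2.1 h3.1
    · refine ⟨⟨by simp, hb⟩, fun h1 => h0 h1.2, fun f f' hf h2 h3 => ?_⟩
      have hf' : f = 0 := by simpa using h2.1.symm
      subst hf'
      simpa using h f' hf.2 h2.2 h3.2

theorem isPrimitiveIdem_iff_eq_one [IsDomain R] {e : R} : IsPrimitiveIdem e ↔ e = 1 := by
  constructor
  · rintro ⟨h, h0, -⟩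
    exact (IsIdempotentElem.iff_eq_zero_or_one.1 h).resolve_left h0
  · rintro rfl
    exact ⟨IsIdempotentElem.one, one_ne_zero, fun f hf _ _ =>
      IsIdempotentElem.iff_eq_zero_or_one.1 hf⟩

theorem mem_span_idem_iff {e : R} (he : IsIdempotentElem e) {r : R} :
    r ∈ Ideal.span {e} ↔ r * e = r := by
  rw [Ideal.mem_span_singleton']
  refine ⟨?_, fun h => ⟨r, h⟩⟩
  rintro ⟨a, rfl⟩
  rw [mul_assoc, he.eq]

theorem isCompl_span_idem {e : R} (he : IsIdempotentElem e) :
    IsCompl (Ideal.span {e}) (Ideal.span {1 - e}) := by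
  refine IsCompl.of_eq ?_ ?_
  · rw [eq_bot_iff]
    rintro r ⟨h1, h2⟩
    rw [SetLike.mem_coe, mem_span_idem_iff he] at h1
    rw [SetLike.mem_coe, mem_span_idem_iff he.one_sub, mul_sub, mul_one, h1, sub_self] at h2
    exact h2.symm
  · rw [Ideal.eq_top_iff_one]
    exact Submodule.mem_sup.2 ⟨e, Ideal.mem_span_singleton_self e, 1 - e,
      Ideal.mem_span_singleton_self _, by abel⟩

/-- A decomposition N ⊕ N' splits e as n + n'. Here n is an idempotent below e, so it is 0 or e, and
then N or N' vanishes. -/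
theorem indecomposable_span_idem {e : R} (he : IsPrimitiveIdem e) :
    IsIndecomposableModule R (Ideal.span {e} : Ideal R) := by
  obtain ⟨hi, h0, hp⟩ := he
  set I := (Ideal.span {e} : Ideal R) with hI
  have heI : e ∈ I := Ideal.mem_span_singleton_self e
  have hmem : ∀ a : I, (a : R) * e = a := fun a => (mem_span_idem_iff hi).1 a.2
  refine ⟨⟨⟨e, heI⟩, 0, fun h => h0 congr(($h : R))⟩, fun N N' hN => ?_⟩
  obtain ⟨n, hn, n', hn', hs⟩ := Submodule.mem_sup.1
    ((hN.sup_eq_top ▸ Submodule.mem_top : (⟨e, heI⟩ : I) ∈ N ⊔ N'))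
  have hs' : (n : R) + n' = e := congr(($hs : R))
  -- From a = a e = a p + a p' and disjointness, a p' vanishes: p is a right identity on P.
  have key : ∀ (P P' : Submodule R I), Disjoint P P' → ∀ p ∈ P, ∀ p' ∈ P', (p : R) + p' = e →
      ∀ a ∈ P, (a : R) * p = a := by
    intro P P' hd p hp p' hp' hpp a ha
    have h1 : a - (a : R) • p = (a : R) • p' := by
      refine Subtype.ext ?_
      change (a : R) - a * p = a * p'
      rw [sub_eq_iff_eq_add', ← mul_add, hpp, hmem]
    have h2 : a - (a : R) • p = 0 := by
      refine (Submodule.disjoint_def.1 hd) _ (P.sub_mem ha (P.smul_mem _ hp)) ?_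
      rw [h1]
      exact P'.smul_mem _ hp'
    have h3 : (a : R) - a * p = 0 := congr(($h2 : R))
    exact (sub_eq_zero.1 h3).symm
  have k1 := key N N' hN.disjoint n hn n' hn' hs'
  have k2 := key N' N hN.disjoint.symm n' hn' n hn (by rw [add_comm, hs'])
  have h3 : (n' : R) * n = 0 := by
    have h := hmem n'
    rw [← hs', mul_add, k2 n' hn', add_eq_right] at h
    exact h
  have h4 : e * n = n := by rw [← hs', add_mul, k1 n hn, h3, add_zero]
  rcases hp n (k1 n hn) h4 (hmem n) with h | h
  · refine Or.inl (eq_bot_iff.2 fun a ha => Subtype.ext ?_)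
    have := k1 a ha
    rw [h, mul_zero] at this
    exact this.symm
  · refine Or.inr (eq_bot_iff.2 fun a ha => Subtype.ext ?_)
    have h5 : (n' : R) = 0 := by rw [← hs', left_eq_add] at h; exact h
    have := k2 a ha
    rw [h5, mul_zero] at this
    exact this.symm

/-- Split 1 = e + f along I ⊕ J. Then e is a right identity on I, hence an idempotent generator, and
an idempotent p below e would split I as Rp ⊕ R(e - p). -/
theorem exists_primitiveIdem_of_indecomposable {I J : Ideal R} (hIJ : IsCompl I J)
    (h : IsIndecomposableModule R I) : ∃ e, IsPrimitiveIdem e ∧ I = Ideal.span {e} := by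
  obtain ⟨e, he, f, hf, hs⟩ := Submodule.mem_sup.1
    ((hIJ.sup_eq_top ▸ Submodule.mem_top : (1 : R) ∈ I ⊔ J))
  have hmem : ∀ a ∈ I, a * e = a := by
    intro a ha
    have h1 : a - a * e = a * f := by rw [sub_eq_iff_eq_add', ← mul_add, hs, mul_one]
    have h2 := (Submodule.disjoint_def.1 hIJ.disjoint) (a - a * e)
      (I.sub_mem ha (I.mul_mem_left _ he)) (h1 ▸ J.mul_mem_left _ hf)
    exact (sub_eq_zero.1 h2).symm
  have hi : IsIdempotentElem e := hmem e he
  have hspan : I = Ideal.span {e} := by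
    ext a
    rw [mem_span_idem_iff hi]
    exact ⟨hmem a, fun h => h ▸ I.mul_mem_left _ he⟩
  refine ⟨e, ⟨hi, ?_, fun p hp h1 h2 => ?_⟩, hspan⟩
  · rintro rfl
    obtain ⟨a, b, hab⟩ := h.1
    exact hab (Subtype.ext (by rw [← hmem a a.2, ← hmem b b.2, mul_zero, mul_zero]))
  · have hpI : ∀ a, a * p = a → a ∈ I := fun a ha => by
      rw [← ha, ← h2, ← mul_assoc]; exact I.mul_mem_left _ he
    have hq : ∀ a, a * (e - p) = a → a ∈ I := fun a ha => by
      rw [← ha]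
      exact I.mul_mem_left _ (I.sub_mem he (hpI p hp))
    have hqi : (e - p) * (e - p) = e - p := by
      rw [mul_sub, sub_mul, sub_mul, hi.eq, h1, h2, hp.eq, sub_self, sub_zero]
    have hc : IsCompl (Submodule.comap (Submodule.subtype I) (Ideal.span {p}))
        (Submodule.comap (Submodule.subtype I) (Ideal.span {e - p})) := by
      refine IsCompl.of_eq ?_ ?_
      · rw [eq_bot_iff]
        rintro a ⟨ha, ha'⟩
        have ha1 := (mem_span_idem_iff hp).1 ha
        have ha2 := (mem_span_idem_iff hqi).1 ha'
        refine Subtype.ext ?_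
        have ha3 : (a : R) * (e - p) = 0 := by
          rw [mul_sub, hmem a a.2]
          exact sub_eq_zero.2 ha1.symm
        exact ha2.symm.trans ha3
      · rw [eq_top_iff]
        rintro a -
        refine Submodule.mem_sup.2 ⟨(a : R) • ⟨p, hpI p hp⟩, ?_, (a : R) • ⟨e - p, hq _ hqi⟩, ?_, ?_⟩
        · exact Ideal.mul_mem_left _ _ (Ideal.mem_span_singleton_self p)
        · exact Ideal.mul_mem_left _ _ (Ideal.mem_span_singleton_self (e - p))
        · refine Subtype.ext ?_
          change (a : R) * p + a * (e - p) = a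
          rw [← mul_add, add_sub_cancel, hmem a a.2]
    rcases h.2 _ _ hc with hb | hb
    · left
      have : (⟨p, hpI p hp⟩ : I) ∈ Submodule.comap (Submodule.subtype I) (Ideal.span {p}) :=
        Ideal.mem_span_singleton_self p
      rw [hb] at this
      exact congr(($((Submodule.mem_bot R).1 this) : R))
    · right
      have : (⟨e - p, hq _ hqi⟩ : I) ∈
          Submodule.comap (Submodule.subtype I) (Ideal.span {e - p}) :=
        Ideal.mem_span_singleton_self (e - p)
      rw [hb] at this
      have h5 : e - p = 0 := congr(($((Submodule.mem_bot R).1 this) : R))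
      exact (sub_eq_zero.1 h5).symm

end Idempotents

/-! ### Minimal group convolutional codes and primitive idempotents -/

section Minimal

variable {F G : Type*} [CommRing F] [Group G] {n : ℕ} (g : Fin n ≃ G)
  (σ : MonoidAlgebra F G ≃ₐ[F] MonoidAlgebra F G)

/-- The preimage of a left ideal under `rho`. -/
def idealCode (I : Ideal (SkewPoly σ)) : Submodule F[X] (Fin n → F[X]) where
  carrier := {y | rho g σ y ∈ I}
  add_mem' {x y} hx hy := by
    rw [Set.mem_ofPred_eq, rho_add]; exact I.add_mem hx hy
  zero_mem' := by rw [Set.mem_ofPred_eq, rho_zero]; exact I.zero_mem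
  smul_mem' p y hy := by rw [Set.mem_ofPred_eq, rho_smul]; exact I.mul_mem_left _ hy

theorem mem_idealCode {I : Ideal (SkewPoly σ)} {y : Fin n → F[X]} :
    y ∈ idealCode g σ I ↔ rho g σ y ∈ I := Iff.rfl

theorem rho_image_idealCode (I : Ideal (SkewPoly σ)) : rho g σ '' idealCode g σ I = I := by
  ext r
  constructor
  · rintro ⟨y, hy, rfl⟩
    exact hy
  · intro hr
    obtain ⟨y, rfl⟩ := rho_surjective g σ r
    exact ⟨y, hr, rfl⟩

theorem eq_idealCode {I : Ideal (SkewPoly σ)} {C : Submodule F[X] (Fin n → F[X])}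
    (h : (I : Set (SkewPoly σ)) = rho g σ '' C) : C = idealCode g σ I := by
  rw [← rho_image_idealCode g σ I] at h
  exact SetLike.coe_injective ((rho_injective g σ).image_injective h.symm)

theorem isCompl_idealCode {I J : Ideal (SkewPoly σ)} (h : IsCompl I J) :
    IsCompl (idealCode g σ I) (idealCode g σ J) := by
  refine IsCompl.of_eq ?_ ?_
  · rw [eq_bot_iff]
    rintro y ⟨h1, h2⟩
    refine rho_injective g σ ?_
    rw [rho_zero]
    exact Submodule.disjoint_def.1 h.disjoint _ h1 h2
  · rw [eq_top_iff]
    rintro y -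
    obtain ⟨a, ha, b, hb, hab⟩ := Submodule.mem_sup.1
      ((h.sup_eq_top ▸ Submodule.mem_top : rho g σ y ∈ I ⊔ J))
    obtain ⟨a, rfl⟩ := rho_surjective g σ a
    obtain ⟨b, rfl⟩ := rho_surjective g σ b
    rw [← rho_add] at hab
    exact Submodule.mem_sup.2 ⟨a, ha, b, hb, rho_injective g σ hab⟩

/-- Here codes become ring theory. The condition that C be a convolutional code comes for free: the
complementary left ideal pulls back along `rho` to a complementary F[z]-submodule. -/
theorem isMinimalGroupConvCode_iff (C : Submodule F[X] (Fin n → F[X])) :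
    IsMinimalGroupConvCode g σ C ↔
      ∃ e : SkewPoly σ, IsPrimitiveIdem e ∧ ∀ y, y ∈ C ↔ rho g σ y * e = rho g σ y := by
  constructor
  · rintro ⟨⟨-, I, hI, J, hIJ⟩, I', hI', hind⟩
    obtain rfl : I' = I := SetLike.coe_injective (hI'.trans hI.symm)
    obtain ⟨e, he, rfl⟩ := exists_primitiveIdem_of_indecomposable hIJ hind
    refine ⟨e, he, fun y => ?_⟩
    rw [eq_idealCode g σ hI, mem_idealCode, mem_span_idem_iff he.1]
  · rintro ⟨e, he, h⟩
    have hC : C = idealCode g σ (Ideal.span {e}) := by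
      ext y
      rw [mem_idealCode, mem_span_idem_iff he.1, h]
    subst hC
    have hc := isCompl_span_idem he.1
    have hi := (rho_image_idealCode g σ (Ideal.span {e})).symm
    exact ⟨⟨⟨_, isCompl_idealCode g σ hc⟩, _, hi, _, hc⟩, _, hi, indecomposable_span_idem he⟩

variable {g σ} in
theorem IsMinimalGroupConvCode.isConvCode {C : Submodule F[X] (Fin n → F[X])}
    (h : IsMinimalGroupConvCode g σ C) : IsConvCode C := h.1.1

/-- Minimal codes, seen through a ring isomorphism. -/
theorem isMinimalGroupConvCode_iff_of_equiv {B : Type*} [Ring B] (φ : SkewPoly σ ≃+* B)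
    (C : Submodule F[X] (Fin n → F[X])) :
    IsMinimalGroupConvCode g σ C ↔
      ∃ e : B, IsPrimitiveIdem e ∧ ∀ y, y ∈ C ↔ φ (rho g σ y) * e = φ (rho g σ y) := by
  rw [isMinimalGroupConvCode_iff]
  constructor
  · rintro ⟨e, he, h⟩
    refine ⟨φ e, he.map φ, fun y => ?_⟩
    rw [h, ← map_mul, φ.injective.eq_iff]
  · rintro ⟨e, he, h⟩
    refine ⟨φ.symm e, he.map φ.symm, fun y => ?_⟩
    rw [h, ← φ.injective.eq_iff, map_mul, φ.apply_symm_apply]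

/-- No compatibility of `θ` with F[z] is needed, since minimality depends only on the left ideal.
This matters because z ↦ zu is in general not F[z]-linear. -/
theorem isMinimalGroupConvCode_iff_exists_image
    {σ₀ : MonoidAlgebra F G ≃ₐ[F] MonoidAlgebra F G} (θ : SkewPoly σ ≃+* SkewPoly σ₀)
    (C : Submodule F[X] (Fin n → F[X])) :
    IsMinimalGroupConvCode g σ C ↔
      ∃ C₀ : Submodule F[X] (Fin n → F[X]), IsMinimalGroupConvCode g σ₀ C₀ ∧
        θ '' (rho g σ '' C) = rho g σ₀ '' C₀ := by
  rw [isMinimalGroupConvCode_iff_of_equiv g σ θ]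
  constructor
  · rintro ⟨e, he, h⟩
    refine ⟨idealCode g σ₀ (Ideal.span {e}), (isMinimalGroupConvCode_iff g σ₀ _).2
      ⟨e, he, fun y => by rw [mem_idealCode, mem_span_idem_iff he.1]⟩, ?_⟩
    rw [rho_image_idealCode]
    ext r
    rw [SetLike.mem_coe, mem_span_idem_iff he.1]
    constructor
    · rintro ⟨_, ⟨y, hy, rfl⟩, rfl⟩
      exact (h y).1 hy
    · intro hr
      obtain ⟨s, rfl⟩ := θ.surjective r
      obtain ⟨y, rfl⟩ := rho_surjective g σ s
      exact ⟨_, ⟨y, (h y).2 hr, rfl⟩, rfl⟩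
  · rintro ⟨C₀, h₀, himg⟩
    obtain ⟨e, he, h⟩ := (isMinimalGroupConvCode_iff g σ₀ _).1 h₀
    refine ⟨e, he, fun y => ?_⟩
    have h1 : y ∈ C ↔ θ (rho g σ y) ∈ rho g σ₀ '' C₀ := by
      rw [← himg, θ.injective.mem_set_image, (rho_injective g σ).mem_set_image, SetLike.mem_coe]
    rw [h1]
    constructor
    · rintro ⟨y₀, hy₀, hy⟩
      rw [← hy]
      exact (h y₀).1 hy₀
    · intro hy
      obtain ⟨y₀, hy₀⟩ := rho_surjective g σ₀ (θ (rho g σ y))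
      rw [← hy₀] at hy ⊢
      exact ⟨y₀, (h y₀).2 hy, rfl⟩

end Minimal

/-! ### Primitive idempotents of `2 × 2` matrices over a principal ideal domain -/

section MatrixIdem

open Matrix

variable {D : Type*} [CommRing D]

theorem vecMulVec_mul_vecMulVec_self_iff {u v : Fin 2 → D} (w : Fin 2 → D) (h : v ⬝ᵥ u = 1) :
    vecMulVec w v * vecMulVec u v = vecMulVec w v := by
  rw [vecMulVec_mul_vecMulVec, h, one_smul]

variable [IsDomain D]

/-- A rank one idempotent is primitive in every subring that contains it. -/
theorem isPrimitiveIdem_of_rank_one {R : Type*} [Ring R] (ι : R →+* Matrix (Fin 2) (Fin 2) D)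
    (hι : Function.Injective ι) {e : R} {u v : Fin 2 → D} (he : ι e = vecMulVec u v)
    (h : v ⬝ᵥ u = 1) : IsPrimitiveIdem e := by
  have hi : IsIdempotentElem e := hι (by
    rw [map_mul, he, vecMulVec_mul_vecMulVec_self_iff u h])
  refine ⟨hi, ?_, fun f hf h1 h2 => ?_⟩
  · rintro rfl
    have h2 : v ⬝ᵥ ((vecMulVec u v) *ᵥ u) = 1 := by
      rw [vecMulVec_mulVec, h]; simp [h]
    rw [← he] at h2
    simp at h2
  -- Compressing by a rank one idempotent gives a scalar multiple c·e, and c is an idempotent of a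
  -- domain.
  · have h3 : f = e * f * e := by rw [h1, h2]
    set c : D := v ⬝ᵥ (ι f *ᵥ u) with hc
    have h4 : ι f = c • vecMulVec u v := by
      conv_lhs => rw [h3, map_mul, map_mul, he]
      rw [vecMulVec_mul, vecMulVec_mul_vecMulVec, ← dotProduct_mulVec]
      ext i j
      simp only [Matrix.smul_apply, vecMulVec_apply, smul_eq_mul, Pi.smul_apply,
        ← hc]
      ring
    have h5 : c * c = c := by
      have h6 : ι f * ι f = ι f := by rw [← map_mul, hf.eq]
      rw [h4, smul_mul_smul_comm, vecMulVec_mul_vecMulVec_self_iff u h] at h6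
      have h7 := congr(v ⬝ᵥ ($h6 *ᵥ u))
      simpa [smul_mulVec, vecMulVec_mulVec, h] using h7
    rcases IsIdempotentElem.iff_eq_zero_or_one.1 (show IsIdempotentElem c from h5) with h6 | h6
    · left
      apply hι
      rw [h4, h6, zero_smul, map_zero]
    · right
      apply hι
      rw [h4, h6, one_smul, he]

variable [IsPrincipalIdealRing D]

theorem exists_mul_coprime (p q : D) (h : p ≠ 0 ∨ q ≠ 0) :
    ∃ g a c : D, p = g * a ∧ q = g * c ∧ IsCoprime a c := by
  obtain ⟨g, hg⟩ := (IsPrincipalIdealRing.principal (Ideal.span {p, q})).principal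
  replace hg : Ideal.span {p, q} = Ideal.span {g} := hg
  have hp : p ∈ Ideal.span {g} := hg ▸ Ideal.subset_span (by simp)
  have hq : q ∈ Ideal.span {g} := hg ▸ Ideal.subset_span (by simp)
  have hgg : g ∈ Ideal.span {p, q} := by rw [hg]; exact Ideal.mem_span_singleton_self g
  obtain ⟨a, rfl⟩ := Ideal.mem_span_singleton.1 hp
  obtain ⟨c, rfl⟩ := Ideal.mem_span_singleton.1 hq
  obtain ⟨s, t, hst⟩ := Ideal.mem_span_pair.1 hgg
  have hg0 : g ≠ 0 := by
    rintro rfl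
    simp at h
  refine ⟨g, a, c, rfl, rfl, s, t, mul_left_cancel₀ hg0 ?_⟩
  linear_combination hst

/-- The determinant is an idempotent of a domain; it is not 1, since an invertible idempotent is the
identity. So E is singular of trace 1, and over a principal ideal domain its rows are multiples of
one unimodular row. -/
theorem exists_rank_one_of_idem {E : Matrix (Fin 2) (Fin 2) D} (hE : IsIdempotentElem E)
    (h0 : E ≠ 0) (h1 : E ≠ 1) : ∃ u v : Fin 2 → D, E = vecMulVec u v ∧ v ⬝ᵥ u = 1 := by
  have hdet : E.det = 0 := by
    have h : IsIdempotentElem E.det := by rw [IsIdempotentElem, ← det_mul, hE.eq]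
    refine (IsIdempotentElem.iff_eq_zero_or_one.1 h).resolve_right fun hd => h1 ?_
    have hu : IsUnit E := (isUnit_iff_isUnit_det E).2 (hd ▸ isUnit_one)
    exact (IsIdempotentElem.iff_eq_one_of_isUnit hu).1 hE
  obtain ⟨p, q, r, s, rfl⟩ : ∃ p q r s, E = !![p, q; r, s] := ⟨_, _, _, _, eta_fin_two E⟩
  rw [det_fin_two_of] at hdet
  have hmul := hE.eq
  rw [mul_fin_two] at hmul
  have e00 := congr($hmul 0 0)
  have e01 := congr($hmul 0 1)
  have e10 := congr($hmul 1 0)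
  have e11 := congr($hmul 1 1)
  simp only [of_apply, cons_val_zero, cons_val_one, cons_val', cons_val_fin_one] at e00 e01 e10 e11
  -- Cayley–Hamilton with determinant zero reads E² = (tr E)·E, so (tr E - 1)·E = 0.
  have htr : p + s = 1 := by
    by_contra hne
    have hne' : p + s - 1 ≠ 0 := sub_ne_zero.2 hne
    refine h0 ?_
    have hp : p = 0 := (mul_eq_zero.1 (show (p + s - 1) * p = 0 by
      linear_combination e00 + hdet)).resolve_left hne'
    have hq : q = 0 := (mul_eq_zero.1 (show (p + s - 1) * q = 0 by
      linear_combination e01)).resolve_left hne'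
    have hr : r = 0 := (mul_eq_zero.1 (show (p + s - 1) * r = 0 by
      linear_combination e10)).resolve_left hne'
    have hs : s = 0 := (mul_eq_zero.1 (show (p + s - 1) * s = 0 by
      linear_combination e11 + hdet)).resolve_left hne'
    subst hp hq hr hs
    ext i j
    fin_cases i <;> fin_cases j <;> rfl
  by_cases hpq : p ≠ 0 ∨ q ≠ 0
  · obtain ⟨g, a, c, rfl, rfl, x, y, hxy⟩ := exists_mul_coprime p q hpq
    have hg : g ≠ 0 := by
      rintro rfl
      simp at hpq
    have hac : a * s = c * r := mul_left_cancel₀ hg (by linear_combination hdet)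
    -- The second row (r, s) satisfies a s = c r, so it is a multiple of (a, c); the Bézout relation
    -- x a + y c = 1 gives the factor.
    refine ⟨![g, x * r + y * s], ![a, c], ?_, ?_⟩
    · ext i j
      fin_cases i <;> fin_cases j <;> simp [vecMulVec_apply]
      · linear_combination (-r) * hxy - y * hac
      · linear_combination (-s) * hxy + x * hac
    · simp [dotProduct, Fin.sum_univ_two]
      linear_combination htr + s * hxy - x * hac
  · push Not at hpq
    obtain ⟨rfl, rfl⟩ := hpq
    refine ⟨![0, 1], ![r, s], ?_, ?_⟩
    · ext i j
      fin_cases i <;> fin_cases j <;> simp [vecMulVec_apply]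
    · simpa [dotProduct, Fin.sum_univ_two] using htr

end MatrixIdem
end
end GroupConv

namespace GroupConv

noncomputable section

/-! ### Reduced encoders -/

section Reduced

open Matrix Polynomial

variable {F : Type*} [Field F] {n k : ℕ}

/-- Row rank equals column rank, so the columns span and k of them form a basis. -/
theorem exists_minor_ne_zero (L : Matrix (Fin k) (Fin n) F) (hL : LinearIndependent F L.row) :
    ∃ s : Fin k ↪ Fin n, (L.submatrix id s).det ≠ 0 := by
  have hr : L.rank = k := by simpa using hL.rank_matrix
  have hspan : Submodule.span F (Set.range L.col) = ⊤ := by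
    refine Submodule.eq_top_of_finrank_eq ?_
    rw [← rank_eq_finrank_span_cols, hr, Module.finrank_fin_fun]
  obtain ⟨κ, a, ha, hs, hli⟩ := exists_linearIndependent' F L.col
  have : Finite κ := Finite.of_injective a ha
  have := Fintype.ofFinite κ
  have hcard : Fintype.card κ = k := by
    have h := finrank_span_eq_card hli
    rw [hs, hspan, finrank_top, Module.finrank_fin_fun] at h
    exact h.symm
  let e : Fin k ≃ κ := (Fintype.equivFinOfCardEq hcard).symm
  refine ⟨⟨a ∘ e, ha.comp e.injective⟩, ?_⟩
  have h2 : LinearIndependent F (L.submatrix id (a ∘ e)).col := hli.comp e e.injective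
  exact ((isUnit_iff_isUnit_det _).1 (linearIndependent_cols_iff_isUnit.1 h2)).ne_zero

variable {M : Matrix (Fin k) (Fin n) F[X]} {t : ℕ}

theorem natDegree_det_le_of_forall_le {N : Matrix (Fin k) (Fin k) F[X]}
    (hN : ∀ i j, (N i j).natDegree ≤ t) : N.det.natDegree ≤ k * t := by
  rw [det_apply]
  refine natDegree_sum_le_of_forall_le _ _ fun p _ => ?_
  refine (natDegree_smul_le _ _).trans ((natDegree_prod_le _ _).trans ?_)
  refine (Finset.sum_le_sum fun i _ => hN (p i) i).trans ?_
  simp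

theorem coeff_det_of_forall_le {N : Matrix (Fin k) (Fin k) F[X]}
    (hN : ∀ i j, (N i j).natDegree ≤ t) :
    N.det.coeff (k * t) = (Matrix.of fun i j => (N i j).coeff t).det := by
  rw [det_apply, det_apply, finsetSum_coeff]
  refine Finset.sum_congr rfl fun p _ => ?_
  rw [coeff_smul]
  congr 1
  have h := coeff_prod_of_natDegree_le (s := Finset.univ) (fun i => N (p i) i) t
    (fun i _ => hN (p i) i)
  simpa using h

/-- The coefficient at k·t of a minor is the corresponding minor of the matrix of coefficients at t,
and one of those is nonzero. -/
theorem complexity_of_reduced (hM : ∀ i j, (M i j).natDegree ≤ t)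
    (hL : LinearIndependent F fun i j => (M i j).coeff t) : complexity M = k * t := by
  refine le_antisymm (Finset.sup_le fun s _ => natDegree_det_le_of_forall_le fun i j => hM _ _) ?_
  obtain ⟨s, hs⟩ := exists_minor_ne_zero (Matrix.of fun i j => (M i j).coeff t) hL
  refine le_trans ?_ (Finset.le_sup (Finset.mem_univ s))
  refine le_natDegree_of_ne_zero ?_
  rw [coeff_det_of_forall_le (N := M.submatrix id s) fun i j => hM _ _]
  exact hs

/-- Top terms cannot cancel: if d is the largest degree among the multipliers of a relation, its
coefficient at d + t is a relation among the leading rows. -/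
theorem linearIndependent_of_reduced (hM : ∀ i j, (M i j).natDegree ≤ t)
    (hL : LinearIndependent F fun i j => (M i j).coeff t) : LinearIndependent F[X] M.row := by
  rw [Fintype.linearIndependent_iff]
  intro p hp
  by_contra! hne
  obtain ⟨i₀, hi₀⟩ := hne
  set d := Finset.univ.sup fun i => (p i).natDegree with hd
  have hdeg : ∀ i, (p i).natDegree ≤ d := fun i =>
    Finset.le_sup (f := fun i => (p i).natDegree) (Finset.mem_univ i)
  obtain ⟨i₁, -, hi₁⟩ := Finset.exists_mem_eq_sup Finset.univ ⟨i₀, Finset.mem_univ _⟩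
    fun i => (p i).natDegree
  have hz : ∀ i, (p i).coeff d = 0 := by
    refine Fintype.linearIndependent_iff.1 hL (fun i => (p i).coeff d) ?_
    ext j
    have h := congr(($hp j).coeff (d + t))
    simp only [Finset.sum_apply, Pi.smul_apply, smul_eq_mul, finsetSum_coeff, Pi.zero_apply,
      coeff_zero] at h ⊢
    rw [← h]
    exact Finset.sum_congr rfl fun i _ => (coeff_mul_add_eq_of_natDegree_le (hdeg i) (hM i j)).symm
  have h1 : p i₁ = 0 := by
    rw [← leadingCoeff_eq_zero, leadingCoeff, ← hi₁]
    exact hz i₁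
  have h0 : d = 0 := by rw [hd, hi₁, h1, natDegree_zero]
  refine hi₀ ?_
  rw [eq_C_of_natDegree_le_zero (p := p i₀) (h0 ▸ hdeg i₀), ← h0, hz, C_0]

theorem rowDegree_of_reduced (hM : ∀ i j, (M i j).natDegree ≤ t)
    (hL : LinearIndependent F fun i j => (M i j).coeff t) (i : Fin k) :
    (Finset.univ.sup fun j => (M i j).natDegree) = t := by
  refine le_antisymm (Finset.sup_le fun j _ => hM i j) ?_
  obtain ⟨j, hj⟩ := Function.ne_iff.1 (hL.ne_zero i)
  exact (le_natDegree_of_ne_zero hj).trans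
    (Finset.le_sup (f := fun j => (M i j).natDegree) (Finset.mem_univ j))

theorem natDegree_mul_of_isUnit {u p : F[X]} (hu : IsUnit u) : (u * p).natDegree = p.natDegree := by
  by_cases hp : p = 0
  · simp [hp]
  · rw [natDegree_mul hu.ne_zero hp, natDegree_eq_zero_of_isUnit hu, zero_add]

theorem exists_mul_eq_of_rowCode_le {M N : Matrix (Fin k) (Fin n) F[X]}
    (h : rowCode M ≤ rowCode N) : ∃ U : Matrix (Fin k) (Fin k) F[X], M = U * N := by
  have h1 : ∀ i, ∃ c : Fin k → F[X], ∑ j, c j • N.row j = M.row i := fun i =>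
    (Submodule.mem_span_range_iff_exists_fun _).1 (h (Submodule.subset_span ⟨i, rfl⟩))
  choose U hU using h1
  refine ⟨Matrix.of U, ?_⟩
  ext1 i j
  have := congr($(hU i) j)
  simp only [Finset.sum_apply, Pi.smul_apply, smul_eq_mul] at this
  rw [mul_apply]
  exact this.symm

/-- Two encoders differ by an invertible square factor, which multiplies all maximal minors by one
unit of F[z]. -/
theorem complexity_eq_of_isEncoder {M N : Matrix (Fin k) (Fin n) F[X]}
    {C : Submodule F[X] (Fin n → F[X])} (hM : IsEncoder M C) (hN : IsEncoder N C) :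
    complexity M = complexity N := by
  obtain ⟨U, hU⟩ := exists_mul_eq_of_rowCode_le (hM.2.trans hN.2.symm).le
  obtain ⟨V, hV⟩ := exists_mul_eq_of_rowCode_le (hN.2.trans hM.2.symm).le
  have h1 : U * V = 1 := by
    have h2 : U * V * M = (1 : Matrix (Fin k) (Fin k) F[X]) * M := by rw [Matrix.mul_assoc, ← hV, ← hU, Matrix.one_mul]
    exact funext fun i => vecMul_injective_iff.2 hM.1 (congr_fun h2 i)
  have hu : IsUnit U.det := isUnit_det_of_right_inverse h1
  refine Finset.sup_congr rfl fun s _ => ?_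
  have : M.submatrix id s = U * N.submatrix id s := by
    rw [hU]; rfl
  rw [this, det_mul, natDegree_mul_of_isUnit hu]

theorem hasParameters_of_reduced {C : Submodule F[X] (Fin n → F[X])} (hC : IsConvCode C)
    (hMC : rowCode M = C) (hM : ∀ i j, (M i j).natDegree ≤ t)
    (hL : LinearIndependent F fun i j => (M i j).coeff t) :
    IsEncoder M C ∧ HasParameters n k (k * t) C ∧ HasForneyIndices C fun _ : Fin k => t := by
  have hE : IsEncoder M C := ⟨linearIndependent_of_reduced hM hL, hMC⟩
  have hc := complexity_of_reduced hM hL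
  refine ⟨hE, ⟨hC, ⟨M, hE⟩, fun N hN => ?_⟩, M, hE, rowDegree_of_reduced hM hL, ?_⟩
  · rw [complexity_eq_of_isEncoder hN hE, hc]
  · simp [hc]

end Reduced
end
end GroupConv

namespace GroupConv

noncomputable section

theorem fact_prime_five : Fact (Nat.Prime 5) := ⟨by norm_num⟩

attribute [local instance] fact_prime_five

/-! ### The irreducible representations of `S₃` over `F₅` -/

section Representations

open Matrix

/-- The algebra of `2 × 2` matrices over `F₅`. -/
abbrev M2 : Type := Matrix (Fin 2) (Fin 2) F5

/-- The trivial representation. -/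
def psiP : A5 →ₐ[F5] F5 := MonoidAlgebra.lift F5 F5 S3 1

/-- The sign representation. -/
def psiM : A5 →ₐ[F5] F5 :=
  MonoidAlgebra.lift F5 F5 S3
    { toFun := fun g => ((Equiv.Perm.sign g : ℤ) : F5)
      map_one' := by simp
      map_mul' := fun g h => by simp }

/-- The matrix of a permutation of `0, 1, 2` on the vectors of sum zero, with respect to the
basis `e₀ - e₁, e₂ - e₁`. -/
def stdMatrix (g : S3) : M2 :=
  Matrix.of fun r c =>
    (if g (![0, 2] c) = ![0, 2] r then 1 else 0) - (if g 1 = ![0, 2] r then 1 else 0)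

theorem stdMatrix_mul (g h : S3) : stdMatrix (g * h) = stdMatrix g * stdMatrix h := by
  revert g h
  decide

/-- The irreducible representation of degree two. -/
def psi2 : A5 →ₐ[F5] M2 :=
  MonoidAlgebra.lift F5 M2 S3
    { toFun := stdMatrix
      map_one' := by decide
      map_mul' := stdMatrix_mul }

@[simp]
theorem psiP_single (g : S3) (c : F5) : psiP (MonoidAlgebra.single g c) = c := by
  simp [psiP, MonoidAlgebra.lift_single]

@[simp]
theorem psiM_single (g : S3) (c : F5) :
    psiM (MonoidAlgebra.single g c) = c * ((Equiv.Perm.sign g : ℤ) : F5) := by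
  simp [psiM, MonoidAlgebra.lift_single]

@[simp]
theorem psi2_single (g : S3) (c : F5) : psi2 (MonoidAlgebra.single g c) = c • stdMatrix g := by
  simp [psi2, MonoidAlgebra.lift_single]

theorem psiP_elt (v : Fin 6 → F5) : psiP (elt v) = ∑ i, v i := by simp [elt]

theorem psiM_elt (v : Fin 6 → F5) :
    psiM (elt v) = ∑ i, v i * ((Equiv.Perm.sign (s3 i) : ℤ) : F5) := by simp [elt]

theorem psi2_elt (v : Fin 6 → F5) : psi2 (elt v) = ∑ i, v i • stdMatrix (s3 i) := by simp [elt]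

theorem elt_add (v w : Fin 6 → F5) : elt (v + w) = elt v + elt w := by
  simp [elt, Finset.sum_add_distrib]

theorem elt_smul (c : F5) (v : Fin 6 → F5) : elt (c • v) = c • elt v := by
  simp [elt, Finset.smul_sum]

theorem single_s3 (i : Fin 6) : MonoidAlgebra.single (s3 i) (1 : F5) = elt (Pi.single i 1) := by
  classical
  rw [elt, Finset.sum_eq_single i]
  · simp
  · intro b _ hb
    simp [hb]
  · simp

theorem swap_mul_elt (v : Fin 6 → F5) :
    MonoidAlgebra.single (Equiv.swap 0 2 : S3) (1 : F5) * elt v =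
      elt ![v 2, v 4, v 0, v 5, v 1, v 3] := by
  have h : ∀ i, (Equiv.swap 0 2 : S3) * s3 i = s3 (![2, 4, 0, 5, 1, 3] i) := by decide
  simp only [elt, Fin.sum_univ_six, mul_add, MonoidAlgebra.single_mul_single, h, one_mul]
  simp
  abel

theorem ε₃₄_eq : ε₃₄ = elt ![0, 0, 2, 3, 2, 3] := by
  rw [ε₃₄, ε₄, swap_mul_elt]; simp

theorem ε₄₃_eq : ε₄₃ = elt ![0, 3, 2, 0, 3, 2] := by
  rw [ε₄₃, ε₃, swap_mul_elt]; simp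

-- The following table shows that `ε₁`, `ε₂` are the idempotents of the two characters and `ε₃`,
-- `ε₃₄`, `ε₄₃`, `ε₄` the matrix units of the third block.
@[simp] theorem psiP_ε₁ : psiP ε₁ = 1 := by rw [ε₁, psiP_elt]; decide
@[simp] theorem psiP_ε₂ : psiP ε₂ = 0 := by rw [ε₂, psiP_elt]; decide
@[simp] theorem psiP_ε₃ : psiP ε₃ = 0 := by rw [ε₃, psiP_elt]; decide
@[simp] theorem psiP_ε₄ : psiP ε₄ = 0 := by rw [ε₄, psiP_elt]; decide
@[simp] theorem psiP_ε₃₄ : psiP ε₃₄ = 0 := by rw [ε₃₄_eq, psiP_elt]; decide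
@[simp] theorem psiP_ε₄₃ : psiP ε₄₃ = 0 := by rw [ε₄₃_eq, psiP_elt]; decide
@[simp] theorem psiM_ε₁ : psiM ε₁ = 0 := by rw [ε₁, psiM_elt]; decide
@[simp] theorem psiM_ε₂ : psiM ε₂ = 1 := by rw [ε₂, psiM_elt]; decide
@[simp] theorem psiM_ε₃ : psiM ε₃ = 0 := by rw [ε₃, psiM_elt]; decide
@[simp] theorem psiM_ε₄ : psiM ε₄ = 0 := by rw [ε₄, psiM_elt]; decide
@[simp] theorem psiM_ε₃₄ : psiM ε₃₄ = 0 := by rw [ε₃₄_eq, psiM_elt]; decide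
@[simp] theorem psiM_ε₄₃ : psiM ε₄₃ = 0 := by rw [ε₄₃_eq, psiM_elt]; decide
@[simp] theorem psi2_ε₁ : psi2 ε₁ = 0 := by rw [ε₁, psi2_elt]; decide
@[simp] theorem psi2_ε₂ : psi2 ε₂ = 0 := by rw [ε₂, psi2_elt]; decide
@[simp] theorem psi2_ε₃ : psi2 ε₃ = !![1, 0; 0, 0] := by rw [ε₃, psi2_elt]; decide
@[simp] theorem psi2_ε₄ : psi2 ε₄ = !![0, 0; 0, 1] := by rw [ε₄, psi2_elt]; decide
@[simp] theorem psi2_ε₃₄ : psi2 ε₃₄ = !![0, 1; 0, 0] := by rw [ε₃₄_eq, psi2_elt]; decide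
@[simp] theorem psi2_ε₄₃ : psi2 ε₄₃ = !![0, 0; 1, 0] := by rw [ε₄₃_eq, psi2_elt]; decide

/-- The element of the block of the two-dimensional representation with a given matrix. -/
def block : M2 →ₗ[F5] A5 where
  toFun N := N 0 0 • ε₃ + N 0 1 • ε₃₄ + N 1 0 • ε₄₃ + N 1 1 • ε₄
  map_add' N N' := by simp only [Matrix.add_apply, add_smul]; abel
  map_smul' c N := by
    simp only [Matrix.smul_apply, smul_eq_mul, mul_smul, smul_add, RingHom.id_apply]

theorem block_apply (N : M2) :
    block N = N 0 0 • ε₃ + N 0 1 • ε₃₄ + N 1 0 • ε₄₃ + N 1 1 • ε₄ := rfl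

@[simp] theorem psiP_block (N : M2) : psiP (block N) = 0 := by simp [block_apply]
@[simp] theorem psiM_block (N : M2) : psiM (block N) = 0 := by simp [block_apply]
@[simp] theorem psi2_block (N : M2) : psi2 (block N) = N := by
  simp only [block_apply, map_add, map_smul, psi2_ε₃, psi2_ε₄, psi2_ε₃₄, psi2_ε₄₃]
  ext i j
  fin_cases i <;> fin_cases j <;> simp

/-- This is the Wedderburn decomposition; by linearity it is a finite check on the six group
elements. It lets identities in A be verified block by block. -/
theorem eq_add_block (a : A5) : a = psiP a • ε₁ + psiM a • ε₂ + block (psi2 a) := by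
  suffices h : LinearMap.id = psiP.toLinearMap.smulRight ε₁ + psiM.toLinearMap.smulRight ε₂ +
      block ∘ₗ psi2.toLinearMap from congr($h a)
  refine MonoidAlgebra.lhom_ext' fun g => LinearMap.ext_ring ?_
  obtain ⟨i, rfl⟩ := s3.surjective g
  simp only [LinearMap.comp_apply, LinearMap.add_apply, LinearMap.smulRight_apply,
    AlgHom.toLinearMap_apply, LinearMap.id_apply, MonoidAlgebra.lsingle_apply, psiP_single,
    psiM_single, psi2_single, block_apply, one_smul, one_mul]
  rw [single_s3, ε₁, ε₂, ε₃, ε₄, ε₃₄_eq, ε₄₃_eq]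
  simp only [← elt_smul, ← elt_add]
  congr 1
  revert i
  decide

theorem psi_ext {a b : A5} (h1 : psiP a = psiP b) (h2 : psiM a = psiM b) (h3 : psi2 a = psi2 b) :
    a = b := by
  rw [eq_add_block a, eq_add_block b, h1, h2, h3]

theorem psi2_surjective : Function.Surjective psi2 := fun N => ⟨block N, psi2_block N⟩

theorem block_mul (N N' : M2) : block (N * N') = block N * block N' :=
  psi_ext (by simp) (by simp) (by simp)

theorem ε₁_mul (a : A5) : ε₁ * a = psiP a • ε₁ := psi_ext (by simp) (by simp) (by simp)

theorem ε₂_mul (a : A5) : ε₂ * a = psiM a • ε₂ := psi_ext (by simp) (by simp) (by simp)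

theorem block_one : block 1 = 1 - ε₁ - ε₂ := psi_ext (by simp) (by simp) (by simp)

theorem signAut_single (g : S3) (c : F5) :
    signAut (MonoidAlgebra.single g c) =
      MonoidAlgebra.single g (c * ((Equiv.Perm.sign g : ℤ) : F5)) := signHom_single g c

end Representations

/-! ### The automorphisms of `F₅[S₃]` -/

section Automorphisms

open Matrix

theorem psiP_signAut (a : A5) : psiP (signAut a) = psiM a := by
  suffices h : psiP.comp (signAut : A5 →ₐ[F5] A5) = psiM from congr($h a)
  refine MonoidAlgebra.algHom_ext (fun g => ?_) (Subsingleton.elim _ _)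
  simp [signAut_single]

theorem psiM_signAut (a : A5) : psiM (signAut a) = psiP a := by
  suffices h : psiM.comp (signAut : A5 →ₐ[F5] A5) = psiP from congr($h a)
  refine MonoidAlgebra.algHom_ext (fun g => ?_) (Subsingleton.elim _ _)
  have h : ((Equiv.Perm.sign g : ℤ) : F5) * ((Equiv.Perm.sign g : ℤ) : F5) = 1 := by
    rw [← Int.cast_mul, ← Units.val_mul, Int.units_mul_self]; simp
  simp [signAut_single, h]

/-- The matrix that induces the sign automorphism on the block of dimension four. -/
def signMatrix : M2 := !![2, 4; 1, 3]

/-- The order of the factors mirrors a z = z σ(a), so that z may be sent to x times this matrix. -/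
theorem psi2_mul_signMatrix (a : A5) : psi2 a * signMatrix = signMatrix * psi2 (signAut a) := by
  suffices h : (LinearMap.mulRight F5 signMatrix) ∘ₗ psi2.toLinearMap =
      (LinearMap.mulLeft F5 signMatrix) ∘ₗ psi2.toLinearMap ∘ₗ signAut.toLinearMap from
    congr($h a)
  refine MonoidAlgebra.lhom_ext' fun g => LinearMap.ext_ring ?_
  simp only [LinearMap.comp_apply, MonoidAlgebra.lsingle_apply, AlgHom.toLinearMap_apply,
    AlgEquiv.toLinearMap_apply, signAut_single, psi2_single, LinearMap.mulRight_apply,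
    LinearMap.mulLeft_apply]
  revert g
  decide

/-- All of M₂ acts from the right on the line through c by scalars, so c annihilates commutators;
one of them, diag(1, -1), is invertible. -/
theorem eq_zero_of_forall_mul_mem_line (h : A5 →ₐ[F5] M2) (hs : Function.Surjective h) (c : M2)
    (hc : ∀ a, ∃ k : F5, c * h a = k • c) : c = 0 := by
  have hcomm : ∀ N N' : M2, c * (N * N' - N' * N) = 0 := by
    intro N N'
    obtain ⟨a, rfl⟩ := hs N
    obtain ⟨b, rfl⟩ := hs N'
    obtain ⟨k, hk⟩ := hc a
    obtain ⟨l, hl⟩ := hc b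
    rw [mul_sub, ← mul_assoc, ← mul_assoc, hk, hl, smul_mul_assoc, smul_mul_assoc, hk, hl,
      smul_smul, smul_smul, mul_comm k l, sub_self]
  have h2 := hcomm !![0, 1; 0, 0] !![0, 0; 1, 0]
  have h3 : (!![0, 1; 0, 0] * !![0, 0; 1, 0] - !![0, 0; 1, 0] * !![0, 1; 0, 0] : M2) =
      !![1, 0; 0, -1] := by decide
  have h4 : (!![1, 0; 0, -1] * !![1, 0; 0, -1] : M2) = 1 := by decide
  rw [h3] at h2
  rw [← mul_one c, ← h4, ← mul_assoc, h2, zero_mul]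

/-- Skolem–Noether, through End(Kⁿ): the automorphism is conjugation by a linear equivalence T, and
m is the matrix of T⁻¹ because of the order of the factors. -/
theorem exists_conj_of_matrixAlgEquiv {K n : Type*} [Field K] [Fintype n] [DecidableEq n]
    (e : Matrix n n K ≃ₐ[K] Matrix n n K) :
    ∃ m : Matrix n n K, IsUnit m ∧ ∀ N, N * m = m * e N := by
  let L : Matrix n n K ≃ₐ[K] Module.End K (n → K) := Matrix.toLinAlgEquiv'
  obtain ⟨T, hT⟩ := ((L.symm.trans e).trans L).eq_linearEquivConjAlgEquiv
  have hL : ∀ N, L (e N) = T.toLinearMap ∘ₗ L N ∘ₗ T.symm.toLinearMap := by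
    intro N
    have h := congr($hT (L N))
    simpa [LinearEquiv.conjAlgEquiv_apply] using h
  refine ⟨L.symm T.symm.toLinearMap, ?_, fun N => L.injective ?_⟩
  · refine IsUnit.map L.symm ?_
    refine ⟨⟨T.symm.toLinearMap, T.toLinearMap, ?_, ?_⟩, rfl⟩
    · refine LinearMap.ext fun x => ?_
      simp
    · refine LinearMap.ext fun x => ?_
      simp
  · rw [map_mul, map_mul, L.apply_symm_apply, hL]
    refine LinearMap.ext fun x => ?_
    simp

theorem exists_conj_of_algHom (τ : M2 →ₐ[F5] M2) (hτ : Function.Surjective τ) :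
    ∃ m : M2, IsUnit m ∧ ∀ N, N * m = m * τ N :=
  exists_conj_of_matrixAlgEquiv (K := ZMod 5)
    (AlgEquiv.ofBijective τ ⟨Finite.injective_iff_surjective.2 hτ, hτ⟩)

/-- A homomorphism to a field kills commutators, one of which is invertible in the matrix block,
hence kills that block. What remains is decided by the idempotent value at `ε₁`. -/
theorem algHom_eq_psiP_or_psiM (h : A5 →ₐ[F5] F5) : h = psiP ∨ h = psiM := by
  have hb : ∀ N, h (block N) = 0 := by
    have hcomm : ∀ N N', h (block (N * N' - N' * N)) = 0 := by
      intro N N'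
      rw [map_sub, block_mul, block_mul, map_sub, map_mul, map_mul, mul_comm, sub_self]
    intro N
    have h2 := hcomm !![0, 1; 0, 0] !![0, 0; 1, 0]
    have h3 : (!![0, 1; 0, 0] * !![0, 0; 1, 0] - !![0, 0; 1, 0] * !![0, 1; 0, 0] : M2) =
        !![1, 0; 0, -1] := by decide
    have h4 : (!![1, 0; 0, -1] * !![1, 0; 0, -1] : M2) = 1 := by decide
    rw [h3] at h2
    rw [← mul_one N, ← h4, block_mul, block_mul, map_mul, map_mul, h2]
    simp
  have ha : ∀ a, h a = psiP a * h ε₁ + psiM a * h ε₂ := by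
    intro a
    conv_lhs => rw [eq_add_block a]
    simp [hb]
  have h12 : h ε₁ + h ε₂ = 1 := by
    have := ha 1
    simpa using this.symm
  have hi : h ε₁ * h ε₁ = h ε₁ := by rw [← map_mul, ε₁_mul, psiP_ε₁, one_smul]
  rcases IsIdempotentElem.iff_eq_zero_or_one.1 (show IsIdempotentElem (h ε₁) from hi) with h1 | h1
  · right
    refine AlgHom.ext fun a => ?_
    rw [h1, zero_add] at h12
    rw [ha, h1, h12]; simp
  · left
    refine AlgHom.ext fun a => ?_
    rw [h1, add_eq_left] at h12
    rw [ha, h1, h12]; simp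

/-- Every automorphism of `F₅[S₃]` is inner on the block of dimension four and fixes or
interchanges the two one-dimensional representations. -/
theorem exists_matrix_of_aut (σ : A5 ≃ₐ[F5] A5) :
    (∃ m : M2, IsUnit m ∧ ∀ a, psi2 a * m = m * psi2 (σ a)) ∧
      ((∀ a, psiP (σ a) = psiP a ∧ psiM (σ a) = psiM a) ∨
        (∀ a, psiP (σ a) = psiM a ∧ psiM (σ a) = psiP a)) := by
  constructor
  · let h : A5 →ₐ[F5] M2 := psi2.comp σ
    have hs : Function.Surjective h := psi2_surjective.comp σ.surjective
    -- The right ideal `ε₁` A is a line, so its image in M₂ is a line or zero, and a line is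
    -- impossible.
    have h1 : psi2 (σ ε₁) = 0 := eq_zero_of_forall_mul_mem_line h hs _ fun a =>
      ⟨psiP a, by
        change psi2 (σ ε₁) * psi2 (σ a) = _
        rw [← map_mul, ← map_mul, ε₁_mul, map_smul, map_smul]⟩
    have h2 : psi2 (σ ε₂) = 0 := eq_zero_of_forall_mul_mem_line h hs _ fun a =>
      ⟨psiM a, by
        change psi2 (σ ε₂) * psi2 (σ a) = _
        rw [← map_mul, ← map_mul, ε₂_mul, map_smul, map_smul]⟩
    have hb : ∀ a, psi2 (σ a) = psi2 (σ (block (psi2 a))) := by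
      intro a
      conv_lhs => rw [eq_add_block a]
      simp [h1, h2]
    -- As `psi2 ∘ σ` vanishes on the one-dimensional blocks, it descends along `psi2`.
    let τ : M2 →ₐ[F5] M2 := AlgHom.ofLinearMap (h.toLinearMap ∘ₗ block)
      (by change psi2 (σ (block 1)) = 1; rw [block_one]; simp [h1, h2])
      (fun N N' => by
        change psi2 (σ (block (N * N'))) = psi2 (σ (block N)) * psi2 (σ (block N'))
        rw [block_mul, map_mul, map_mul])
    have hτ : ∀ a, psi2 (σ a) = τ (psi2 a) := hb
    have hτs : Function.Surjective τ := by
      intro N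
      obtain ⟨a, ha⟩ := hs N
      exact ⟨psi2 a, (hτ a).symm.trans ha⟩
    obtain ⟨m, hm, hmτ⟩ := exists_conj_of_algHom τ hτs
    exact ⟨m, hm, fun a => by rw [hmτ, hτ]⟩
  · have hne : psiP ≠ psiM := fun h => by
      have := congr($h ε₁)
      simp at this
    have hne' : psiP.comp (σ : A5 →ₐ[F5] A5) ≠ psiM.comp (σ : A5 →ₐ[F5] A5) := fun h => by
      refine hne (AlgHom.ext fun a => ?_)
      have := congr($h (σ.symm a))
      simpa using this
    rcases algHom_eq_psiP_or_psiM (psiP.comp (σ : A5 →ₐ[F5] A5)) with h1 | h1 <;>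
      rcases algHom_eq_psiP_or_psiM (psiM.comp (σ : A5 →ₐ[F5] A5)) with h2 | h2
    · exact absurd (h1.trans h2.symm) hne'
    · exact Or.inl fun a => ⟨congr($h1 a), congr($h2 a)⟩
    · exact Or.inr fun a => ⟨congr($h1 a), congr($h2 a)⟩
    · exact absurd (h1.trans h2.symm) hne'

end Automorphisms
end
end GroupConv

namespace GroupConv

noncomputable section

attribute [local instance] fact_prime_five

/-! ### Homomorphisms from `F₅[S₃][z; σ]` to matrices -/

section Homs

open Matrix Polynomial

/-- The algebra of `2 × 2` matrices over `F₅[x]`. -/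
abbrev M2X : Type := Matrix (Fin 2) (Fin 2) F5[X]

/-- Constant matrices. -/
def constMatrix : M2 →+* M2X := (Polynomial.C : F5 →+* F5[X]).mapMatrix

@[simp]
theorem constMatrix_apply (N : M2) (i j : Fin 2) : constMatrix N i j = C (N i j) := rfl

theorem constMatrix_smul (c : F5) (N : M2) : constMatrix (c • N) = C c • constMatrix N := by
  ext1 i j
  simp

variable {σ : A5 ≃ₐ[F5] A5}

theorem hom_polyHom {B : Type*} [Ring B] [Algebra F5 B] (φ : SkewPoly σ →+* B)
    (h : ∀ c : F5, φ (const σ (algebraMap F5 A5 c)) = algebraMap F5 B c) (p : F5[X]) :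
    φ (polyHom σ p) = aeval (φ (zvar σ)) p := by
  induction p using Polynomial.induction_on' with
  | add p q hp hq => simp [hp, hq]
  | monomial j c =>
    rw [polyHom_monomial, map_mul, map_pow, h, aeval_monomial]
    exact (Algebra.commutes _ _).symm

theorem rho_mul_C (f : F5[X]) (v : Fin 6 → F5) :
    rho s3 σ (fun i => f * C (v i)) = polyHom σ f * const σ (elt v) := by
  rw [rho_eq_sum, elt, map_sum, Finset.mul_sum]
  refine Finset.sum_congr rfl fun i _ => ?_
  rw [map_mul, mul_assoc, polyHom_C, ← map_mul, ← Algebra.smul_def, MonoidAlgebra.smul_single,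
    smul_eq_mul, mul_one]

/-! #### The component of the two-dimensional representation -/

variable {m : M2}

theorem aeval_X_smul_monomial (j : ℕ) (c : F5) :
    aeval ((X : F5[X]) • constMatrix m) (monomial j c) =
      monomial j c • constMatrix (m ^ j) := by
  rw [aeval_monomial, _root_.smul_pow, ← map_pow, ← C_mul_X_pow_eq_monomial, mul_smul,
    ← Algebra.smul_def, ← algebraMap_smul F5[X] c, Polynomial.algebraMap_eq]

/-- Since z acts as x·m with m invertible, the column xʲv is zʲ applied to the constant column m⁻ʲv.
The scalars s, s' leave room for the factor 4 in the explicit encoders. -/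
theorem exists_aeval_mulVec (hm : IsUnit m) {s s' : F5} (hs : s ≠ 0) (hs' : s' ≠ 0)
    (w : Fin 2 → F5[X]) :
    ∃ p q : F5[X], w = aeval ((X : F5[X]) • constMatrix m) p *ᵥ ![C s, 0] +
      aeval ((X : F5[X]) • constMatrix m) q *ᵥ ![0, C s'] := by
  have hadd : ∀ w w' : Fin 2 → F5[X],
      (∃ p q : F5[X], w = aeval ((X : F5[X]) • constMatrix m) p *ᵥ ![C s, 0] +
        aeval ((X : F5[X]) • constMatrix m) q *ᵥ ![0, C s']) →
      (∃ p q : F5[X], w' = aeval ((X : F5[X]) • constMatrix m) p *ᵥ ![C s, 0] +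
        aeval ((X : F5[X]) • constMatrix m) q *ᵥ ![0, C s']) →
      ∃ p q : F5[X], w + w' = aeval ((X : F5[X]) • constMatrix m) p *ᵥ ![C s, 0] +
        aeval ((X : F5[X]) • constMatrix m) q *ᵥ ![0, C s'] := by
    rintro _ _ ⟨p, q, rfl⟩ ⟨p', q', rfl⟩
    refine ⟨p + p', q + q', ?_⟩
    rw [map_add, map_add, add_mulVec, add_mulVec]
    abel
  have hmon : ∀ (j : ℕ) (v : Fin 2 → F5),
      ∃ p q : F5[X], (fun i => monomial j (v i)) =
        aeval ((X : F5[X]) • constMatrix m) p *ᵥ ![C s, 0] +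
        aeval ((X : F5[X]) • constMatrix m) q *ᵥ ![0, C s'] := by
    intro j v
    obtain ⟨v', rfl⟩ := mulVec_surjective_iff_isUnit.2 (hm.pow j) v
    refine ⟨monomial j (v' 0 * s⁻¹), monomial j (v' 1 * s'⁻¹), ?_⟩
    have h1 : v' 0 * s⁻¹ * s = v' 0 := inv_mul_cancel_right₀ hs _
    have h2 : v' 1 * s'⁻¹ * s' = v' 1 := inv_mul_cancel_right₀ hs' _
    rw [aeval_X_smul_monomial, aeval_X_smul_monomial]
    ext1 i
    simp only [mulVec, dotProduct, Fin.sum_univ_two, Pi.add_apply, Matrix.smul_apply, smul_eq_mul,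
      constMatrix_apply, cons_val_zero, cons_val_one, mul_zero, add_zero, zero_add]
    simp only [monomial_mul_C, ← map_add]
    congr 1
    linear_combination (-(m ^ j) i 0) * h1 - (m ^ j) i 1 * h2
  have hw : w = ![w 0, 0] + ![0, w 1] := by
    ext1 i
    fin_cases i <;> simp
  rw [hw]
  refine hadd _ _ ?_ ?_
  · generalize w 0 = f
    induction f using Polynomial.induction_on' with
    | add f g hf hg =>
      have := hadd _ _ hf hg
      simpa using this
    | monomial j c =>
      have h : ![monomial j c, 0] = fun i => monomial j ((![c, 0] : Fin 2 → F5) i) := by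
        ext1 i
        fin_cases i <;> simp
      exact h ▸ hmon j ![c, 0]
  · generalize w 1 = f
    induction f using Polynomial.induction_on' with
    | add f g hf hg =>
      have := hadd _ _ hf hg
      simpa using this
    | monomial j c =>
      have h : ![0, monomial j c] = fun i => monomial j ((![0, c] : Fin 2 → F5) i) := by
        ext1 i
        fin_cases i <;> simp
      exact h ▸ hmon j ![0, c]

section Component2

variable {φ : SkewPoly σ →+* M2X}

theorem hom2_algebraMap (hc : ∀ a, φ (const σ a) = constMatrix (psi2 a)) (c : F5) :
    φ (const σ (algebraMap F5 A5 c)) = algebraMap F5 M2X c := by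
  rw [hc, AlgHom.commutes]
  ext1 i j
  simp [Matrix.algebraMap_matrix_apply]
  split_ifs <;> simp

theorem hom2_polyHom (hz : φ (zvar σ) = (X : F5[X]) • constMatrix m)
    (hc : ∀ a, φ (const σ a) = constMatrix (psi2 a)) (p : F5[X]) :
    φ (polyHom σ p) = aeval ((X : F5[X]) • constMatrix m) p := by
  rw [hom_polyHom φ (hom2_algebraMap hc), hz]

/-- The coefficient at xʲ depends only on the one at zʲ, through mʲ. With m invertible, degrees in x
and in z can be compared. -/
theorem coeff_hom2 (hz : φ (zvar σ) = (X : F5[X]) • constMatrix m)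
    (hc : ∀ a, φ (const σ a) = constMatrix (psi2 a)) (r : SkewPoly σ) (j : ℕ) (k l : Fin 2) :
    (φ r k l).coeff j = (m ^ j * psi2 (zcoeff σ j r)) k l := by
  induction r using skew_induction with
  | h0 => simp
  | hadd p q hp hq => simp [hp, hq, mul_add]
  | hmon i a =>
    rw [map_mul, map_pow, hz, hc, _root_.smul_pow, ← map_pow, smul_mul_assoc, ← map_mul,
      zcoeff_zvar_pow_mul_const, Matrix.smul_apply, smul_eq_mul, constMatrix_apply,
      X_pow_mul_C, coeff_C_mul_X_pow]
    by_cases h : i = j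
    · subst h; simp
    · rw [if_neg h, if_neg (Ne.symm h)]; simp

theorem psi2_zcoeff_eq_zero (hz : φ (zvar σ) = (X : F5[X]) • constMatrix m)
    (hc : ∀ a, φ (const σ a) = constMatrix (psi2 a)) (hm : IsUnit m) {r : SkewPoly σ} {j : ℕ}
    (h : ∀ k l, (φ r k l).coeff j = 0) : psi2 (zcoeff σ j r) = 0 := by
  refine (hm.pow j).mul_right_injective ?_
  ext1 k l
  simp only
  rw [← coeff_hom2 hz hc, h, mul_zero, Matrix.zero_apply]

/-- Each column of N is produced separately. The preimage is recorded as a left combination of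
elements of the matrix block, so that it will vanish in the other component. -/
theorem exists_hom2_eq (hz : φ (zvar σ) = (X : F5[X]) • constMatrix m)
    (hc : ∀ a, φ (const σ a) = constMatrix (psi2 a)) (hm : IsUnit m) (N : M2X) :
    ∃ r : SkewPoly σ, φ r = N ∧ ∃ p : Fin 2 → Fin 2 → F5[X], r =
      ∑ k, ∑ l, polyHom σ (p k l) * const σ (block (Matrix.single k l 1)) := by
  obtain ⟨p, q, h1⟩ := exists_aeval_mulVec hm one_ne_zero one_ne_zero (fun i => N i 0)
  obtain ⟨p', q', h2⟩ := exists_aeval_mulVec hm one_ne_zero one_ne_zero (fun i => N i 1)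
  refine ⟨_, ?_, ![![p, p'], ![q, q']], rfl⟩
  simp only [map_sum, map_mul, hom2_polyHom hz hc, hc, psi2_block]
  ext1 i j
  have h1' := congr_fun h1 i
  have h2' := congr_fun h2 i
  simp only [mulVec, dotProduct, Fin.sum_univ_two, Pi.add_apply, cons_val_zero,
    cons_val_one, map_one, mul_one, mul_zero, add_zero, zero_add] at h1' h2'
  fin_cases j
  · simp [Fin.sum_univ_two, Matrix.mul_apply, Matrix.single_apply, h1']
  · simp [Fin.sum_univ_two, Matrix.mul_apply, Matrix.single_apply, h2']

end Component2

/-! #### Polynomials as sums of an even and an odd part -/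

/-- The polynomial `f₀(z²) + z f₁(z²)`. -/
def interleave (f₀ f₁ : F5[X]) : F5[X] := expand F5 2 f₀ + X * expand F5 2 f₁

theorem exists_interleave (f : F5[X]) : ∃ f₀ f₁, f = interleave f₀ f₁ := by
  induction f using Polynomial.induction_on' with
  | add p q hp hq =>
    obtain ⟨f₀, f₁, rfl⟩ := hp
    obtain ⟨g₀, g₁, rfl⟩ := hq
    refine ⟨f₀ + g₀, f₁ + g₁, ?_⟩
    simp only [interleave, map_add]
    ring
  | monomial j c =>
    obtain ⟨k, rfl | rfl⟩ := Nat.even_or_odd' j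
    · exact ⟨monomial k c, 0, by simp [interleave, expand_monomial, mul_comm]⟩
    · exact ⟨0, monomial k c, by simp [interleave, expand_monomial, mul_comm, add_comm]⟩

theorem reflect_interleave (f₀ f₁ : F5[X]) :
    reflect (interleave f₀ f₁) = expand F5 2 f₀ - X * expand F5 2 f₁ := by
  have h : ∀ p : F5[X], (expand F5 2 p).comp (-X) = expand F5 2 p := by
    intro p
    rw [expand_eq_comp_X_pow, comp_assoc]
    simp
  simp only [reflect, interleave, add_comp, mul_comp, X_comp, h]
  ring

/-- The image of `z` in the component of the two one-dimensional representations, when these are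
interchanged. -/
def swapMatrix : M2X := !![0, 1; X, 0]

theorem swapMatrix_sq : swapMatrix ^ 2 = algebraMap F5[X] M2X X := by
  rw [swapMatrix, pow_two, mul_fin_two]
  ext1 i j
  fin_cases i <;> fin_cases j <;> simp [Matrix.algebraMap_matrix_apply]

theorem aeval_swapMatrix_expand (p : F5[X]) :
    aeval swapMatrix (expand F5 2 p) = algebraMap F5[X] M2X p := by
  rw [expand_aeval, swapMatrix_sq, aeval_algebraMap_apply, aeval_X_left_apply]

/-- The square of z is the scalar x, so the even part becomes a scalar matrix and the odd part a
multiple of `swapMatrix`. -/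
theorem aeval_swapMatrix_interleave (p₀ p₁ : F5[X]) :
    aeval swapMatrix (interleave p₀ p₁) = !![p₀, p₁; X * p₁, p₀] := by
  rw [interleave, map_add, map_mul, aeval_X, aeval_swapMatrix_expand, aeval_swapMatrix_expand,
    swapMatrix, Algebra.algebraMap_eq_smul_one, Algebra.algebraMap_eq_smul_one, mul_smul_comm,
    mul_one]
  ext1 i j
  fin_cases i <;> fin_cases j <;> simp [mul_comm]

theorem interleave_injective {f₀ f₁ g₀ g₁ : F5[X]} (h : interleave f₀ f₁ = interleave g₀ g₁) :
    f₀ = g₀ ∧ f₁ = g₁ := by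
  have h2 := congr(aeval swapMatrix $h)
  rw [aeval_swapMatrix_interleave, aeval_swapMatrix_interleave] at h2
  exact ⟨congr($h2 0 0), congr($h2 0 1)⟩

/-- The two polynomials are f₀(z²) ± z f₁(z²). A Bézout relation with multipliers s, t becomes (s +
t) f₀(z²) + z (s - t) f₁(z²) = 1, whose even part is the relation on the right. -/
theorem isCoprime_reflect_iff (f₀ f₁ : F5[X]) :
    IsCoprime (interleave f₀ f₁) (reflect (interleave f₀ f₁)) ↔ IsCoprime f₀ (X * f₁) := by
  have h5 : (5 : F5[X]) = 0 := by
    have : ((5 : ℕ) : F5[X]) = 0 := CharP.cast_eq_zero _ 5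
    exact_mod_cast this
  rw [reflect_interleave]
  constructor
  · rintro ⟨s, t, h⟩
    obtain ⟨a₀, a₁, ha⟩ := exists_interleave (s + t)
    obtain ⟨b₀, b₁, hb⟩ := exists_interleave (s - t)
    have h1 : interleave (a₀ * f₀ + X * (b₁ * f₁)) (a₁ * f₀ + b₀ * f₁) = interleave 1 0 := by
      simp only [interleave, map_add, map_mul, expand_X, map_one, map_zero] at h ha hb ⊢
      linear_combination h - expand F5 2 f₀ * ha - X * expand F5 2 f₁ * hb
    exact ⟨a₀, b₁, by linear_combination (interleave_injective h1).1⟩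
  · rintro ⟨s, t, h⟩
    have h1 := congr(expand F5 2 $h)
    simp only [map_add, map_mul, expand_X, map_one] at h1
    -- The odd cross terms cancel and the rest doubles; 3 is the inverse of 2 modulo 5.
    refine ⟨3 * (expand F5 2 s + X * expand F5 2 t), 3 * (expand F5 2 s - X * expand F5 2 t), ?_⟩
    simp only [interleave]
    linear_combination 6 * h1 + h5

end Homs
end
end GroupConv

namespace GroupConv

noncomputable section

attribute [local instance] fact_prime_five

/-! ### Decompositions of `F₅[S₃][z; σ]` -/

section Decomposition

open Matrix Polynomial

variable {T : Type*} [Ring T] {σ : A5 ≃ₐ[F5] A5} {m : M2}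

/-- A homomorphism to `T × M₂(F₅[x])` that maps `z` to `x m` in the second component and separates
the two one-dimensional representations in the first one. -/
structure IsDecomposition (Φ : SkewPoly σ →+* T × M2X) (m : M2) : Prop where
  isUnit : IsUnit m
  zvar_snd : (Φ (zvar σ)).2 = (X : F5[X]) • constMatrix m
  const_snd : ∀ a, (Φ (const σ a)).2 = constMatrix (psi2 a)
  const_fst : ∀ a, psiP a = 0 → psiM a = 0 → (Φ (const σ a)).1 = 0
  zcoeff_fst : ∀ r, (Φ r).1 = 0 → ∀ j, psiP (zcoeff σ j r) = 0 ∧ psiM (zcoeff σ j r) = 0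

/-- Codes that correspond to the left ideals of `M₂(F₅[x])` of the matrices with rows in the
span of `(a, c)`. -/
def IsRowSpanCode (Φ : SkewPoly σ →+* T × M2X) (a c : F5[X])
    (C : Submodule F5[X] (Fin 6 → F5[X])) : Prop :=
  ∀ y, y ∈ C ↔ ∃ w : Fin 2 → F5[X], Φ (rho s3 σ y) = (0, vecMulVec w ![a, c])

namespace IsDecomposition

variable {Φ : SkewPoly σ →+* T × M2X} (h : IsDecomposition Φ m)

/-- The second component of a homomorphism to a product. -/
abbrev sndHom (Φ : SkewPoly σ →+* T × M2X) : SkewPoly σ →+* M2X := (RingHom.snd T M2X).comp Φ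

theorem psi2_zcoeff (h : IsDecomposition Φ m) {r : SkewPoly σ} {j : ℕ}
    (hr : ∀ k l, ((Φ r).2 k l).coeff j = 0) : psi2 (zcoeff σ j r) = 0 :=
  psi2_zcoeff_eq_zero (φ := sndHom Φ) h.zvar_snd h.const_snd h.isUnit hr

theorem zcoeff_eq_zero (h : IsDecomposition Φ m) {r : SkewPoly σ} {j : ℕ} (h1 : (Φ r).1 = 0)
    (hr : ∀ k l, ((Φ r).2 k l).coeff j = 0) : zcoeff σ j r = 0 :=
  psi_ext (by rw [(h.zcoeff_fst r h1 j).1, map_zero]) (by rw [(h.zcoeff_fst r h1 j).2, map_zero])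
    (by rw [h.psi2_zcoeff hr, map_zero])

theorem injective (h : IsDecomposition Φ m) : Function.Injective Φ := by
  rw [injective_iff_map_eq_zero]
  intro r hr
  refine skew_ext fun j => ?_
  rw [h.zcoeff_eq_zero (by rw [hr]; rfl) (by simp [hr]), map_zero]

theorem exists_eq_zero_snd (h : IsDecomposition Φ m) (N : M2X) :
    ∃ r : SkewPoly σ, Φ r = (0, N) := by
  obtain ⟨r, hr, p, rfl⟩ := exists_hom2_eq (φ := sndHom Φ) h.zvar_snd h.const_snd h.isUnit N
  refine ⟨_, Prod.ext ?_ hr⟩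
  change RingHom.fst T M2X _ = 0
  simp only [map_sum, map_mul]
  refine Finset.sum_eq_zero fun k _ => Finset.sum_eq_zero fun l _ => ?_
  have : RingHom.fst T M2X (Φ (const σ (block (Matrix.single k l 1)))) = 0 :=
    h.const_fst _ (psiP_block _) (psiM_block _)
  rw [this, mul_zero]

theorem bijective (h : IsDecomposition Φ m) (hs : ∀ t : T, ∃ r, Φ r = (t, 0)) :
    Function.Bijective Φ := by
  refine ⟨h.injective, fun x => ?_⟩
  obtain ⟨r, hr⟩ := hs x.1
  obtain ⟨r', hr'⟩ := h.exists_eq_zero_snd x.2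
  exact ⟨r + r', by rw [map_add, hr, hr']; simp⟩

theorem polyHom_mul_of_fst_eq_zero (h : IsDecomposition Φ m) {r : SkewPoly σ} (p : F5[X])
    {N : M2X} (hr : Φ r = (0, N)) :
    Φ (polyHom σ p * r) = (0, aeval ((X : F5[X]) • constMatrix m) p * N) := by
  have h2 : (Φ (polyHom σ p)).2 = aeval ((X : F5[X]) • constMatrix m) p :=
    hom2_polyHom (φ := sndHom Φ) h.zvar_snd h.const_snd p
  rw [map_mul, hr]
  refine Prod.ext ?_ ?_
  · simp
  · simp [h2]

theorem mem_rowCode_fin_two {R : Type*} [CommRing R] {M : Matrix (Fin 2) (Fin 6) R} (y : Fin 6 → R) :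
    y ∈ Submodule.span R (Set.range M.row) ↔ ∃ p q : R, y = p • M 0 + q • M 1 := by
  rw [Submodule.mem_span_range_iff_exists_fun]
  constructor
  · rintro ⟨c, rfl⟩
    exact ⟨c 0, c 1, by simp [Fin.sum_univ_two, Matrix.row]⟩
  · rintro ⟨p, q, rfl⟩
    exact ⟨![p, q], by simp [Fin.sum_univ_two, Matrix.row]⟩

variable {M : Matrix (Fin 2) (Fin 6) F5[X]} {a c : F5[X]} {s s' : F5}

theorem map_rho_combination (h : IsDecomposition Φ m)
    (h0 : Φ (rho s3 σ (M 0)) = (0, vecMulVec ![C s, 0] ![a, c]))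
    (h1 : Φ (rho s3 σ (M 1)) = (0, vecMulVec ![0, C s'] ![a, c])) (p q : F5[X]) :
    Φ (rho s3 σ (p • M 0 + q • M 1)) =
      (0, vecMulVec (aeval ((X : F5[X]) • constMatrix m) p *ᵥ ![C s, 0] +
        aeval ((X : F5[X]) • constMatrix m) q *ᵥ ![0, C s']) ![a, c]) := by
  rw [rho_add, rho_smul, rho_smul, map_add, h.polyHom_mul_of_fst_eq_zero p h0,
    h.polyHom_mul_of_fst_eq_zero q h1, mul_vecMulVec, mul_vecMulVec, Prod.mk_add_mk, add_zero,
    add_vecMulVec]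

/-- Multiplication by F[z] changes only the column factor w, and the two constant columns generate
all w by `exists_aeval_mulVec`. -/
theorem isRowSpanCode_rowCode (h : IsDecomposition Φ m) (hs : s ≠ 0) (hs' : s' ≠ 0)
    (h0 : Φ (rho s3 σ (M 0)) = (0, vecMulVec ![C s, 0] ![a, c]))
    (h1 : Φ (rho s3 σ (M 1)) = (0, vecMulVec ![0, C s'] ![a, c])) :
    IsRowSpanCode Φ a c (rowCode M) := by
  intro y
  rw [rowCode, mem_rowCode_fin_two]
  constructor
  · rintro ⟨p, q, rfl⟩
    exact ⟨_, h.map_rho_combination h0 h1 p q⟩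
  · rintro ⟨w, hw⟩
    obtain ⟨p, q, rfl⟩ := exists_aeval_mulVec h.isUnit hs hs' w
    exact ⟨p, q, rho_injective s3 σ
      (h.injective (hw.trans (h.map_rho_combination h0 h1 p q).symm))⟩

theorem natDegree_le_of_fst_eq_zero (h : IsDecomposition Φ m) {y : Fin 6 → F5[X]} {t : ℕ}
    (h1 : (Φ (rho s3 σ y)).1 = 0) (h2 : ∀ k l, ((Φ (rho s3 σ y)).2 k l).natDegree ≤ t)
    (i : Fin 6) : (y i).natDegree ≤ t := by
  rw [natDegree_le_iff_coeff_eq_zero]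
  intro j hj
  rw [← coeff_zcoeff_rho s3 σ, h.zcoeff_eq_zero h1 fun k l =>
    coeff_eq_zero_of_natDegree_lt ((h2 k l).trans_lt hj)]
  simp

theorem coeff_max_natDegree_ne_zero (hac : IsCoprime a c) :
    a.coeff (max a.natDegree c.natDegree) ≠ 0 ∨ c.coeff (max a.natDegree c.natDegree) ≠ 0 := by
  -- The delicate case is q = 0, whose `natDegree` is 0 by convention: then p would be a constant
  -- with zero coefficient, contradicting coprimality.
  have key : ∀ p q : F5[X], IsCoprime p q → p.natDegree ≤ q.natDegree → p.coeff q.natDegree = 0 →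
      q.coeff q.natDegree ≠ 0 := by
    intro p q hpq hle hp hq
    have hq0 : q = 0 := leadingCoeff_eq_zero.1 hq
    subst hq0
    rw [natDegree_zero] at hle hp
    rw [eq_C_of_natDegree_le_zero hle, hp, C_0] at hpq
    exact not_isUnit_zero (isCoprime_zero_left.1 hpq)
  by_contra! hne
  rcases le_total a.natDegree c.natDegree with hle | hle
  · rw [max_eq_right hle] at hne
    exact key a c hac hle hne.1 hne.2
  · rw [max_eq_left hle] at hne
    exact key c a hac.symm hle hne.2 hne.1

theorem natDegree_vecMulVec_le {w : Fin 2 → F5} (k l : Fin 2) :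
    (vecMulVec (fun i => C (w i)) ![a, c] k l).natDegree ≤ max a.natDegree c.natDegree := by
  rw [vecMulVec_apply]
  refine (natDegree_C_mul_le _ _).trans ?_
  fin_cases l <;> simp

/-- A relation among the coefficient rows at t carries over to the images, whose coefficients at xᵗ
are the rows of two different matrix positions times the top coefficient vector of (a, c). That
vector is nonzero by coprimality. -/
theorem reduced (h : IsDecomposition Φ m) (hs : s ≠ 0) (hs' : s' ≠ 0)
    (h0 : Φ (rho s3 σ (M 0)) = (0, vecMulVec ![C s, 0] ![a, c]))
    (h1 : Φ (rho s3 σ (M 1)) = (0, vecMulVec ![0, C s'] ![a, c])) (hac : IsCoprime a c) :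
    (∀ i j, (M i j).natDegree ≤ max a.natDegree c.natDegree) ∧
      LinearIndependent F5 fun i j => (M i j).coeff (max a.natDegree c.natDegree) := by
  have e0 : ![C s, 0] = fun i => C ((![s, 0] : Fin 2 → F5) i) := by
    ext1 i
    fin_cases i <;> simp
  have e1 : ![0, C s'] = fun i => C ((![0, s'] : Fin 2 → F5) i) := by
    ext1 i
    fin_cases i <;> simp
  constructor
  · rw [Fin.forall_fin_two]
    constructor
    · refine h.natDegree_le_of_fst_eq_zero (by rw [h0]) fun k l => ?_
      rw [h0, e0]
      exact natDegree_vecMulVec_le k l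
    · refine h.natDegree_le_of_fst_eq_zero (by rw [h1]) fun k l => ?_
      rw [h1, e1]
      exact natDegree_vecMulVec_le k l
  · set t := max a.natDegree c.natDegree with ht
    rw [Fintype.linearIndependent_iff]
    intro g hg
    have hz : zcoeff σ t (rho s3 σ (C (g 0) • M 0 + C (g 1) • M 1)) = 0 := by
      rw [zcoeff_rho]
      refine Finset.sum_eq_zero fun i _ => ?_
      have := congr_fun hg i
      simp only [Fin.sum_univ_two, Pi.add_apply, Pi.smul_apply, smul_eq_mul, Pi.zero_apply] at this
      simp [this]
    have hk : ∀ k l, (vecMulVec ![C (g 0 * s), C (g 1 * s')] ![a, c] k l).coeff t = 0 := by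
      intro k l
      have h2 := coeff_hom2 (φ := sndHom Φ) h.zvar_snd h.const_snd
        (rho s3 σ (C (g 0) • M 0 + C (g 1) • M 1)) t k l
      rw [hz, map_zero, mul_zero, Matrix.zero_apply] at h2
      rw [← h2]
      change _ = ((Φ _).2 k l).coeff t
      rw [h.map_rho_combination h0 h1, aeval_C, aeval_C]
      congr 2
      simp only [Algebra.algebraMap_eq_smul_one, smul_mulVec, one_mulVec]
      ext1 i
      fin_cases i <;> simp [smul_eq_C_mul]
    simp only [vecMulVec_apply, Fin.forall_fin_two, cons_val_zero, cons_val_one, coeff_C_mul,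
      mul_eq_zero, hs, hs', or_false] at hk
    rw [Fin.forall_fin_two]
    rcases coeff_max_natDegree_ne_zero hac with hne | hne
    · exact ⟨hk.1.1.resolve_right hne, hk.2.1.resolve_right hne⟩
    · exact ⟨hk.1.2.resolve_right hne, hk.2.2.resolve_right hne⟩

/-- An encoder of a code in the second component, and its parameters. -/
theorem parameters_rowCode (h : IsDecomposition Φ m) (hs : s ≠ 0) (hs' : s' ≠ 0)
    (h0 : Φ (rho s3 σ (M 0)) = (0, vecMulVec ![C s, 0] ![a, c]))
    (h1 : Φ (rho s3 σ (M 1)) = (0, vecMulVec ![0, C s'] ![a, c])) (hac : IsCoprime a c)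
    (hconv : IsConvCode (rowCode M)) :
    IsEncoder M (rowCode M) ∧
      HasParameters 6 2 (2 * max a.natDegree c.natDegree) (rowCode M) ∧
      HasForneyIndices (rowCode M) fun _ : Fin 2 => max a.natDegree c.natDegree :=
  hasParameters_of_reduced hconv rfl (h.reduced hs hs' h0 h1 hac).1 (h.reduced hs hs' h0 h1 hac).2

/-- For a general automorphism no explicit encoder is at hand; preimages of the two generating
matrices serve to compute the parameters. -/
theorem exists_rows (h : IsDecomposition Φ m) (a c : F5[X]) :
    ∃ M : Matrix (Fin 2) (Fin 6) F5[X],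
      Φ (rho s3 σ (M 0)) = (0, vecMulVec ![C 1, 0] ![a, c]) ∧
      Φ (rho s3 σ (M 1)) = (0, vecMulVec ![0, C 1] ![a, c]) := by
  obtain ⟨r, hr⟩ := h.exists_eq_zero_snd (vecMulVec ![C 1, 0] ![a, c])
  obtain ⟨r', hr'⟩ := h.exists_eq_zero_snd (vecMulVec ![0, C 1] ![a, c])
  obtain ⟨y, rfl⟩ := rho_surjective s3 σ r
  obtain ⟨y', rfl⟩ := rho_surjective s3 σ r'
  exact ⟨Matrix.of ![y, y'], hr, hr'⟩

theorem _root_.GroupConv.IsRowSpanCode.eq {Φ : SkewPoly σ →+* T × M2X}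
    {C C' : Submodule F5[X] (Fin 6 → F5[X])} (h : IsRowSpanCode Φ a c C)
    (h' : IsRowSpanCode Φ a c C') : C = C' := by
  ext y
  rw [h y, h' y]

theorem parameters_of_isRowSpanCode (h : IsDecomposition Φ m)
    {C : Submodule F5[X] (Fin 6 → F5[X])} (hC : IsRowSpanCode Φ a c C) (hac : IsCoprime a c)
    (hconv : IsConvCode C) :
    HasParameters 6 2 (2 * max a.natDegree c.natDegree) C ∧
      HasForneyIndices C fun _ : Fin 2 => max a.natDegree c.natDegree := by
  obtain ⟨M, h0, h1⟩ := h.exists_rows a c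
  obtain rfl := hC.eq (h.isRowSpanCode_rowCode one_ne_zero one_ne_zero h0 h1)
  exact (h.parameters_rowCode one_ne_zero one_ne_zero h0 h1 hac hconv).2

theorem not_isPrimitiveIdem_one : ¬ IsPrimitiveIdem (1 : M2X) := by
  rintro ⟨-, -, h⟩
  rcases h !![1, 0; 0, 0] (by rw [IsIdempotentElem, mul_fin_two]; simp) (one_mul _) (mul_one _)
    with h | h
  · have := congr($h 0 0)
    simp at this
  · have := congr($h 1 1)
    simp at this

/-- The left ideal generated by u vᵀ remembers only v, so these codes are parametrised by unimodular
rows. -/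
theorem vecMulVec_eq_iff {u v : Fin 2 → F5[X]} (huv : v ⬝ᵥ u = 1) (N : M2X) :
    N * vecMulVec u v = N ↔ ∃ w, N = vecMulVec w v := by
  constructor
  · intro h
    exact ⟨N *ᵥ u, by rw [← mul_vecMulVec, h]⟩
  · rintro ⟨w, rfl⟩
    exact vecMulVec_mul_vecMulVec_self_iff w huv

/-- The minimal codes are those that come from the first component, and the row span codes. -/
theorem isMinimalGroupConvCode_iff {Φ : SkewPoly σ ≃+* T × M2X}
    (C : Submodule F5[X] (Fin 6 → F5[X])) :
    IsMinimalGroupConvCode s3 σ C ↔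
      (∃ e : T, IsPrimitiveIdem e ∧ ∀ y, y ∈ C ↔ (Φ (rho s3 σ y)).1 * e = (Φ (rho s3 σ y)).1 ∧
        (Φ (rho s3 σ y)).2 = 0) ∨
      ∃ a c, IsCoprime a c ∧ IsRowSpanCode (Φ : SkewPoly σ →+* T × M2X) a c C := by
  rw [isMinimalGroupConvCode_iff_of_equiv s3 σ Φ]
  constructor
  · rintro ⟨⟨e, e'⟩, he, hC⟩
    rcases isPrimitiveIdem_prod_iff.1 he with ⟨h1, h2⟩ | ⟨h1, h2⟩
    · simp only at h1 h2
      subst h2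
      refine Or.inl ⟨e, h1, fun y => ?_⟩
      rw [hC, Prod.ext_iff]
      simp [eq_comm]
    · simp only at h1 h2
      subst h1
      obtain ⟨u, v, rfl, huv⟩ := exists_rank_one_of_idem h2.1 h2.2.1
        (fun h => not_isPrimitiveIdem_one (h ▸ h2))
      refine Or.inr ⟨v 0, v 1, ⟨u 0, u 1, ?_⟩, fun y => ?_⟩
      · rw [← huv, dotProduct, Fin.sum_univ_two]; ring
      · have hv : ![v 0, v 1] = v := by
          ext1 i
          fin_cases i <;> rfl
        rw [hC, hv, Prod.ext_iff]
        simp only [Prod.fst_mul, Prod.snd_mul, mul_zero, vecMulVec_eq_iff huv, RingHom.coe_coe,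
          Prod.ext_iff, exists_and_left, eq_comm (a := (0 : T))]
  · rintro (⟨e, he, hC⟩ | ⟨a, c, ⟨u, v, huv⟩, hC⟩)
    · refine ⟨(e, 0), isPrimitiveIdem_prod_iff.2 (Or.inl ⟨he, rfl⟩), fun y => ?_⟩
      rw [hC, Prod.ext_iff]
      simp [eq_comm]
    · have huv' : ![a, c] ⬝ᵥ ![u, v] = 1 := by
        rw [dotProduct, Fin.sum_univ_two, ← huv]
        simp
        ring
      refine ⟨(0, vecMulVec ![u, v] ![a, c]), isPrimitiveIdem_prod_iff.2 (Or.inr ⟨rfl,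
        isPrimitiveIdem_of_rank_one (RingHom.id M2X) Function.injective_id rfl huv'⟩),
        fun y => ?_⟩
      rw [hC, Prod.ext_iff]
      simp only [Prod.fst_mul, Prod.snd_mul, mul_zero, vecMulVec_eq_iff huv', RingHom.coe_coe,
        Prod.ext_iff, exists_and_left, eq_comm (a := (0 : T))]

end IsDecomposition
end Decomposition
end
end GroupConv

namespace GroupConv

noncomputable section

attribute [local instance] fact_prime_five

/-! ### The decomposition when the one-dimensional representations are interchanged -/

section Swap

open Matrix Polynomial

theorem mem_lowerDivRing {M : M2X} : M ∈ lowerDivRing ↔ (X : F5[X]) ∣ M 1 0 := Iff.rfl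

/-- The two one-dimensional representations, as diagonal matrices. -/
def diagHom : A5 →+* lowerDivRing where
  toFun a := ⟨!![C (psiP a), 0; 0, C (psiM a)], mem_lowerDivRing.2 (by simp)⟩
  map_one' := by
    refine Subtype.ext ?_
    simp [one_fin_two]
  map_mul' a b := by
    refine Subtype.ext ?_
    simp
  map_zero' := by
    refine Subtype.ext ?_
    ext1 i j
    fin_cases i <;> fin_cases j <;> simp
  map_add' a b := by
    refine Subtype.ext ?_
    ext1 i j
    fin_cases i <;> fin_cases j <;> simp

theorem coe_diagHom (a : A5) : (diagHom a : M2X) = !![C (psiP a), 0; 0, C (psiM a)] := rfl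

/-- The matrix `swapMatrix` as an element of `lowerDivRing`. -/
def swapElem : lowerDivRing := ⟨swapMatrix, mem_lowerDivRing.2 (by simp [swapMatrix])⟩

variable {σ : A5 ≃ₐ[F5] A5} {m : M2}

/-- The decomposition homomorphism for an automorphism that interchanges the one-dimensional
representations. -/
def swapHom (hσ : ∀ a, psiP (σ a) = psiM a ∧ psiM (σ a) = psiP a)
    (hm : ∀ a, psi2 a * m = m * psi2 (σ a)) : SkewPoly σ →+* lowerDivRing × M2X :=
  skewLift (diagHom.prod (constMatrix.comp (psi2 : A5 →+* M2)))
    (swapElem, (X : F5[X]) • constMatrix m) (by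
      intro a
      refine Prod.ext ?_ ?_
      · refine Subtype.ext ?_
        -- Moving a diagonal matrix past `swapMatrix` interchanges its entries, just as σ
        -- interchanges the characters.
        change (diagHom a : M2X) * swapMatrix = swapMatrix * (diagHom (σ a) : M2X)
        rw [coe_diagHom, coe_diagHom, (hσ a).1, (hσ a).2, swapMatrix, mul_fin_two, mul_fin_two]
        simp [X_mul_C]
      · simp only [RingHom.prod_apply, Prod.mk_mul_mk, RingHom.comp_apply, RingHom.coe_coe,
          mul_smul_comm, smul_mul_assoc, ← map_mul, hm])

/-- The component of the one-dimensional representations. -/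
abbrev fstMatrixHom (Φ : SkewPoly σ →+* lowerDivRing × M2X) : SkewPoly σ →+* M2X :=
  (lowerDivRing.subtype.comp (RingHom.fst lowerDivRing M2X)).comp Φ

section

variable (hσ : ∀ a, psiP (σ a) = psiM a ∧ psiM (σ a) = psiP a)
  (hm : ∀ a, psi2 a * m = m * psi2 (σ a))

theorem swapHom_zvar :
    swapHom hσ hm (zvar σ) = (swapElem, (X : F5[X]) • constMatrix m) := by
  rw [swapHom, skewLift_zvar]

theorem swapHom_const (a : A5) :
    swapHom hσ hm (const σ a) = (diagHom a, constMatrix (psi2 a)) := by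
  rw [swapHom, skewLift_const]; rfl

theorem swapHom_polyHom_fst (p₀ p₁ : F5[X]) :
    ((swapHom hσ hm (polyHom σ (interleave p₀ p₁))).1 : M2X) = !![p₀, p₁; X * p₁, p₀] := by
  have h := hom_polyHom (fstMatrixHom (swapHom hσ hm)) (fun c => by
    change ((swapHom hσ hm _).1 : M2X) = _
    rw [swapHom_const, coe_diagHom, AlgHom.commutes, AlgHom.commutes]
    ext1 i j
    fin_cases i <;> fin_cases j <;> simp [Matrix.algebraMap_matrix_apply]) (interleave p₀ p₁)
  have hz : fstMatrixHom (swapHom hσ hm) (zvar σ) = swapMatrix := by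
    change ((swapHom hσ hm _).1 : M2X) = _
    rw [swapHom_zvar]; rfl
  rw [hz, aeval_swapMatrix_interleave] at h
  exact h

theorem swapMatrix_pow_two_mul (k : ℕ) : swapMatrix ^ (2 * k) = (X ^ k : F5[X]) • (1 : M2X) := by
  rw [pow_mul, swapMatrix_sq, ← map_pow, Algebra.algebraMap_eq_smul_one]

/-- Even powers of z contribute to the diagonal and odd powers off it. The shift to i + 1 in the
lower left entry is the factor x that `swapMatrix` carries there. -/
theorem swapHom_coeff (r : SkewPoly σ) (i : ℕ) :
    (((swapHom hσ hm r).1 : M2X) 0 0).coeff i = psiP (zcoeff σ (2 * i) r) ∧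
    (((swapHom hσ hm r).1 : M2X) 0 1).coeff i = psiM (zcoeff σ (2 * i + 1) r) ∧
    (((swapHom hσ hm r).1 : M2X) 1 0).coeff (i + 1) = psiP (zcoeff σ (2 * i + 1) r) ∧
    (((swapHom hσ hm r).1 : M2X) 1 1).coeff i = psiM (zcoeff σ (2 * i) r) := by
  induction r using skew_induction with
  | h0 => simp
  | hadd p q hp hq => simp [hp, hq]
  | hmon j a =>
    have h : ((swapHom hσ hm (zvar σ ^ j * const σ a)).1 : M2X) =
        swapMatrix ^ j * !![C (psiP a), 0; 0, C (psiM a)] := by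
      rw [map_mul, map_pow, swapHom_zvar, swapHom_const]; rfl
    rw [h]
    simp only [zcoeff_zvar_pow_mul_const]
    obtain ⟨k, rfl | rfl⟩ := Nat.even_or_odd' j
    · rw [swapMatrix_pow_two_mul, smul_mul_assoc, one_mul]
      have h1 : 2 * k ≠ 2 * i + 1 := by omega
      by_cases hk : k = i
      · subst hk
        simp
      · simp [h1, hk, coeff_X_pow, Ne.symm hk]
    · rw [pow_succ, swapMatrix_pow_two_mul, smul_mul_assoc, one_mul, smul_mul_assoc, swapMatrix,
        mul_fin_two]
      have h1 : 2 * k + 1 ≠ 2 * i := by omega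
      by_cases hk : k = i
      · subst hk
        simp [← mul_assoc]
      · simp [h1, hk, coeff_X_pow, Ne.symm hk, ← mul_assoc]

theorem isDecomposition_swapHom (hmu : IsUnit m) : IsDecomposition (swapHom hσ hm) m where
  isUnit := hmu
  zvar_snd := by rw [swapHom_zvar]
  const_snd a := by rw [swapHom_const]
  const_fst a h1 h2 := by
    rw [swapHom_const]
    refine Subtype.ext ?_
    ext1 i j
    fin_cases i <;> fin_cases j <;> simp [coe_diagHom, h1, h2]
  zcoeff_fst r hr j := by
    have h := swapHom_coeff hσ hm r
    simp only [hr, ZeroMemClass.coe_zero, Matrix.zero_apply, coeff_zero] at h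
    obtain ⟨k, rfl | rfl⟩ := Nat.even_or_odd' j
    · exact ⟨(h k).1.symm, (h k).2.2.2.symm⟩
    · exact ⟨(h k).2.2.1.symm, (h k).2.1.symm⟩

theorem swapHom_polyHom_mul_const (p₀ p₁ : F5[X]) (a : A5) (ha : psi2 a = 0) :
    ((swapHom hσ hm (polyHom σ (interleave p₀ p₁) * const σ a)).1 : M2X) =
      !![p₀, p₁; X * p₁, p₀] * !![C (psiP a), 0; 0, C (psiM a)] ∧
    (swapHom hσ hm (polyHom σ (interleave p₀ p₁) * const σ a)).2 = 0 := by
  constructor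
  · rw [map_mul, Prod.fst_mul, Subring.coe_mul, swapHom_polyHom_fst, swapHom_const, coe_diagHom]
  · rw [map_mul, Prod.snd_mul, swapHom_const, ha, map_zero, mul_zero]

/-- The first column comes from `ε₁`, the second from `ε₂`. The result is the general element of
`lowerDivRing`, whence surjectivity. -/
theorem swapHom_sum (p₀ p₁ q₀ q₁ : F5[X]) :
    ((swapHom hσ hm (polyHom σ (interleave p₀ p₁) * const σ ε₁ +
      polyHom σ (interleave q₀ q₁) * const σ ε₂)).1 : M2X) = !![p₀, q₁; X * p₁, q₀] ∧
    (swapHom hσ hm (polyHom σ (interleave p₀ p₁) * const σ ε₁ +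
      polyHom σ (interleave q₀ q₁) * const σ ε₂)).2 = 0 := by
  have h1 := swapHom_polyHom_mul_const hσ hm p₀ p₁ ε₁ psi2_ε₁
  have h2 := swapHom_polyHom_mul_const hσ hm q₀ q₁ ε₂ psi2_ε₂
  constructor
  · rw [map_add, Prod.fst_add, Subring.coe_add, h1.1, h2.1]
    simp
  · rw [map_add, Prod.snd_add, h1.2, h2.2, add_zero]

theorem swapHom_bijective (hmu : IsUnit m) : Function.Bijective (swapHom hσ hm) := by
  refine (isDecomposition_swapHom hσ hm hmu).bijective fun t => ?_
  obtain ⟨q, hq⟩ : (X : F5[X]) ∣ (t : M2X) 1 0 := t.2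
  have h := swapHom_sum hσ hm ((t : M2X) 0 0) q ((t : M2X) 1 1) ((t : M2X) 0 1)
  refine ⟨_, Prod.ext (Subtype.ext ?_) h.2⟩
  rw [h.1, ← hq]
  exact (eta_fin_two (t : M2X)).symm

/-- The decomposition isomorphism for an automorphism that interchanges the one-dimensional
representations. -/
def swapEquiv (hmu : IsUnit m) : SkewPoly σ ≃+* lowerDivRing × M2X :=
  RingEquiv.ofBijective (swapHom hσ hm) (swapHom_bijective hσ hm hmu)

/-! #### The codes in the first component -/

/-- The vectors `ε₁` and `ε₂` agree on even permutations and are opposite on odd ones, so the even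
part of f on `ε₁` plus the odd part on `ε₂` has coordinates f(z) and f(-z). -/
theorem rho_encSym (f₀ f₁ : F5[X]) :
    rho s3 σ (encSym (interleave f₀ f₁) 0) =
      polyHom σ (interleave f₀ 0) * const σ ε₁ + polyHom σ (interleave 0 f₁) * const σ ε₂ := by
  rw [ε₁, ε₂, ← rho_mul_C, ← rho_mul_C, ← rho_add]
  congr 1
  have h4 : (C 4 : F5[X]) = -1 := by
    rw [show (4 : F5) = -1 by decide]; simp
  ext1 i
  rw [encSym, reflect_interleave]
  fin_cases i <;> simp [interleave, h4, sub_eq_add_neg]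

theorem rho_encAlt (f₀ f₁ : F5[X]) :
    rho s3 σ (encAlt (interleave f₀ f₁) 0) =
      polyHom σ (interleave 0 f₁) * const σ ε₁ + polyHom σ (interleave f₀ 0) * const σ ε₂ := by
  rw [ε₁, ε₂, ← rho_mul_C, ← rho_mul_C, ← rho_add]
  congr 1
  have h4 : (C 4 : F5[X]) = -1 := by
    rw [show (4 : F5) = -1 by decide]; simp
  ext1 i
  rw [encAlt, reflect_interleave]
  fin_cases i <;> simp [interleave, h4, sub_eq_add_neg, add_comm]

theorem mem_rowCode_fin_one {R : Type*} [CommRing R] {n : ℕ} {M : Matrix (Fin 1) (Fin n) R}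
    (y : Fin n → R) : y ∈ Submodule.span R (Set.range M.row) ↔ ∃ p : R, y = p • M 0 := by
  rw [Submodule.mem_span_range_iff_exists_fun]
  constructor
  · rintro ⟨c, rfl⟩
    exact ⟨c 0, by simp [Matrix.row]⟩
  · rintro ⟨p, rfl⟩
    exact ⟨fun _ => p, by simp [Matrix.row]⟩

/-- The generator maps to the matrix with rows (f₀, f₁) and 0, and p(z) multiplies it by a matrix
with first column (p₀, x p₁). -/
theorem mem_rowCode_encSym (hmu : IsUnit m) (f₀ f₁ : F5[X]) (y : Fin 6 → F5[X]) :
    y ∈ rowCode (encSym (interleave f₀ f₁)) ↔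
      (∃ p₀ p₁, ((swapHom hσ hm (rho s3 σ y)).1 : M2X) = vecMulVec ![p₀, X * p₁] ![f₀, f₁]) ∧
        (swapHom hσ hm (rho s3 σ y)).2 = 0 := by
  have key : ∀ p₀ p₁, ((swapHom hσ hm
      (rho s3 σ (interleave p₀ p₁ • encSym (interleave f₀ f₁) 0))).1 : M2X) =
        vecMulVec ![p₀, X * p₁] ![f₀, f₁] ∧
      (swapHom hσ hm (rho s3 σ (interleave p₀ p₁ • encSym (interleave f₀ f₁) 0))).2 = 0 := by
    intro p₀ p₁
    have h := swapHom_sum hσ hm f₀ 0 0 f₁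
    rw [rho_smul, rho_encSym, map_mul, Prod.fst_mul, Prod.snd_mul, Subring.coe_mul,
      swapHom_polyHom_fst, h.1, h.2]
    refine ⟨?_, mul_zero _⟩
    rw [mul_fin_two]
    ext1 i j
    fin_cases i <;> fin_cases j <;> simp [vecMulVec_apply]
  rw [rowCode, mem_rowCode_fin_one]
  constructor
  · rintro ⟨p, rfl⟩
    obtain ⟨p₀, p₁, rfl⟩ := exists_interleave p
    exact ⟨⟨p₀, p₁, (key p₀ p₁).1⟩, (key p₀ p₁).2⟩
  · rintro ⟨⟨p₀, p₁, h1⟩, h2⟩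
    refine ⟨interleave p₀ p₁, rho_injective s3 σ ((swapHom_bijective hσ hm hmu).1 ?_)⟩
    exact Prod.ext (Subtype.ext (h1.trans (key p₀ p₁).1.symm)) (h2.trans (key p₀ p₁).2.symm)

theorem mem_rowCode_encAlt (hmu : IsUnit m) (f₀ f₁ : F5[X]) (y : Fin 6 → F5[X]) :
    y ∈ rowCode (encAlt (interleave f₀ f₁)) ↔
      (∃ p₀ p₁, ((swapHom hσ hm (rho s3 σ y)).1 : M2X) = vecMulVec ![p₀, p₁] ![X * f₁, f₀]) ∧
        (swapHom hσ hm (rho s3 σ y)).2 = 0 := by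
  -- The generator now sits in the second row, so the second column of the multiplier counts: odd
  -- part above even part, which explains the order p₁, p₀.
  have key : ∀ p₀ p₁, ((swapHom hσ hm
      (rho s3 σ (interleave p₁ p₀ • encAlt (interleave f₀ f₁) 0))).1 : M2X) =
        vecMulVec ![p₀, p₁] ![X * f₁, f₀] ∧
      (swapHom hσ hm (rho s3 σ (interleave p₁ p₀ • encAlt (interleave f₀ f₁) 0))).2 = 0 := by
    intro p₀ p₁
    have h := swapHom_sum hσ hm 0 f₁ f₀ 0
    rw [rho_smul, rho_encAlt, map_mul, Prod.fst_mul, Prod.snd_mul, Subring.coe_mul,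
      swapHom_polyHom_fst, h.1, h.2]
    refine ⟨?_, mul_zero _⟩
    rw [mul_fin_two]
    ext1 i j
    fin_cases i <;> fin_cases j <;> simp [vecMulVec_apply]
  rw [rowCode, mem_rowCode_fin_one]
  constructor
  · rintro ⟨p, rfl⟩
    obtain ⟨p₁, p₀, rfl⟩ := exists_interleave p
    exact ⟨⟨p₀, p₁, (key p₀ p₁).1⟩, (key p₀ p₁).2⟩
  · rintro ⟨⟨p₀, p₁, h1⟩, h2⟩
    refine ⟨interleave p₁ p₀, rho_injective s3 σ ((swapHom_bijective hσ hm hmu).1 ?_)⟩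
    exact Prod.ext (Subtype.ext (h1.trans (key p₀ p₁).1.symm)) (h2.trans (key p₀ p₁).2.symm)

theorem not_isPrimitiveIdem_one_lowerDivRing : ¬ IsPrimitiveIdem (1 : lowerDivRing) := by
  rintro ⟨-, -, h⟩
  rcases h ⟨!![1, 0; 0, 0], mem_lowerDivRing.2 (by simp)⟩
    (Subtype.ext (by rw [Subring.coe_mul, mul_fin_two]; simp)) (one_mul _) (mul_one _) with h | h
  · have := congr(($h : M2X) 0 0)
    simp at this
  · have := congr(($h : M2X) 1 1)
    simp at this

/-- The column factor is N u; its lower entry is divisible by x because the lower left entry of N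
and the lower entry of u are. -/
theorem vecMulVec_eq_iff_of_dvd (N : lowerDivRing) {e : lowerDivRing} {u₀ u₁ v₀ v₁ : F5[X]}
    (he : (e : M2X) = vecMulVec ![u₀, X * u₁] ![v₀, v₁]) (h : v₀ * u₀ + v₁ * (X * u₁) = 1) :
    N * e = N ↔ ∃ p₀ p₁, (N : M2X) = vecMulVec ![p₀, X * p₁] ![v₀, v₁] := by
  have huv : ![v₀, v₁] ⬝ᵥ ![u₀, X * u₁] = 1 := by simpa [dotProduct, Fin.sum_univ_two] using h
  have h1 : N * e = N ↔ (N : M2X) * vecMulVec ![u₀, X * u₁] ![v₀, v₁] = N := by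
    rw [← he, ← Subring.coe_mul]
    exact Subtype.ext_iff
  rw [h1]
  constructor
  · intro h2
    obtain ⟨q, hq⟩ : (X : F5[X]) ∣ (N : M2X) 1 0 := N.2
    refine ⟨(N : M2X) 0 0 * u₀ + (N : M2X) 0 1 * (X * u₁), q * u₀ + (N : M2X) 1 1 * u₁, ?_⟩
    refine h2.symm.trans ?_
    rw [mul_vecMulVec]
    congr 1
    ext1 i
    fin_cases i
    · simp [mulVec, dotProduct, Fin.sum_univ_two]
    · simp [mulVec, dotProduct, Fin.sum_univ_two, hq]
      ring
  · rintro ⟨p₀, p₁, h2⟩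
    rw [h2]
    exact vecMulVec_mul_vecMulVec_self_iff _ huv

theorem exists_primitiveIdem_iff_exists_encoder (hmu : IsUnit m)
    (C : Submodule F5[X] (Fin 6 → F5[X])) :
    (∃ e : lowerDivRing, IsPrimitiveIdem e ∧ ∀ y, y ∈ C ↔
        (swapHom hσ hm (rho s3 σ y)).1 * e = (swapHom hσ hm (rho s3 σ y)).1 ∧
        (swapHom hσ hm (rho s3 σ y)).2 = 0) ↔
      ∃ f : F5[X], IsCoprime f (reflect f) ∧
        (C = rowCode (encSym f) ∨ C = rowCode (encAlt f)) := by
  have hinj : Function.Injective lowerDivRing.subtype := Subtype.val_injective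
  constructor
  · rintro ⟨e, he, hC⟩
    have hei : IsIdempotentElem (e : M2X) := he.1.map lowerDivRing.subtype
    obtain ⟨u, v, huv, h1⟩ := exists_rank_one_of_idem hei
      (fun h => he.2.1 (Subtype.ext h))
      (fun h => not_isPrimitiveIdem_one_lowerDivRing (by
        rwa [show e = 1 from Subtype.ext h] at he))
    obtain ⟨u₀, u₁, rfl⟩ : ∃ u₀ u₁, u = ![u₀, u₁] := ⟨u 0, u 1, by
      ext1 i; fin_cases i <;> rfl⟩
    obtain ⟨v₀, v₁, rfl⟩ : ∃ v₀ v₁, v = ![v₀, v₁] := ⟨v 0, v 1, by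
      ext1 i; fin_cases i <;> rfl⟩
    simp only [dotProduct, Fin.sum_univ_two, cons_val_zero, cons_val_one] at h1
    have hdvd : (X : F5[X]) ∣ u₁ * v₀ := by
      have h2 : (X : F5[X]) ∣ (e : M2X) 1 0 := e.2
      rw [huv] at h2
      simpa [vecMulVec_apply] using h2
    -- The prime x divides u₁ or v₀, which yields `encSym` or `encAlt`; in both cases v·u = 1 is the
    -- coprimality needed for `isCoprime_reflect_iff`.
    rcases prime_X.dvd_or_dvd hdvd with ⟨w, rfl⟩ | ⟨w, rfl⟩
    · refine ⟨interleave v₀ v₁, (isCoprime_reflect_iff _ _).2 ⟨u₀, w, by linear_combination h1⟩,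
        Or.inl ?_⟩
      ext y
      rw [hC, mem_rowCode_encSym hσ hm hmu, vecMulVec_eq_iff_of_dvd _ huv h1]
    · refine ⟨interleave v₁ w, (isCoprime_reflect_iff _ _).2 ⟨u₁, u₀, by linear_combination h1⟩,
        Or.inr ?_⟩
      ext y
      rw [hC, mem_rowCode_encAlt hσ hm hmu]
      have h2 := IsDecomposition.vecMulVec_eq_iff (u := ![u₀, u₁]) (v := ![X * w, v₁])
        (by simpa [dotProduct, Fin.sum_univ_two] using h1)
        ((swapHom hσ hm (rho s3 σ y)).1 : M2X)
      rw [← huv, ← Subring.coe_mul] at h2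
      rw [Subtype.ext_iff, h2]
      refine and_congr_left fun _ => ⟨?_, ?_⟩
      · rintro ⟨w', hw'⟩
        refine ⟨w' 0, w' 1, hw'.trans ?_⟩
        congr 1
        ext1 i
        fin_cases i <;> rfl
      · rintro ⟨p₀, p₁, hp⟩
        exact ⟨_, hp⟩
  · rintro ⟨f, hf, hC⟩
    obtain ⟨f₀, f₁, rfl⟩ := exists_interleave f
    obtain ⟨s, t, hst⟩ := (isCoprime_reflect_iff _ _).1 hf
    rcases hC with rfl | rfl
    · have h1 : f₀ * s + f₁ * (X * t) = 1 := by linear_combination hst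
      let e : lowerDivRing := ⟨vecMulVec ![s, X * t] ![f₀, f₁], by
        change X ∣ vecMulVec ![s, X * t] ![f₀, f₁] 1 0
        simp [vecMulVec_apply, mul_assoc]⟩
      refine ⟨e, isPrimitiveIdem_of_rank_one lowerDivRing.subtype hinj (u := ![s, X * t])
        (v := ![f₀, f₁]) rfl (by simpa [dotProduct, Fin.sum_univ_two] using h1), fun y => ?_⟩
      rw [mem_rowCode_encSym hσ hm hmu, vecMulVec_eq_iff_of_dvd _ rfl h1]
    · have h1 : ![X * f₁, f₀] ⬝ᵥ ![t, s] = 1 := by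
        simp [dotProduct, Fin.sum_univ_two]
        linear_combination hst
      let e : lowerDivRing := ⟨vecMulVec ![t, s] ![X * f₁, f₀], by
        change X ∣ vecMulVec ![t, s] ![X * f₁, f₀] 1 0
        simp only [vecMulVec_apply, cons_val_zero, cons_val_one]
        exact Dvd.intro _ (by ring : X * (s * f₁) = s * (X * f₁))⟩
      refine ⟨e, isPrimitiveIdem_of_rank_one lowerDivRing.subtype hinj (u := ![t, s])
        (v := ![X * f₁, f₀]) rfl h1, fun y => ?_⟩
      rw [mem_rowCode_encAlt hσ hm hmu]
      have h2 := IsDecomposition.vecMulVec_eq_iff h1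
        ((swapHom hσ hm (rho s3 σ y)).1 : M2X)
      rw [show vecMulVec ![t, s] ![X * f₁, f₀] = (e : M2X) from rfl, ← Subring.coe_mul] at h2
      rw [Subtype.ext_iff, h2]
      refine and_congr_left fun _ => ⟨?_, ?_⟩
      · rintro ⟨p₀, p₁, hp⟩
        exact ⟨_, hp⟩
      · rintro ⟨w', hw'⟩
        refine ⟨w' 0, w' 1, hw'.trans ?_⟩
        congr 1
        ext1 i
        fin_cases i <;> rfl

/-- The minimal codes when the one-dimensional representations are interchanged. -/
theorem isMinimalGroupConvCode_swap_iff (hmu : IsUnit m) (C : Submodule F5[X] (Fin 6 → F5[X])) :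
    IsMinimalGroupConvCode s3 σ C ↔
      (∃ f : F5[X], IsCoprime f (reflect f) ∧
        (C = rowCode (encSym f) ∨ C = rowCode (encAlt f))) ∨
      ∃ a c, IsCoprime a c ∧ IsRowSpanCode (swapHom hσ hm) a c C := by
  rw [← exists_primitiveIdem_iff_exists_encoder hσ hm hmu,
    IsDecomposition.isMinimalGroupConvCode_iff (Φ := swapEquiv hσ hm hmu)]
  rfl

end

end Swap
end
end GroupConv

namespace GroupConv

noncomputable section

attribute [local instance] fact_prime_five

/-! ### The decomposition when the one-dimensional representations are fixed -/

section Fix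

open Matrix Polynomial

variable {σ : A5 ≃ₐ[F5] A5} {m : M2}

/-- The two one-dimensional representations, as a pair of constant polynomials. -/
def pairHom : A5 →+* F5[X] × F5[X] :=
  ((C : F5 →+* F5[X]).comp (psiP : A5 →+* F5)).prod ((C : F5 →+* F5[X]).comp (psiM : A5 →+* F5))

theorem pairHom_apply (a : A5) : pairHom a = (C (psiP a), C (psiM a)) := rfl

/-- The decomposition homomorphism for an automorphism that fixes the one-dimensional
representations. -/
def fixHom (hσ : ∀ a, psiP (σ a) = psiP a ∧ psiM (σ a) = psiM a)
    (hm : ∀ a, psi2 a * m = m * psi2 (σ a)) : SkewPoly σ →+* (F5[X] × F5[X]) × M2X :=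
  skewLift (pairHom.prod (constMatrix.comp (psi2 : A5 →+* M2)))
    ((X, X), (X : F5[X]) • constMatrix m) (by
      intro a
      refine Prod.ext ?_ ?_
      · simp only [RingHom.prod_apply, Prod.mk_mul_mk, pairHom_apply, (hσ a).1, (hσ a).2, X_mul_C]
      · simp only [RingHom.prod_apply, Prod.mk_mul_mk, RingHom.comp_apply, RingHom.coe_coe,
          mul_smul_comm, smul_mul_assoc, ← map_mul, hm])

section

variable (hσ : ∀ a, psiP (σ a) = psiP a ∧ psiM (σ a) = psiM a)
  (hm : ∀ a, psi2 a * m = m * psi2 (σ a))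

theorem fixHom_zvar :
    fixHom hσ hm (zvar σ) = ((X, X), (X : F5[X]) • constMatrix m) := by
  rw [fixHom, skewLift_zvar]

theorem fixHom_const (a : A5) :
    fixHom hσ hm (const σ a) = ((C (psiP a), C (psiM a)), constMatrix (psi2 a)) := by
  rw [fixHom, skewLift_const]; rfl

theorem fixHom_polyHom_fst (p : F5[X]) : (fixHom hσ hm (polyHom σ p)).1 = (p, p) := by
  have h := hom_polyHom ((RingHom.fst (F5[X] × F5[X]) M2X).comp (fixHom hσ hm)) (fun c => by
    rw [RingHom.comp_apply, fixHom_const, AlgHom.commutes, AlgHom.commutes]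
    rfl) p
  rw [RingHom.comp_apply, RingHom.comp_apply, fixHom_zvar] at h
  refine h.trans ?_
  change aeval ((X, X) : F5[X] × F5[X]) p = _
  have h1 : ∀ π : F5[X] × F5[X] →ₐ[F5] F5[X], π (X, X) = X →
      π (aeval ((X, X) : F5[X] × F5[X]) p) = p := fun π hπ => by
    rw [← aeval_algHom_apply, hπ, aeval_X_left_apply]
  exact Prod.ext (h1 (AlgHom.fst F5 F5[X] F5[X]) rfl) (h1 (AlgHom.snd F5 F5[X] F5[X]) rfl)

theorem fixHom_coeff (r : SkewPoly σ) (i : ℕ) :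
    (fixHom hσ hm r).1.1.coeff i = psiP (zcoeff σ i r) ∧
    (fixHom hσ hm r).1.2.coeff i = psiM (zcoeff σ i r) := by
  induction r using skew_induction with
  | h0 => simp
  | hadd p q hp hq => simp [hp, hq]
  | hmon j a =>
    rw [map_mul, map_pow, fixHom_zvar, fixHom_const, zcoeff_zvar_pow_mul_const]
    by_cases h : j = i
    · subst h
      simp
    · simp [h, coeff_X_pow, Ne.symm h]

theorem isDecomposition_fixHom (hmu : IsUnit m) : IsDecomposition (fixHom hσ hm) m where
  isUnit := hmu
  zvar_snd := by rw [fixHom_zvar]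
  const_snd a := by rw [fixHom_const]
  const_fst a h1 h2 := by
    rw [fixHom_const, h1, h2]
    simp
  zcoeff_fst r hr j := by
    have h := fixHom_coeff hσ hm r j
    simp only [hr, Prod.fst_zero, Prod.snd_zero, coeff_zero] at h
    exact ⟨h.1.symm, h.2.symm⟩

theorem fixHom_sum (p q : F5[X]) :
    fixHom hσ hm (polyHom σ p * const σ ε₁ + polyHom σ q * const σ ε₂) = ((p, q), 0) := by
  rw [map_add, map_mul, map_mul, fixHom_const, fixHom_const]
  refine Prod.ext ?_ ?_
  · rw [Prod.fst_add, Prod.fst_mul, Prod.fst_mul, fixHom_polyHom_fst, fixHom_polyHom_fst]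
    simp
  · simp

theorem fixHom_bijective (hmu : IsUnit m) : Function.Bijective (fixHom hσ hm) :=
  (isDecomposition_fixHom hσ hm hmu).bijective fun t => ⟨_, fixHom_sum hσ hm t.1 t.2⟩

/-- The decomposition isomorphism for an automorphism that fixes the one-dimensional
representations. -/
def fixEquiv (hmu : IsUnit m) : SkewPoly σ ≃+* (F5[X] × F5[X]) × M2X :=
  RingEquiv.ofBijective (fixHom hσ hm) (fixHom_bijective hσ hm hmu)

theorem rho_ones :
    rho s3 σ ((!![1, 1, 1, 1, 1, 1] : Matrix (Fin 1) (Fin 6) F5[X]) 0) = const σ ε₁ := by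
  rw [← one_mul (const σ ε₁), ← map_one (polyHom σ), ε₁, ← rho_mul_C]
  congr 1
  ext1 i
  fin_cases i <;> simp

theorem rho_signs :
    rho s3 σ ((!![1, 4, 4, 4, 1, 1] : Matrix (Fin 1) (Fin 6) F5[X]) 0) = const σ ε₂ := by
  rw [← one_mul (const σ ε₂), ← map_one (polyHom σ), ε₂, ← rho_mul_C]
  congr 1
  have h4 : (C 4 : F5[X]) = 4 := map_ofNat C 4
  ext1 i
  fin_cases i <;> simp [h4]

theorem mem_rowCode_ones (hmu : IsUnit m) (y : Fin 6 → F5[X]) :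
    y ∈ rowCode (!![1, 1, 1, 1, 1, 1] : Matrix (Fin 1) (Fin 6) F5[X]) ↔
      (fixHom hσ hm (rho s3 σ y)).1.2 = 0 ∧ (fixHom hσ hm (rho s3 σ y)).2 = 0 := by
  have key : ∀ p : F5[X], fixHom hσ hm (rho s3 σ (p •
      (!![1, 1, 1, 1, 1, 1] : Matrix (Fin 1) (Fin 6) F5[X]) 0)) = ((p, 0), 0) := by
    intro p
    have h := fixHom_sum hσ hm p 0
    rw [map_zero, zero_mul, add_zero] at h
    rw [rho_smul, rho_ones, h]
  rw [rowCode, mem_rowCode_fin_one]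
  constructor
  · rintro ⟨p, rfl⟩
    rw [key]
    exact ⟨rfl, rfl⟩
  · rintro ⟨h1, h2⟩
    refine ⟨(fixHom hσ hm (rho s3 σ y)).1.1,
      rho_injective s3 σ ((fixHom_bijective hσ hm hmu).1 ?_)⟩
    rw [key]
    exact Prod.ext (Prod.ext rfl h1) h2

theorem mem_rowCode_signs (hmu : IsUnit m) (y : Fin 6 → F5[X]) :
    y ∈ rowCode (!![1, 4, 4, 4, 1, 1] : Matrix (Fin 1) (Fin 6) F5[X]) ↔
      (fixHom hσ hm (rho s3 σ y)).1.1 = 0 ∧ (fixHom hσ hm (rho s3 σ y)).2 = 0 := by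
  have key : ∀ p : F5[X], fixHom hσ hm (rho s3 σ (p •
      (!![1, 4, 4, 4, 1, 1] : Matrix (Fin 1) (Fin 6) F5[X]) 0)) = ((0, p), 0) := by
    intro p
    have h := fixHom_sum hσ hm 0 p
    rw [map_zero, zero_mul, zero_add] at h
    rw [rho_smul, rho_signs, h]
  rw [rowCode, mem_rowCode_fin_one]
  constructor
  · rintro ⟨p, rfl⟩
    rw [key]
    exact ⟨rfl, rfl⟩
  · rintro ⟨h1, h2⟩
    refine ⟨(fixHom hσ hm (rho s3 σ y)).1.2,
      rho_injective s3 σ ((fixHom_bijective hσ hm hmu).1 ?_)⟩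
    rw [key]
    exact Prod.ext (Prod.ext h1 rfl) h2

/-- The minimal codes when the one-dimensional representations are fixed. -/
theorem isMinimalGroupConvCode_fix_iff (hmu : IsUnit m) (D : Submodule F5[X] (Fin 6 → F5[X])) :
    IsMinimalGroupConvCode s3 σ D ↔
      (D = rowCode !![1, 1, 1, 1, 1, 1] ∨ D = rowCode !![1, 4, 4, 4, 1, 1]) ∨
      ∃ a c, IsCoprime a c ∧ IsRowSpanCode (fixHom hσ hm) a c D := by
  rw [IsDecomposition.isMinimalGroupConvCode_iff (Φ := fixEquiv hσ hm hmu)]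
  refine or_congr ?_ Iff.rfl
  change (∃ e : F5[X] × F5[X], IsPrimitiveIdem e ∧ ∀ y, y ∈ D ↔
    (fixHom hσ hm (rho s3 σ y)).1 * e = (fixHom hσ hm (rho s3 σ y)).1 ∧
    (fixHom hσ hm (rho s3 σ y)).2 = 0) ↔ _
  simp only [SetLike.ext_iff, mem_rowCode_ones hσ hm hmu, mem_rowCode_signs hσ hm hmu]
  constructor
  · rintro ⟨⟨e, e'⟩, he, hD⟩
    -- A domain has 1 as its only primitive idempotent, so only (1, 0) and (0, 1) remain.
    rw [isPrimitiveIdem_prod_iff, isPrimitiveIdem_iff_eq_one, isPrimitiveIdem_iff_eq_one] at he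
    rcases he with ⟨h1, h2⟩ | ⟨h1, h2⟩ <;> simp only at h1 h2 <;> subst h1 h2
    · refine Or.inl fun y => ?_
      rw [hD, Prod.ext_iff]
      simp [eq_comm]
    · refine Or.inr fun y => ?_
      rw [hD, Prod.ext_iff]
      simp [eq_comm]
  · rintro (hD | hD)
    · refine ⟨(1, 0), isPrimitiveIdem_prod_iff.2
        (Or.inl ⟨isPrimitiveIdem_iff_eq_one.2 rfl, rfl⟩), fun y => ?_⟩
      rw [hD, Prod.ext_iff]
      simp [eq_comm]
    · refine ⟨(0, 1), isPrimitiveIdem_prod_iff.2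
        (Or.inr ⟨rfl, isPrimitiveIdem_iff_eq_one.2 rfl⟩), fun y => ?_⟩
      rw [hD, Prod.ext_iff]
      simp [eq_comm]

end

end Fix
end
end GroupConv

namespace GroupConv

noncomputable section

attribute [local instance] fact_prime_five

/-! ### Encoders and parameters -/

section Encoders

open Matrix Polynomial

theorem natDegree_reflect_le (f : F5[X]) : (reflect f).natDegree ≤ f.natDegree := by
  refine natDegree_comp_le.trans ?_
  rw [natDegree_neg, natDegree_X, mul_one]

theorem ne_zero_of_isCoprime_reflect {f : F5[X]} (hf : IsCoprime f (reflect f)) : f ≠ 0 := by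
  rintro rfl
  rw [reflect, zero_comp] at hf
  exact not_isUnit_zero (isCoprime_zero_left.1 hf)

/-- Parameters of a code with one generator whose first entry has maximal degree. -/
theorem parameters_of_one_row {M : Matrix (Fin 1) (Fin 6) F5[X]}
    (hM : ∀ j, (M 0 j).natDegree ≤ (M 0 0).natDegree) (h0 : M 0 0 ≠ 0)
    (hC : IsConvCode (rowCode M)) :
    IsEncoder M (rowCode M) ∧ HasParameters 6 1 (M 0 0).natDegree (rowCode M) ∧
      HasForneyIndices (rowCode M) fun _ : Fin 1 => (M 0 0).natDegree := by
  have h := hasParameters_of_reduced (t := (M 0 0).natDegree) hC rfl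
    (fun i j => by rw [Subsingleton.elim i 0]; exact hM j) (by
      rw [Fintype.linearIndependent_iff]
      intro g hg i
      -- The first column suffices: its coefficient at t is the leading coefficient of a nonzero
      -- polynomial.
      have h1 := congr_fun hg 0
      simp only [Finset.univ_unique, Fin.default_eq_zero, Finset.sum_singleton, Pi.smul_apply,
        smul_eq_mul, Pi.zero_apply, mul_eq_zero] at h1
      rw [Subsingleton.elim i 0]
      exact h1.resolve_right (leadingCoeff_ne_zero.2 h0))
  rwa [one_mul] at h

theorem parameters_encSym {f : F5[X]} (hf : IsCoprime f (reflect f))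
    (hC : IsConvCode (rowCode (encSym f))) :
    IsEncoder (encSym f) (rowCode (encSym f)) ∧
      HasParameters 6 1 f.natDegree (rowCode (encSym f)) ∧
      HasForneyIndices (rowCode (encSym f)) fun _ : Fin 1 => f.natDegree := by
  refine parameters_of_one_row (M := encSym f) (fun j => ?_) (ne_zero_of_isCoprime_reflect hf) hC
  have h := natDegree_reflect_le f
  fin_cases j <;> simp [encSym, h]

theorem parameters_encAlt {f : F5[X]} (hf : IsCoprime f (reflect f))
    (hC : IsConvCode (rowCode (encAlt f))) :
    IsEncoder (encAlt f) (rowCode (encAlt f)) ∧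
      HasParameters 6 1 f.natDegree (rowCode (encAlt f)) ∧
      HasForneyIndices (rowCode (encAlt f)) fun _ : Fin 1 => f.natDegree := by
  refine parameters_of_one_row (M := encAlt f) (fun j => ?_) (ne_zero_of_isCoprime_reflect hf) hC
  have h := natDegree_reflect_le f
  fin_cases j <;> simp [encAlt, h]

theorem parameters_ones
    (hC : IsConvCode (rowCode (!![1, 1, 1, 1, 1, 1] : Matrix (Fin 1) (Fin 6) F5[X]))) :
    HasParameters 6 1 0 (rowCode (!![1, 1, 1, 1, 1, 1] : Matrix (Fin 1) (Fin 6) F5[X])) ∧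
      HasForneyIndices (rowCode (!![1, 1, 1, 1, 1, 1] : Matrix (Fin 1) (Fin 6) F5[X]))
        fun _ : Fin 1 => 0 := by
  have h := (parameters_of_one_row (fun j => by fin_cases j <;> simp) (by simp) hC).2
  have h0 : ((!![1, 1, 1, 1, 1, 1] : Matrix (Fin 1) (Fin 6) F5[X]) 0 0).natDegree = 0 :=
    natDegree_one
  rwa [h0] at h

theorem parameters_signs
    (hC : IsConvCode (rowCode (!![1, 4, 4, 4, 1, 1] : Matrix (Fin 1) (Fin 6) F5[X]))) :
    HasParameters 6 1 0 (rowCode (!![1, 4, 4, 4, 1, 1] : Matrix (Fin 1) (Fin 6) F5[X])) ∧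
      HasForneyIndices (rowCode (!![1, 4, 4, 4, 1, 1] : Matrix (Fin 1) (Fin 6) F5[X]))
        fun _ : Fin 1 => 0 := by
  have h := (parameters_of_one_row (fun j => by fin_cases j <;> simp) (by simp) hC).2
  have h0 : ((!![1, 4, 4, 4, 1, 1] : Matrix (Fin 1) (Fin 6) F5[X]) 0 0).natDegree = 0 :=
    natDegree_one
  rwa [h0] at h

/-- Every minimal code has parameters `(6, 1, t)` and Forney index `t`, or parameters `(6, 2, 2t)`
and Forney indices `t, t`. -/
theorem exists_parameters (σ : A5 ≃ₐ[F5] A5) (D : Submodule F5[X] (Fin 6 → F5[X]))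
    (hD : IsMinimalGroupConvCode s3 σ D) :
    ∃ t : ℕ, (HasParameters 6 1 t D ∧ HasForneyIndices D ![t]) ∨
      (HasParameters 6 2 (2 * t) D ∧ HasForneyIndices D ![t, t]) := by
  have e1 : ∀ t : ℕ, (![t] : Fin 1 → ℕ) = fun _ => t := fun t => by
    ext1 i
    fin_cases i; rfl
  have e2 : ∀ t : ℕ, (![t, t] : Fin 2 → ℕ) = fun _ => t := fun t => by
    ext1 i
    fin_cases i <;> rfl
  simp only [e2]
  simp only [e1]
  have hC := hD.isConvCode
  obtain ⟨⟨m, hmu, hm⟩, hσ | hσ⟩ := exists_matrix_of_aut σ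
  · rcases (isMinimalGroupConvCode_fix_iff hσ hm hmu D).1 hD with (rfl | rfl) | ⟨a, c, hac, h⟩
    · exact ⟨0, Or.inl (parameters_ones hC)⟩
    · exact ⟨0, Or.inl (parameters_signs hC)⟩
    · exact ⟨_, Or.inr ((isDecomposition_fixHom hσ hm hmu).parameters_of_isRowSpanCode h hac hC)⟩
  · rcases (isMinimalGroupConvCode_swap_iff hσ hm hmu D).1 hD with
      ⟨f, hf, rfl | rfl⟩ | ⟨a, c, hac, h⟩
    · exact ⟨_, Or.inl (parameters_encSym hf hC).2⟩
    · exact ⟨_, Or.inl (parameters_encAlt hf hC).2⟩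
    · exact ⟨_, Or.inr ((isDecomposition_swapHom hσ hm hmu).parameters_of_isRowSpanCode h hac hC)⟩

/-! #### Explicit encoders in the second component -/

namespace IsDecomposition

variable {T : Type*} [Ring T] {σ : A5 ≃ₐ[F5] A5} {m : M2} {Φ : SkewPoly σ →+* T × M2X}

theorem map_polyHom_mul_const (h : IsDecomposition Φ m) (p : F5[X]) {v : Fin 6 → F5} {N : M2}
    (h1 : psiP (elt v) = 0) (h2 : psiM (elt v) = 0) (hN : psi2 (elt v) = N) :
    Φ (polyHom σ p * const σ (elt v)) =
      (0, aeval ((X : F5[X]) • constMatrix m) p * constMatrix N) :=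
  h.polyHom_mul_of_fst_eq_zero p (Prod.ext (h.const_fst _ h1 h2) (by rw [h.const_snd, hN]))

end IsDecomposition

theorem rho_encPattern_zero {σ : A5 ≃ₐ[F5] A5} (a₁ a₂ c₁ c₂ : F5[X]) :
    rho s3 σ (encPattern a₁ a₂ c₁ c₂ 0) =
      polyHom σ a₁ * const σ (elt ![3, 2, 0, 3, 2, 0]) +
      polyHom σ a₂ * const σ (elt ![2, 2, 1, 2, 2, 1]) +
      polyHom σ c₁ * const σ (elt ![0, 0, 3, 2, 3, 2]) +
      polyHom σ c₂ * const σ (elt ![1, 1, 2, 2, 2, 2]) := by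
  simp only [← rho_mul_C, ← rho_add]
  congr 1
  have h2 : (C 2 : F5[X]) = 2 := map_ofNat C 2
  have h3 : (C 3 : F5[X]) = 3 := map_ofNat C 3
  ext1 i
  fin_cases i <;> simp [encPattern, h2, h3] <;> ring

theorem rho_encPattern_one {σ : A5 ≃ₐ[F5] A5} (a₁ a₂ c₁ c₂ : F5[X]) :
    rho s3 σ (encPattern a₁ a₂ c₁ c₂ 1) =
      polyHom σ a₁ * const σ (elt ![0, 3, 2, 0, 3, 2]) +
      polyHom σ a₂ * const σ (elt ![1, 2, 2, 1, 2, 2]) +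
      polyHom σ c₁ * const σ (elt ![2, 2, 0, 3, 0, 3]) +
      polyHom σ c₂ * const σ (elt ![2, 2, 1, 2, 1, 2]) := by
  simp only [← rho_mul_C, ← rho_add]
  congr 1
  have h2 : (C 2 : F5[X]) = 2 := map_ofNat C 2
  have h3 : (C 3 : F5[X]) = 3 := map_ofNat C 3
  ext1 i
  fin_cases i <;> simp [encPattern, h2, h3] <;> ring

theorem encId_eq_encPattern (a c : F5[X]) : encId a c = encPattern a 0 c 0 := by
  ext1 i j
  fin_cases i <;> fin_cases j <;> simp [encId, encPattern]

/-- The images of the rows of `encPattern a₁ a₂ c₁ c₂` if `a₁(x m)`, `a₂(x m)`, `c₁(x m)` and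
`c₂(x m)` are the products of `p₁`, `p₂`, `q₁` and `q₂` with `1`, `m`, `1` and `m`. -/
theorem IsDecomposition.map_rho_encPattern {T : Type*} [Ring T] {σ : A5 ≃ₐ[F5] A5} {m : M2}
    {Φ : SkewPoly σ →+* T × M2X} (h : IsDecomposition Φ m) {a₁ a₂ c₁ c₂ p₁ p₂ q₁ q₂ : F5[X]}
    (ha₁ : aeval ((X : F5[X]) • constMatrix m) a₁ = p₁ • (1 : M2X))
    (ha₂ : aeval ((X : F5[X]) • constMatrix m) a₂ = p₂ • constMatrix signMatrix)
    (hc₁ : aeval ((X : F5[X]) • constMatrix m) c₁ = q₁ • (1 : M2X))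
    (hc₂ : aeval ((X : F5[X]) • constMatrix m) c₂ = q₂ • constMatrix signMatrix) :
    Φ (rho s3 σ (encPattern a₁ a₂ c₁ c₂ 0)) =
      (0, vecMulVec ![C 4, 0] ![p₁ + p₂, q₁ + q₂]) ∧
    Φ (rho s3 σ (encPattern a₁ a₂ c₁ c₂ 1)) =
      (0, vecMulVec ![0, C 1] ![p₁ + p₂, q₁ + q₂]) := by
  have hP : ∀ v : Fin 6 → F5, ∑ i, v i = 0 → psiP (elt v) = 0 := fun v hv => by rw [psiP_elt, hv]
  have hM : ∀ v : Fin 6 → F5, ∑ i, v i * ((Equiv.Perm.sign (s3 i) : ℤ) : F5) = 0 →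
      psiM (elt v) = 0 := fun v hv => by rw [psiM_elt, hv]
  have h1 : ∀ (p a : F5[X]) (v : Fin 6 → F5) (N : M2),
      aeval ((X : F5[X]) • constMatrix m) a = p • (1 : M2X) → psiP (elt v) = 0 →
      psiM (elt v) = 0 → psi2 (elt v) = N →
      Φ (polyHom σ a * const σ (elt v)) = (0, p • constMatrix N) := by
    intro p a v N ha hp hm hN
    rw [h.map_polyHom_mul_const a hp hm hN, ha, smul_mul_assoc, one_mul]
  have h2 : ∀ (p a : F5[X]) (v : Fin 6 → F5) (N : M2),
      aeval ((X : F5[X]) • constMatrix m) a = p • constMatrix signMatrix → psiP (elt v) = 0 →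
      psiM (elt v) = 0 → signMatrix * psi2 (elt v) = N →
      Φ (polyHom σ a * const σ (elt v)) = (0, p • constMatrix N) := by
    intro p a v N ha hp hm hN
    rw [h.map_polyHom_mul_const a hp hm rfl, ha, smul_mul_assoc, ← map_mul, hN]
  constructor
  -- The element attached to a₂ becomes, after multiplication by `signMatrix`, the same multiple of
  -- a matrix unit as the one attached to a₁, and likewise for c₂ and c₁. So even and odd parts
  -- recombine.
  · rw [rho_encPattern_zero, map_add, map_add, map_add,
      h1 p₁ a₁ _ !![4, 0; 0, 0] ha₁ (hP _ (by decide)) (hM _ (by decide))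
        (by rw [psi2_elt]; decide),
      h2 p₂ a₂ _ !![4, 0; 0, 0] ha₂ (hP _ (by decide)) (hM _ (by decide))
        (by rw [psi2_elt]; decide),
      h1 q₁ c₁ _ !![0, 4; 0, 0] hc₁ (hP _ (by decide)) (hM _ (by decide))
        (by rw [psi2_elt]; decide),
      h2 q₂ c₂ _ !![0, 4; 0, 0] hc₂ (hP _ (by decide)) (hM _ (by decide))
        (by rw [psi2_elt]; decide)]
    refine Prod.ext (by simp) ?_
    ext1 i j
    fin_cases i <;> fin_cases j <;> simp [vecMulVec_apply] <;> ring
  · rw [rho_encPattern_one, map_add, map_add, map_add,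
      h1 p₁ a₁ _ !![0, 0; 1, 0] ha₁ (hP _ (by decide)) (hM _ (by decide))
        (by rw [psi2_elt]; decide),
      h2 p₂ a₂ _ !![0, 0; 1, 0] ha₂ (hP _ (by decide)) (hM _ (by decide))
        (by rw [psi2_elt]; decide),
      h1 q₁ c₁ _ !![0, 0; 0, 1] hc₁ (hP _ (by decide)) (hM _ (by decide))
        (by rw [psi2_elt]; decide),
      h2 q₂ c₂ _ !![0, 0; 0, 1] hc₂ (hP _ (by decide)) (hM _ (by decide))
        (by rw [psi2_elt]; decide)]
    refine Prod.ext (by simp) ?_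
    ext1 i j
    fin_cases i <;> fin_cases j <;> simp [vecMulVec_apply]

theorem signMatrix_mul_self : signMatrix * signMatrix = (3 : F5) • (1 : M2) := by decide

theorem signMatrix_pow (i : ℕ) : signMatrix ^ (2 * i) = (3 ^ i : F5) • (1 : M2) := by
  rw [pow_mul, pow_two, signMatrix_mul_self, _root_.smul_pow, one_pow]

/-- This is why `evenPart` and `oddPart` contain 2ⁱ: it cancels the 3ⁱ produced by `signMatrix ^ (2
* i)`. -/
theorem two_pow_mul_three_pow (i : ℕ) : (2 ^ i * 3 ^ i : F5) = 1 := by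
  rw [← mul_pow, show (2 * 3 : F5) = 1 by decide, one_pow]

theorem aeval_evenPart (p : F5[X]) :
    aeval ((X : F5[X]) • constMatrix signMatrix) (evenPart p) =
      (∑ i ∈ Finset.range (p.natDegree + 1), monomial (2 * i) (p.coeff (2 * i))) • (1 : M2X) := by
  rw [evenPart, map_sum, Finset.sum_smul]
  refine Finset.sum_congr rfl fun i _ => ?_
  rw [aeval_X_smul_monomial, signMatrix_pow, constMatrix_smul, map_one, smul_smul, monomial_mul_C,
    mul_right_comm, two_pow_mul_three_pow, one_mul]

theorem aeval_oddPart (p : F5[X]) :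
    aeval ((X : F5[X]) • constMatrix signMatrix) (oddPart p) =
      (∑ i ∈ Finset.range (p.natDegree + 1), monomial (2 * i + 1) (p.coeff (2 * i + 1))) •
        constMatrix signMatrix := by
  rw [oddPart, map_sum, Finset.sum_smul]
  refine Finset.sum_congr rfl fun i _ => ?_
  rw [aeval_X_smul_monomial, pow_succ, signMatrix_pow, smul_mul_assoc, one_mul, constMatrix_smul,
    smul_smul, monomial_mul_C, mul_right_comm, two_pow_mul_three_pow, one_mul]

theorem sum_even_add_sum_odd (p : F5[X]) :
    (∑ i ∈ Finset.range (p.natDegree + 1), monomial (2 * i) (p.coeff (2 * i))) +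
      (∑ i ∈ Finset.range (p.natDegree + 1), monomial (2 * i + 1) (p.coeff (2 * i + 1))) = p := by
  ext n
  simp only [coeff_add, finsetSum_coeff, coeff_monomial]
  obtain ⟨k, rfl | rfl⟩ := Nat.even_or_odd' n
  · rw [Finset.sum_eq_single k, if_pos rfl, Finset.sum_eq_zero, add_zero]
    · intro i _
      rw [if_neg (by omega)]
    · intro i _ hi
      rw [if_neg (by omega)]
    · intro hk
      rw [if_pos rfl]
      exact coeff_eq_zero_of_natDegree_lt (by simp at hk; omega)
  · rw [Finset.sum_eq_zero, zero_add, Finset.sum_eq_single k, if_pos rfl]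
    · intro i _ hi
      rw [if_neg (by omega)]
    · intro hk
      rw [if_pos rfl]
      exact coeff_eq_zero_of_natDegree_lt (by simp at hk; omega)
    · intro i _
      rw [if_neg (by omega)]

/-! #### The sign automorphism -/

theorem isUnit_signMatrix : IsUnit signMatrix :=
  ⟨⟨signMatrix, (2 : F5) • signMatrix, by decide, by decide⟩, rfl⟩

theorem signAut_swaps (a : A5) : psiP (signAut a) = psiM a ∧ psiM (signAut a) = psiP a :=
  ⟨psiP_signAut a, psiM_signAut a⟩

theorem isDecomposition_sign :
    IsDecomposition (swapHom signAut_swaps psi2_mul_signMatrix) signMatrix :=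
  isDecomposition_swapHom _ _ isUnit_signMatrix

theorem map_rho_encSign (a c : F5[X]) :
    swapHom signAut_swaps psi2_mul_signMatrix (rho s3 signAut (encSign a c 0)) =
      (0, vecMulVec ![C 4, 0] ![a, c]) ∧
    swapHom signAut_swaps psi2_mul_signMatrix (rho s3 signAut (encSign a c 1)) =
      (0, vecMulVec ![0, C 1] ![a, c]) := by
  have h := isDecomposition_sign.map_rho_encPattern (aeval_evenPart a) (aeval_oddPart a)
    (aeval_evenPart c) (aeval_oddPart c)
  rwa [sum_even_add_sum_odd, sum_even_add_sum_odd] at h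

theorem four_ne_zero_F5 : (4 : F5) ≠ 0 := by decide

theorem isRowSpanCode_encSign (a c : F5[X]) :
    IsRowSpanCode (swapHom signAut_swaps psi2_mul_signMatrix) a c (rowCode (encSign a c)) :=
  isDecomposition_sign.isRowSpanCode_rowCode four_ne_zero_F5 one_ne_zero (map_rho_encSign a c).1
    (map_rho_encSign a c).2

theorem isMinimal_sign_iff (D : Submodule F5[X] (Fin 6 → F5[X])) :
    IsMinimalGroupConvCode s3 signAut D ↔
      (∃ f : F5[X], IsCoprime f (reflect f) ∧
        (D = rowCode (encSym f) ∨ D = rowCode (encAlt f))) ∨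
      ∃ a c, IsCoprime a c ∧ IsRowSpanCode (swapHom signAut_swaps psi2_mul_signMatrix) a c D :=
  isMinimalGroupConvCode_swap_iff _ _ isUnit_signMatrix D

theorem isMinimal_encSym {f : F5[X]} (hf : IsCoprime f (reflect f)) :
    IsMinimalGroupConvCode s3 signAut (rowCode (encSym f)) :=
  (isMinimal_sign_iff _).2 (Or.inl ⟨f, hf, Or.inl rfl⟩)

theorem isMinimal_encAlt {f : F5[X]} (hf : IsCoprime f (reflect f)) :
    IsMinimalGroupConvCode s3 signAut (rowCode (encAlt f)) :=
  (isMinimal_sign_iff _).2 (Or.inl ⟨f, hf, Or.inr rfl⟩)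

theorem isMinimal_encSign {a c : F5[X]} (hac : IsCoprime a c) :
    IsMinimalGroupConvCode s3 signAut (rowCode (encSign a c)) :=
  (isMinimal_sign_iff _).2 (Or.inr ⟨a, c, hac, isRowSpanCode_encSign a c⟩)

theorem parameters_encSign {a c : F5[X]} (hac : IsCoprime a c) :
    IsEncoder (encSign a c) (rowCode (encSign a c)) ∧
      HasParameters 6 2 (max (2 * a.natDegree) (2 * c.natDegree)) (rowCode (encSign a c)) := by
  have h := isDecomposition_sign.parameters_rowCode four_ne_zero_F5 one_ne_zero
    (map_rho_encSign a c).1 (map_rho_encSign a c).2 hac (isMinimal_encSign hac).isConvCode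
  rw [Nat.mul_max_mul_left]
  exact ⟨h.1, h.2.1⟩

/-! #### The identity automorphism -/

theorem refl_fixes (a : A5) :
    psiP ((AlgEquiv.refl : A5 ≃ₐ[F5] A5) a) = psiP a ∧
      psiM ((AlgEquiv.refl : A5 ≃ₐ[F5] A5) a) = psiM a := ⟨rfl, rfl⟩

theorem psi2_mul_one_refl (a : A5) :
    psi2 a * 1 = 1 * psi2 ((AlgEquiv.refl : A5 ≃ₐ[F5] A5) a) := by
  rw [mul_one, one_mul, AlgEquiv.coe_refl, id]

theorem isDecomposition_refl : IsDecomposition (fixHom refl_fixes psi2_mul_one_refl) 1 :=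
  isDecomposition_fixHom _ _ isUnit_one

theorem map_rho_encId (a c : F5[X]) :
    fixHom refl_fixes psi2_mul_one_refl (rho s3 AlgEquiv.refl (encId a c 0)) =
      (0, vecMulVec ![C 4, 0] ![a, c]) ∧
    fixHom refl_fixes psi2_mul_one_refl (rho s3 AlgEquiv.refl (encId a c 1)) =
      (0, vecMulVec ![0, C 1] ![a, c]) := by
  have h1 : ∀ p : F5[X], aeval ((X : F5[X]) • constMatrix 1) p = p • (1 : M2X) := by
    intro p
    rw [map_one, ← Algebra.algebraMap_eq_smul_one, aeval_algebraMap_apply, aeval_X_left_apply,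
      Algebra.algebraMap_eq_smul_one]
  -- With zero odd parts the conditions involving `signMatrix` are trivial, although here m = 1.
  have h := isDecomposition_refl.map_rho_encPattern (h1 a) (a₂ := 0) (p₂ := 0)
    (by rw [map_zero, zero_smul]) (h1 c) (c₂ := 0) (q₂ := 0) (by rw [map_zero, zero_smul])
  rwa [add_zero, add_zero, ← encId_eq_encPattern] at h

theorem isRowSpanCode_encId (a c : F5[X]) :
    IsRowSpanCode (fixHom refl_fixes psi2_mul_one_refl) a c (rowCode (encId a c)) :=
  isDecomposition_refl.isRowSpanCode_rowCode four_ne_zero_F5 one_ne_zero (map_rho_encId a c).1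
    (map_rho_encId a c).2

theorem isMinimal_refl_iff (D : Submodule F5[X] (Fin 6 → F5[X])) :
    IsMinimalGroupConvCode s3 AlgEquiv.refl D ↔
      (D = rowCode !![1, 1, 1, 1, 1, 1] ∨ D = rowCode !![1, 4, 4, 4, 1, 1]) ∨
      ∃ a c, IsCoprime a c ∧ IsRowSpanCode (fixHom refl_fixes psi2_mul_one_refl) a c D :=
  isMinimalGroupConvCode_fix_iff _ _ isUnit_one D

theorem isMinimal_encId {a c : F5[X]} (hac : IsCoprime a c) :
    IsMinimalGroupConvCode s3 AlgEquiv.refl (rowCode (encId a c)) :=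
  (isMinimal_refl_iff _).2 (Or.inr ⟨a, c, hac, isRowSpanCode_encId a c⟩)

theorem parameters_encId {a c : F5[X]} (hac : IsCoprime a c) :
    IsEncoder (encId a c) (rowCode (encId a c)) ∧
      HasParameters 6 2 (max (2 * a.natDegree) (2 * c.natDegree)) (rowCode (encId a c)) := by
  have h := isDecomposition_refl.parameters_rowCode four_ne_zero_F5 one_ne_zero
    (map_rho_encId a c).1 (map_rho_encId a c).2 hac (isMinimal_encId hac).isConvCode
  rw [Nat.mul_max_mul_left]
  exact ⟨h.1, h.2.1⟩

end Encoders
end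
end GroupConv

namespace GroupConv

noncomputable section

attribute [local instance] fact_prime_five

/-! ### Automorphisms that differ by an inner automorphism -/

section Theta

variable {F A : Type*} [CommRing F] [Ring A] [Algebra F A] {σ σ₀ : A ≃ₐ[F] A}

/-- The homomorphism `A[z; σ] → A[z; σ₀]` that is the identity on `A` and maps `z` to `z u`. -/
def thetaHom (u : Aˣ) (h : ∀ a, σ a = ↑u⁻¹ * σ₀ a * ↑u) : SkewPoly σ →+* SkewPoly σ₀ :=
  skewLift (const σ₀) (zvar σ₀ * const σ₀ ↑u) fun a => by
    -- The relation is a·zu = z σ₀(a) u = zu·σ(a).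
    rw [← mul_assoc, const_mul_zvar, mul_assoc, mul_assoc, ← map_mul, ← map_mul, h, ← mul_assoc,
      ← mul_assoc, Units.mul_inv, one_mul]

@[simp]
theorem thetaHom_const (u : Aˣ) (h : ∀ a, σ a = ↑u⁻¹ * σ₀ a * ↑u) (a : A) :
    thetaHom u h (const σ a) = const σ₀ a := by
  rw [thetaHom, skewLift_const]

@[simp]
theorem thetaHom_zvar (u : Aˣ) (h : ∀ a, σ a = ↑u⁻¹ * σ₀ a * ↑u) :
    thetaHom u h (zvar σ) = zvar σ₀ * const σ₀ ↑u := by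
  rw [thetaHom, skewLift_zvar]

/-- This provides the inverse of `theta` as the same construction for u⁻¹. -/
theorem conj_symm {u : Aˣ} (h : ∀ a, σ a = ↑u⁻¹ * σ₀ a * ↑u) (a : A) :
    σ₀ a = ↑u⁻¹⁻¹ * σ a * ↑u⁻¹ := by
  rw [h, inv_inv, ← mul_assoc, ← mul_assoc, Units.mul_inv, one_mul, mul_assoc, Units.mul_inv,
    mul_one]

theorem thetaHom_comp_thetaHom (u : Aˣ) (h : ∀ a, σ a = ↑u⁻¹ * σ₀ a * ↑u)
    (h' : ∀ a, σ₀ a = ↑u⁻¹⁻¹ * σ a * ↑u⁻¹) :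
    (thetaHom u⁻¹ h').comp (thetaHom u h) = RingHom.id (SkewPoly σ) := by
  refine skew_hom_ext (fun a => by simp) ?_
  simp only [RingHom.comp_apply, thetaHom_zvar, map_mul, thetaHom_const, RingHom.id_apply]
  rw [mul_assoc, ← map_mul, Units.inv_mul, map_one, mul_one]

theorem thetaHom_comp_thetaHom' (u : Aˣ) (h : ∀ a, σ a = ↑u⁻¹ * σ₀ a * ↑u)
    (h' : ∀ a, σ₀ a = ↑u⁻¹⁻¹ * σ a * ↑u⁻¹) :
    (thetaHom u h).comp (thetaHom u⁻¹ h') = RingHom.id (SkewPoly σ₀) := by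
  refine skew_hom_ext (fun a => by simp) ?_
  simp only [RingHom.comp_apply, thetaHom_zvar, map_mul, thetaHom_const, RingHom.id_apply]
  rw [mul_assoc, ← map_mul, Units.mul_inv, map_one, mul_one]

/-- The isomorphism `A[z; σ] → A[z; σ₀]` that is the identity on `A` and maps `z` to `z u`. -/
def theta (u : Aˣ) (h : ∀ a, σ a = ↑u⁻¹ * σ₀ a * ↑u) : SkewPoly σ ≃+* SkewPoly σ₀ :=
  RingEquiv.ofRingHom (thetaHom u h) (thetaHom u⁻¹ (conj_symm h))
    (thetaHom_comp_thetaHom' u h _) (thetaHom_comp_thetaHom u h _)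

@[simp]
theorem theta_const (u : Aˣ) (h : ∀ a, σ a = ↑u⁻¹ * σ₀ a * ↑u) (a : A) :
    theta u h (const σ a) = const σ₀ a := thetaHom_const u h a

@[simp]
theorem theta_zvar (u : Aˣ) (h : ∀ a, σ a = ↑u⁻¹ * σ₀ a * ↑u) :
    theta u h (zvar σ) = zvar σ₀ * const σ₀ ↑u := thetaHom_zvar u h

end Theta

/-! ### Preservation of weights -/

section Weight

variable {F G : Type*} [Field F] [Group G] {n : ℕ} (g : Fin n ≃ G)

/-- Nonzero coefficients are counted by powers of z instead of by coordinates, because `theta` acts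
on each power separately. -/
theorem weight_eq_sum (σ : MonoidAlgebra F G ≃ₐ[F] MonoidAlgebra F G) (y : Fin n → F[X]) {N : ℕ}
    (hN : ∀ i, (y i).natDegree < N) :
    weight y = ∑ j ∈ Finset.range N, (zcoeff σ j (rho g σ y)).coeff.support.card := by
  classical
  have h1 : ∀ j, (zcoeff σ j (rho g σ y)).coeff.support.card =
      ∑ i, if (y i).coeff j ≠ 0 then 1 else 0 := by
    intro j
    rw [← Finset.card_filter]
    refine (Finset.card_bij (fun i _ => g i) ?_ ?_ ?_).symm
    · intro i hi
      rw [Finsupp.mem_support_iff, coeff_zcoeff_rho]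
      exact (Finset.mem_filter.1 hi).2
    · intro i _ i' _ hii
      exact g.injective hii
    · intro x hx
      obtain ⟨i, rfl⟩ := g.surjective x
      rw [Finsupp.mem_support_iff, coeff_zcoeff_rho] at hx
      exact ⟨i, Finset.mem_filter.2 ⟨Finset.mem_univ _, hx⟩, rfl⟩
  simp only [h1]
  rw [Finset.sum_comm, weight]
  refine Finset.sum_congr rfl fun i _ => ?_
  rw [← Finset.card_filter]
  congr 1
  ext j
  rw [Polynomial.mem_support_iff, Finset.mem_filter, Finset.mem_range]
  refine ⟨fun h => ⟨?_, h⟩, fun h => h.2⟩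
  exact (Polynomial.le_natDegree_of_ne_zero h).trans_lt (hN i)

theorem card_support_single_mul (k : G) {c : F} (hc : c ≠ 0) (a : MonoidAlgebra F G) :
    (MonoidAlgebra.single k c * a).coeff.support.card = a.coeff.support.card := by
  refine (Finset.card_bij (fun x _ => k * x) ?_ ?_ ?_).symm
  · intro x hx
    rw [Finsupp.mem_support_iff] at hx ⊢
    rw [MonoidAlgebra.coeff_single_mul_mul]
    exact mul_ne_zero hc hx
  · intro x _ x' _ h
    exact mul_left_cancel h
  · intro x hx
    refine ⟨k⁻¹ * x, ?_, mul_inv_cancel_left k x⟩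
    rw [Finsupp.mem_support_iff] at hx ⊢
    rw [← mul_inv_cancel_left k x, MonoidAlgebra.coeff_single_mul_mul] at hx
    exact right_ne_zero_of_mul hx

variable {σ σ₀ : MonoidAlgebra F G ≃ₐ[F] MonoidAlgebra F G} {u : (MonoidAlgebra F G)ˣ}

/-- As σ₀ only rescales group elements, (zu)ʲ is zʲ times a monomial. Left multiplication by a
nonzero monomial permutes supports. -/
theorem exists_zcoeff_theta (h : ∀ a, σ a = ↑u⁻¹ * σ₀ a * ↑u) {x : G}
    (hu : (u : MonoidAlgebra F G) = MonoidAlgebra.single x 1)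
    (hσ₀ : ∀ y : G, ∃ k : F, k ≠ 0 ∧
      σ₀ (MonoidAlgebra.single y 1) = MonoidAlgebra.single y k) (j : ℕ) :
    ∃ (y : G) (k : F), k ≠ 0 ∧
      ∀ r, zcoeff σ₀ j (theta u h r) = MonoidAlgebra.single y k * zcoeff σ j r := by
  have hpow : ∀ j : ℕ, ∃ (y : G) (k : F), k ≠ 0 ∧ (zvar σ₀ * const σ₀ ↑u) ^ j =
      zvar σ₀ ^ j * const σ₀ (MonoidAlgebra.single y k) := by
    intro j
    induction j with
    | zero => exact ⟨1, 1, one_ne_zero, by simp [← MonoidAlgebra.one_def]⟩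
    | succ j ih =>
      obtain ⟨y, k, hk, hj⟩ := ih
      obtain ⟨l, hl, hly⟩ := hσ₀ y
      refine ⟨y * x, k * l, mul_ne_zero hk hl, ?_⟩
      have h1 : σ₀ (MonoidAlgebra.single y k) = MonoidAlgebra.single y (k * l) := by
        rw [← mul_one k, ← smul_eq_mul, ← MonoidAlgebra.smul_single, map_smul, hly,
          MonoidAlgebra.smul_single, smul_eq_mul, smul_eq_mul, mul_one]
      rw [pow_succ, hj, mul_assoc, ← mul_assoc (const σ₀ _), const_mul_zvar, h1, hu, mul_assoc,
        ← map_mul, MonoidAlgebra.single_mul_single, mul_one, ← mul_assoc, ← pow_succ]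
  choose y k hk hyk using hpow
  refine ⟨y j, k j, hk j, fun r => ?_⟩
  induction r using skew_induction with
  | h0 => simp
  | hadd p q hp hq => simp [hp, hq, mul_add]
  | hmon i a =>
    rw [map_mul, map_pow, theta_zvar, theta_const, hyk, mul_assoc, ← map_mul,
      zcoeff_zvar_pow_mul_const, zcoeff_zvar_pow_mul_const]
    split_ifs with hij
    · rw [hij]
    · rw [mul_zero]

theorem weight_eq_of_theta (h : ∀ a, σ a = ↑u⁻¹ * σ₀ a * ↑u) {x : G}
    (hu : (u : MonoidAlgebra F G) = MonoidAlgebra.single x 1)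
    (hσ₀ : ∀ y : G, ∃ k : F, k ≠ 0 ∧
      σ₀ (MonoidAlgebra.single y 1) = MonoidAlgebra.single y k)
    {y y₀ : Fin n → F[X]} (hy : theta u h (rho g σ y) = rho g σ₀ y₀) : weight y = weight y₀ := by
  set N := (Finset.univ.sup fun i => (y i).natDegree) +
    (Finset.univ.sup fun i => (y₀ i).natDegree) + 1 with hN
  have h1 : ∀ i, (y i).natDegree < N := fun i => by
    have := Finset.le_sup (f := fun i => (y i).natDegree) (Finset.mem_univ i)
    omega
  have h2 : ∀ i, (y₀ i).natDegree < N := fun i => by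
    have := Finset.le_sup (f := fun i => (y₀ i).natDegree) (Finset.mem_univ i)
    omega
  rw [weight_eq_sum g σ y h1, weight_eq_sum g σ₀ y₀ h2, ← hy]
  refine Finset.sum_congr rfl fun j _ => ?_
  obtain ⟨k, c, hc, hk⟩ := exists_zcoeff_theta h hu hσ₀ j
  rw [hk, card_support_single_mul k hc]

end Weight

/-! ### Reduction to the identity and the sign automorphism -/

section Reduction

open Matrix

/-- Conjugation induces every permutation of the three transpositions, so an ordered pair of
distinct ones can be moved to the chosen generators. -/
theorem exists_perm_conj : ∀ p q : S3,
    (p ≠ 1 ∧ p * p = 1 ∧ q ≠ 1 ∧ q * q = 1 ∧ p ≠ q) → ∃ h : S3, p = h⁻¹ * Equiv.swap 0 1 * h ∧ q = h⁻¹ * Equiv.swap 1 2 * h := by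
  decide

theorem perm_eq_word : ∀ g : S3, g = 1 ∨ g = Equiv.swap 0 1 ∨ g = Equiv.swap 1 2 ∨
    g = Equiv.swap 0 1 * Equiv.swap 1 2 ∨ g = Equiv.swap 1 2 * Equiv.swap 0 1 ∨
    g = Equiv.swap 0 1 * Equiv.swap 1 2 * Equiv.swap 0 1 := by
  decide

/-- Every automorphism of `S₃` is inner. -/
theorem exists_conj_of_monoidHom (α : S3 →* S3) (hα : Function.Injective α) :
    ∃ h : S3, ∀ g, α g = h⁻¹ * g * h := by
  have hs : (Equiv.swap 0 1 : S3) ≠ 1 ∧ (Equiv.swap 1 2 : S3) ≠ 1 ∧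
      (Equiv.swap 0 1 : S3) ≠ Equiv.swap 1 2 := by decide
  have h1 : ∀ g : S3, g ≠ 1 → α g ≠ 1 := fun g hg h => hg (hα (by rw [h, map_one]))
  obtain ⟨h, hp, hq⟩ := exists_perm_conj (α (Equiv.swap 0 1)) (α (Equiv.swap 1 2))
    ⟨h1 _ hs.1, by rw [← map_mul, Equiv.swap_mul_self, map_one],
      h1 _ hs.2.1, by rw [← map_mul, Equiv.swap_mul_self, map_one], fun h => hs.2.2 (hα h)⟩
  refine ⟨h, fun g => ?_⟩
  rcases perm_eq_word g with rfl | rfl | rfl | rfl | rfl | rfl <;>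
    simp only [map_mul, map_one, hp, hq] <;> group

theorem single_injective_of_ne_zero {g h : S3} {k l : F5} (hk : k ≠ 0)
    (e : (MonoidAlgebra.single g k : A5) = MonoidAlgebra.single h l) : g = h ∧ k = l := by
  have h1 := congr(($e).coeff g)
  by_cases hgh : h = g
  · subst hgh
    exact ⟨rfl, by simpa using h1⟩
  · simp [hgh, hk] at h1

/-- A monomial automorphism is, up to conjugation by a group element, determined by its action on
the one-dimensional representations. -/
theorem exists_conj_of_monomial (σ : A5 ≃ₐ[F5] A5) (χ : S3 →* F5)
    (hσ : ∀ g : S3, ∃ (h : S3) (k : F5),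
      σ (MonoidAlgebra.single g 1) = MonoidAlgebra.single h k)
    (hχ : (∀ a, psiP (σ a) = psiP a ∧ psiM (σ a) = psiM a) ∧ (∀ g, χ g = 1) ∨
      (∀ a, psiP (σ a) = psiM a ∧ psiM (σ a) = psiP a) ∧
        ∀ g, χ g = ((Equiv.Perm.sign g : ℤ) : F5)) :
    ∃ h : S3, ∀ g : S3, σ (MonoidAlgebra.single g 1) =
      MonoidAlgebra.single (h⁻¹ * g * h) (χ g) := by
  have hk : ∀ g : S3, ∃ h : S3,
      σ (MonoidAlgebra.single g 1) = MonoidAlgebra.single h (χ g) := by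
    intro g
    obtain ⟨h, k, hg⟩ := hσ g
    -- The trivial character reads off the scalar, so k is determined by the action of σ on the
    -- characters.
    have h1 : psiP (σ (MonoidAlgebra.single g 1)) = k := by rw [hg, psiP_single]
    refine ⟨h, ?_⟩
    rw [hg, ← h1]
    rcases hχ with ⟨h2, h3⟩ | ⟨h2, h3⟩
    · rw [(h2 _).1, h3, psiP_single]
    · rw [(h2 _).1, h3, psiM_single, one_mul]
  choose α hα using hk
  have hχ0 : ∀ g, χ g ≠ 0 := fun g h => by
    have h1 : χ g * χ g⁻¹ = 1 := by rw [← map_mul, mul_inv_cancel, map_one]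
    rw [h, zero_mul] at h1
    exact zero_ne_one h1
  -- Needed for injectivity of α. In the sign case χ(g) is the inverse of the sign of α(g).
  have hχα : ∀ g h, α g = α h → χ g = χ h := by
    intro g h hgh
    rcases hχ with ⟨-, h3⟩ | ⟨h2, h3⟩
    · rw [h3, h3]
    · have e1 : ∀ g, χ g * ((Equiv.Perm.sign (α g) : ℤ) : F5) = 1 := by
        intro g
        rw [← psiM_single, ← hα, (h2 _).2, psiP_single]
      have h4 := e1 g
      rw [hgh, ← e1 h] at h4
      refine mul_right_cancel₀ (fun h0 => ?_) h4
      have h5 := e1 h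
      rw [h0, mul_zero] at h5
      exact zero_ne_one h5
  let α' : S3 →* S3 := MonoidHom.mk' α fun g h => by
    have h1 : σ (MonoidAlgebra.single (g * h) 1) =
        σ (MonoidAlgebra.single g 1) * σ (MonoidAlgebra.single h 1) := by
      rw [← map_mul, MonoidAlgebra.single_mul_single, mul_one]
    rw [hα, hα, hα, MonoidAlgebra.single_mul_single] at h1
    exact (single_injective_of_ne_zero (hχ0 _) h1).1
  obtain ⟨h, hh⟩ := exists_conj_of_monoidHom α' (fun g h hgh => by
    have h1 : σ (MonoidAlgebra.single g 1) = σ (MonoidAlgebra.single h 1) := by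
      rw [hα, hα, hχα g h hgh]
      exact congr(MonoidAlgebra.single $hgh _)
    exact (single_injective_of_ne_zero one_ne_zero (σ.injective h1)).1)
  exact ⟨h, fun g => by rw [hα]; exact congr(MonoidAlgebra.single $(hh g) _)⟩

/-- A group element as a unit of the group algebra. -/
def groupUnit (h : S3) : A5ˣ where
  val := MonoidAlgebra.single h 1
  inv := MonoidAlgebra.single h⁻¹ 1
  val_inv := by simp [MonoidAlgebra.single_mul_single, MonoidAlgebra.one_def]
  inv_val := by simp [MonoidAlgebra.single_mul_single, MonoidAlgebra.one_def]

/-- The unit of the group algebra that acts as the identity on the one-dimensional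
representations and has a given matrix. -/
def blockUnit (p : M2ˣ) : A5ˣ where
  val := ε₁ + ε₂ + block p
  inv := ε₁ + ε₂ + block ↑p⁻¹
  val_inv := psi_ext (by simp) (by simp) (by simp)
  inv_val := psi_ext (by simp) (by simp) (by simp)

theorem eq_conj_groupUnit {σ σ₀ : A5 ≃ₐ[F5] A5} {h : S3} {χ : S3 → F5}
    (hσ : ∀ g : S3, σ (MonoidAlgebra.single g 1) = MonoidAlgebra.single (h⁻¹ * g * h) (χ g))
    (hσ₀ : ∀ g : S3, σ₀ (MonoidAlgebra.single g 1) = MonoidAlgebra.single g (χ g)) (a : A5) :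
    σ a = ↑(groupUnit h)⁻¹ * σ₀ a * ↑(groupUnit h) := by
  suffices e : σ.toLinearMap = (LinearMap.mulRight F5 ↑(groupUnit h)) ∘ₗ
      (LinearMap.mulLeft F5 ↑(groupUnit h)⁻¹) ∘ₗ σ₀.toLinearMap from congr($e a)
  refine MonoidAlgebra.lhom_ext' fun g => LinearMap.ext_ring ?_
  change σ (MonoidAlgebra.single g 1) = MonoidAlgebra.single h⁻¹ 1 *
    σ₀ (MonoidAlgebra.single g 1) * MonoidAlgebra.single h 1
  rw [hσ, hσ₀, MonoidAlgebra.single_mul_single, MonoidAlgebra.single_mul_single, one_mul, mul_one]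

/-- On the matrix block the automorphisms are conjugations by m and m₀, so they differ by m₀⁻¹m. On
the characters they agree, and there the unit acts as 1. -/
theorem eq_conj_blockUnit {σ σ₀ : A5 ≃ₐ[F5] A5} {m m₀ : M2ˣ}
    (hP : ∀ a, psiP (σ a) = psiP (σ₀ a)) (hM : ∀ a, psiM (σ a) = psiM (σ₀ a))
    (hm : ∀ a, psi2 a * m = m * psi2 (σ a)) (hm₀ : ∀ a, psi2 a * m₀ = m₀ * psi2 (σ₀ a)) (a : A5) :
    σ a = ↑(blockUnit (m₀⁻¹ * m))⁻¹ * σ₀ a * ↑(blockUnit (m₀⁻¹ * m)) := by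
  have h1 : (↑(blockUnit (m₀⁻¹ * m)) : A5) = ε₁ + ε₂ + block ↑(m₀⁻¹ * m) := rfl
  have h2 : (↑(blockUnit (m₀⁻¹ * m))⁻¹ : A5) = ε₁ + ε₂ + block ↑(m₀⁻¹ * m)⁻¹ := rfl
  rw [h1, h2]
  refine psi_ext (by simp [hP]) (by simp [hM]) ?_
  simp only [map_mul, map_add, psi2_ε₁, psi2_ε₂, psi2_block, zero_add, _root_.mul_inv_rev, inv_inv,
    Units.val_mul]
  have e1 : psi2 (σ a) = ↑m⁻¹ * psi2 a * m := by rw [mul_assoc, hm, Units.inv_mul_cancel_left]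
  have e2 : psi2 (σ₀ a) = ↑m₀⁻¹ * psi2 a * m₀ := by
    rw [mul_assoc, hm₀, Units.inv_mul_cancel_left]
  rw [e1, e2]
  simp only [mul_assoc, Units.mul_inv_cancel_left]

/-- Every automorphism of `F₅[S₃]` is the composition of the identity or the sign automorphism
and an inner automorphism, which comes from a group element if the automorphism is monomial. -/
theorem exists_conj_unit (σ : A5 ≃ₐ[F5] A5) :
    ∃ σ₀ : A5 ≃ₐ[F5] A5,
      ((σ₀ = AlgEquiv.refl ∧ σ ε₁ = ε₁ ∧ σ ε₂ = ε₂) ∨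
        (σ₀ = signAut ∧ σ ε₁ = ε₂ ∧ σ ε₂ = ε₁)) ∧
      ∃ u : A5ˣ, (∀ a : A5, σ a = ↑u⁻¹ * σ₀ a * ↑u) ∧
        ((∀ g : S3, ∃ (h : S3) (k : F5),
          σ (MonoidAlgebra.single g 1) = MonoidAlgebra.single h k) →
          ∃ x : S3, (u : A5) = MonoidAlgebra.single x 1) := by
  obtain ⟨⟨_, ⟨m, rfl⟩, hm⟩, hσ⟩ := exists_matrix_of_aut σ
  have h2 : ∀ a, psi2 a = 0 → psi2 (σ a) = 0 := fun a ha => by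
    have h := hm a
    rw [ha, zero_mul] at h
    exact (Units.mul_right_eq_zero m).1 h.symm
  have key : ∀ (σ₀ : A5 ≃ₐ[F5] A5) (m₀ : M2ˣ) (χ : S3 →* F5),
      (∀ a, psiP (σ a) = psiP (σ₀ a)) → (∀ a, psiM (σ a) = psiM (σ₀ a)) →
      (∀ a, psi2 a * m₀ = m₀ * psi2 (σ₀ a)) →
      (∀ g : S3, σ₀ (MonoidAlgebra.single g 1) = MonoidAlgebra.single g (χ g)) →
      ((∀ a, psiP (σ a) = psiP a ∧ psiM (σ a) = psiM a) ∧ (∀ g, χ g = 1) ∨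
        (∀ a, psiP (σ a) = psiM a ∧ psiM (σ a) = psiP a) ∧
          ∀ g, χ g = ((Equiv.Perm.sign g : ℤ) : F5)) →
      ∃ u : A5ˣ, (∀ a : A5, σ a = ↑u⁻¹ * σ₀ a * ↑u) ∧
        ((∀ g : S3, ∃ (h : S3) (k : F5),
          σ (MonoidAlgebra.single g 1) = MonoidAlgebra.single h k) →
          ∃ x : S3, (u : A5) = MonoidAlgebra.single x 1) := by
    intro σ₀ m₀ χ hP hM hm₀ hσ₀ hχ
    -- The unit is not unique: a monomial σ calls for a group element, any other σ is served by the
    -- block unit.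
    by_cases hmon : ∀ g : S3, ∃ (h : S3) (k : F5),
        σ (MonoidAlgebra.single g 1) = MonoidAlgebra.single h k
    · obtain ⟨h, hh⟩ := exists_conj_of_monomial σ χ hmon hχ
      exact ⟨groupUnit h, eq_conj_groupUnit hh hσ₀, fun _ => ⟨h, rfl⟩⟩
    · exact ⟨blockUnit (m₀⁻¹ * m), eq_conj_blockUnit hP hM hm hm₀, fun h => absurd h hmon⟩
  rcases hσ with hσ | hσ
  · refine ⟨AlgEquiv.refl, Or.inl ⟨rfl, ?_, ?_⟩, key _ 1 1 (fun a => (hσ a).1)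
      (fun a => (hσ a).2) psi2_mul_one_refl (fun g => rfl) (Or.inl ⟨hσ, fun g => rfl⟩)⟩
    · exact psi_ext (by simp [hσ]) (by simp [hσ]) (by rw [h2 _ psi2_ε₁, psi2_ε₁])
    · exact psi_ext (by simp [hσ]) (by simp [hσ]) (by rw [h2 _ psi2_ε₂, psi2_ε₂])
  · obtain ⟨m₀, hm₀⟩ := isUnit_signMatrix
    refine ⟨signAut, Or.inr ⟨rfl, ?_, ?_⟩, key _ m₀
      { toFun := fun g => ((Equiv.Perm.sign g : ℤ) : F5)
        map_one' := by simp
        map_mul' := fun g h => by simp }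
      (fun a => by rw [(hσ a).1, psiP_signAut])
      (fun a => by rw [(hσ a).2, psiM_signAut]) (by rw [hm₀]; exact psi2_mul_signMatrix)
      (fun g => by rw [signAut_single, one_mul]; rfl) (Or.inr ⟨hσ, fun g => rfl⟩)⟩
    · exact psi_ext (by simp [hσ]) (by simp [hσ]) (by rw [h2 _ psi2_ε₁, psi2_ε₂])
    · exact psi_ext (by simp [hσ]) (by simp [hσ]) (by rw [h2 _ psi2_ε₂, psi2_ε₁])

end Reduction
end
end GroupConv

namespace GroupConv

noncomputable section

attribute [local instance] fact_prime_five

/-! ### Codes in the two components -/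

section Components

open Matrix Polynomial

variable {T : Type*} [Ring T] {σ : A5 ≃ₐ[F5] A5} {m : M2} {Φ : SkewPoly σ →+* T × M2X}

/-- This keeps the two families of minimal codes apart: a coprime pair is not (0, 0). -/
theorem IsRowSpanCode.exists_snd_ne_zero {a c : F5[X]} {D : Submodule F5[X] (Fin 6 → F5[X])}
    (hD : IsRowSpanCode Φ a c D) (h : IsDecomposition Φ m) (hac : IsCoprime a c) :
    ∃ y ∈ D, (Φ (rho s3 σ y)).2 ≠ 0 := by
  obtain ⟨r, hr⟩ := h.exists_eq_zero_snd (vecMulVec ![1, 0] ![a, c])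
  obtain ⟨y, rfl⟩ := rho_surjective s3 σ r
  refine ⟨y, (hD y).2 ⟨_, hr⟩, fun h0 => ?_⟩
  rw [hr] at h0
  have ha := congr_fun (congr_fun h0 0) 0
  have hc := congr_fun (congr_fun h0 0) 1
  simp [vecMulVec_apply] at ha hc
  subst ha hc
  exact not_isUnit_zero (isCoprime_zero_left.1 hac)

theorem IsDecomposition.exists_fst_ne_zero {k : ℕ} {M : Matrix (Fin k) (Fin 6) F5[X]}
    (h : IsDecomposition Φ m) {i : Fin k} (hM : M i ≠ 0)
    (h2 : ∀ y ∈ rowCode M, (Φ (rho s3 σ y)).2 = 0) :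
    ∃ y ∈ rowCode M, (Φ (rho s3 σ y)).1 ≠ 0 := by
  have hi : M i ∈ rowCode M := Submodule.subset_span ⟨i, rfl⟩
  refine ⟨M i, hi, fun h1 => hM (rho_injective s3 σ (h.injective ?_))⟩
  have h0 : rho s3 σ (0 : Fin 6 → F5[X]) = 0 := rho_zero s3 σ
  rw [h0, map_zero]
  exact Prod.ext h1 (h2 _ hi)

/-- The minimal codes in each of the two components. -/
theorem IsDecomposition.components {Q : Submodule F5[X] (Fin 6 → F5[X]) → Prop}
    {E : F5[X] → F5[X] → Matrix (Fin 2) (Fin 6) F5[X]} (h : IsDecomposition Φ m)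
    (hmin : ∀ D, IsMinimalGroupConvCode s3 σ D ↔
      Q D ∨ ∃ a c, IsCoprime a c ∧ IsRowSpanCode Φ a c D)
    (hQ2 : ∀ D, Q D → ∀ y ∈ D, (Φ (rho s3 σ y)).2 = 0)
    (hQ1 : ∀ D, Q D → ∃ y ∈ D, (Φ (rho s3 σ y)).1 ≠ 0)
    (hE : ∀ a c, IsRowSpanCode Φ a c (rowCode (E a c))) :
    (∀ D, IsMinimalGroupConvCode s3 σ D →
      (∀ y ∈ D, (Φ (rho s3 σ y)).2 = 0) ∨ ∀ y ∈ D, (Φ (rho s3 σ y)).1 = 0) ∧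
    (∀ D, (IsMinimalGroupConvCode s3 σ D ∧ ∀ y ∈ D, (Φ (rho s3 σ y)).2 = 0) ↔ Q D) ∧
    ∀ D, (IsMinimalGroupConvCode s3 σ D ∧ ∀ y ∈ D, (Φ (rho s3 σ y)).1 = 0) ↔
      ∃ a c, IsCoprime a c ∧ D = rowCode (E a c) := by
  have hfst : ∀ D a c, IsRowSpanCode Φ a c D → ∀ y ∈ D, (Φ (rho s3 σ y)).1 = 0 := by
    intro D a c hD y hy
    obtain ⟨w, hw⟩ := (hD y).1 hy
    rw [hw]
  refine ⟨fun D hD => ?_, fun D => ⟨?_, fun hD => ⟨(hmin D).2 (Or.inl hD), hQ2 D hD⟩⟩,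
    fun D => ⟨?_, ?_⟩⟩
  · rcases (hmin D).1 hD with hD | ⟨a, c, -, hD⟩
    · exact Or.inl (hQ2 D hD)
    · exact Or.inr (hfst D a c hD)
  · rintro ⟨hD, h2⟩
    rcases (hmin D).1 hD with hD | ⟨a, c, hac, hD⟩
    · exact hD
    · obtain ⟨y, hy, hne⟩ := hD.exists_snd_ne_zero h hac
      exact absurd (h2 y hy) hne
  · rintro ⟨hD, h1⟩
    rcases (hmin D).1 hD with hD | ⟨a, c, hac, hD⟩
    · obtain ⟨y, hy, hne⟩ := hQ1 D hD
      exact absurd (h1 y hy) hne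
    · exact ⟨a, c, hac, hD.eq (hE a c)⟩
  · rintro ⟨a, c, hac, rfl⟩
    exact ⟨(hmin _).2 (Or.inr ⟨a, c, hac, hE a c⟩), hfst _ a c (hE a c)⟩

theorem IsDecomposition.map_const (h : IsDecomposition Φ m) {a : A5} (h1 : psiP a = 0)
    (h2 : psiM a = 0) : Φ (const σ a) = (0, constMatrix (psi2 a)) :=
  Prod.ext (h.const_fst a h1 h2) (h.const_snd a)

theorem snd_eq_zero_of_mem_encSym (f : F5[X]) (y : Fin 6 → F5[X]) (hy : y ∈ rowCode (encSym f)) :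
    (swapHom signAut_swaps psi2_mul_signMatrix (rho s3 signAut y)).2 = 0 := by
  obtain ⟨f₀, f₁, rfl⟩ := exists_interleave f
  exact ((mem_rowCode_encSym _ _ isUnit_signMatrix f₀ f₁ y).1 hy).2

theorem snd_eq_zero_of_mem_encAlt (f : F5[X]) (y : Fin 6 → F5[X]) (hy : y ∈ rowCode (encAlt f)) :
    (swapHom signAut_swaps psi2_mul_signMatrix (rho s3 signAut y)).2 = 0 := by
  obtain ⟨f₀, f₁, rfl⟩ := exists_interleave f
  exact ((mem_rowCode_encAlt _ _ isUnit_signMatrix f₀ f₁ y).1 hy).2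

theorem swapEquiv_apply (hσ : ∀ a, psiP (σ a) = psiM a ∧ psiM (σ a) = psiP a)
    (hm : ∀ a, psi2 a * m = m * psi2 (σ a)) (hmu : IsUnit m) (r : SkewPoly σ) :
    swapEquiv hσ hm hmu r = swapHom hσ hm r := rfl

theorem fixEquiv_apply (hσ : ∀ a, psiP (σ a) = psiP a ∧ psiM (σ a) = psiM a)
    (hm : ∀ a, psi2 a * m = m * psi2 (σ a)) (hmu : IsUnit m) (r : SkewPoly σ) :
    fixEquiv hσ hm hmu r = fixHom hσ hm r := rfl

theorem constMatrix_fin_two (p q r s : F5) :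
    constMatrix !![p, q; r, s] = !![C p, C q; C r, C s] := by
  ext1 i j
  fin_cases i <;> fin_cases j <;> rfl

theorem psi2_signAut_eq_zero {a : A5} (ha : psi2 a = 0) : psi2 (signAut a) = 0 := by
  have h := psi2_mul_signMatrix a
  rw [ha, zero_mul] at h
  exact (isUnit_signMatrix.mul_right_eq_zero).1 h.symm

theorem signAut_ε₁ : signAut ε₁ = ε₂ :=
  psi_ext (by simp [psiP_signAut]) (by simp [psiM_signAut])
    (by rw [psi2_signAut_eq_zero psi2_ε₁, psi2_ε₂])

theorem signAut_ε₂ : signAut ε₂ = ε₁ :=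
  psi_ext (by simp [psiP_signAut]) (by simp [psiM_signAut])
    (by rw [psi2_signAut_eq_zero psi2_ε₂, psi2_ε₁])

/-- The powers of 1 + z work: (1 + z) + (1 - z) = 2 is a unit, with inverse 3. -/
theorem exists_isCoprime_reflect (t : ℕ) :
    ∃ f : F5[X], IsCoprime f (reflect f) ∧ f.natDegree = t := by
  refine ⟨(X + C 1) ^ t, ?_, by rw [natDegree_pow, natDegree_X_add_C, mul_one]⟩
  rw [reflect, pow_comp]
  refine IsCoprime.pow ⟨C 3, C 3, ?_⟩
  have h : (C 3 + C 3 : F5[X]) = 1 := by rw [← C_add]; exact congrArg C (by decide)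
  simp only [add_comp, X_comp, C_comp]
  rw [← h, C_1]
  ring

end Components

end
end GroupConv

/-! ### Assembly of the theorem -/

theorem mainTheorem1 :
    -- the automorphism `g ↦ sign(g) g`, which interchanges the central idempotents `ε₁` and `ε₂`
    (signAut ε₁ = ε₂ ∧ signAut ε₂ = ε₁ ∧
      ∃ φ : SkewPoly signAut ≃+* lowerDivRing × Matrix (Fin 2) (Fin 2) F5[X],
        -- the images of the generators under the decomposition isomorphism
        ((φ (zvar signAut)).1 : Matrix (Fin 2) (Fin 2) F5[X]) = !![0, 1; Polynomial.X, 0] ∧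
        (φ (zvar signAut)).2 = (Polynomial.X : F5[X]) • !![2, 4; 1, 3] ∧
        ((φ (const signAut ε₁)).1 : Matrix (Fin 2) (Fin 2) F5[X]) = !![1, 0; 0, 0] ∧
        (φ (const signAut ε₁)).2 = 0 ∧
        ((φ (const signAut ε₂)).1 : Matrix (Fin 2) (Fin 2) F5[X]) = !![0, 0; 0, 1] ∧
        (φ (const signAut ε₂)).2 = 0 ∧
        φ (const signAut ε₃) = (0, !![1, 0; 0, 0]) ∧
        φ (const signAut ε₃₄) = (0, !![0, 1; 0, 0]) ∧
        φ (const signAut ε₄₃) = (0, !![0, 0; 1, 0]) ∧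
        φ (const signAut ε₄) = (0, !![0, 0; 0, 1]) ∧
        -- every minimal code lies in one of the two components
        (∀ C : Submodule F5[X] (Fin 6 → F5[X]), IsMinimalGroupConvCode s3 signAut C →
          (∀ y ∈ C, (φ (rho s3 signAut y)).2 = 0) ∨ (∀ y ∈ C, (φ (rho s3 signAut y)).1 = 0)) ∧
        -- the minimal codes in the first component
        (∀ C : Submodule F5[X] (Fin 6 → F5[X]),
          (IsMinimalGroupConvCode s3 signAut C ∧ ∀ y ∈ C, (φ (rho s3 signAut y)).2 = 0) ↔
            ∃ f : F5[X], IsCoprime f (reflect f) ∧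
              (C = rowCode (encSym f) ∨ C = rowCode (encAlt f))) ∧
        -- the minimal codes in the second component
        (∀ C : Submodule F5[X] (Fin 6 → F5[X]),
          (IsMinimalGroupConvCode s3 signAut C ∧ ∀ y ∈ C, (φ (rho s3 signAut y)).1 = 0) ↔
            ∃ a c : F5[X], IsCoprime a c ∧ C = rowCode (encSign a c))) ∧
    -- bases and complexities in this case
    (∀ f : F5[X], IsCoprime f (reflect f) →
      IsEncoder (encSym f) (rowCode (encSym f)) ∧
      HasParameters 6 1 f.natDegree (rowCode (encSym f)) ∧
      IsEncoder (encAlt f) (rowCode (encAlt f)) ∧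
      HasParameters 6 1 f.natDegree (rowCode (encAlt f))) ∧
    (∀ a c : F5[X], IsCoprime a c →
      IsEncoder (encSign a c) (rowCode (encSign a c)) ∧
      HasParameters 6 2 (max (2 * a.natDegree) (2 * c.natDegree)) (rowCode (encSign a c))) ∧
    -- the identity automorphism
    (∃ φ : SkewPoly (AlgEquiv.refl : A5 ≃ₐ[F5] A5) ≃+*
        (F5[X] × F5[X]) × Matrix (Fin 2) (Fin 2) F5[X],
      φ (zvar AlgEquiv.refl) = ((Polynomial.X, Polynomial.X), (Polynomial.X : F5[X]) • 1) ∧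
      φ (const AlgEquiv.refl ε₁) = ((1, 0), 0) ∧
      φ (const AlgEquiv.refl ε₂) = ((0, 1), 0) ∧
      φ (const AlgEquiv.refl ε₃) = (0, !![1, 0; 0, 0]) ∧
      φ (const AlgEquiv.refl ε₃₄) = (0, !![0, 1; 0, 0]) ∧
      φ (const AlgEquiv.refl ε₄₃) = (0, !![0, 0; 1, 0]) ∧
      φ (const AlgEquiv.refl ε₄) = (0, !![0, 0; 0, 1]) ∧
      (∀ C : Submodule F5[X] (Fin 6 → F5[X]), IsMinimalGroupConvCode s3 AlgEquiv.refl C →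
        (∀ y ∈ C, (φ (rho s3 AlgEquiv.refl y)).2 = 0) ∨
        (∀ y ∈ C, (φ (rho s3 AlgEquiv.refl y)).1 = 0)) ∧
      (∀ C : Submodule F5[X] (Fin 6 → F5[X]),
        (IsMinimalGroupConvCode s3 AlgEquiv.refl C ∧
            ∀ y ∈ C, (φ (rho s3 AlgEquiv.refl y)).2 = 0) ↔
          C = rowCode !![1, 1, 1, 1, 1, 1] ∨ C = rowCode !![1, 4, 4, 4, 1, 1]) ∧
      (∀ C : Submodule F5[X] (Fin 6 → F5[X]),
        (IsMinimalGroupConvCode s3 AlgEquiv.refl C ∧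
            ∀ y ∈ C, (φ (rho s3 AlgEquiv.refl y)).1 = 0) ↔
          ∃ a c : F5[X], IsCoprime a c ∧ C = rowCode (encId a c))) ∧
    -- bases and complexities in this case
    (HasParameters 6 1 0 (rowCode (!![1, 1, 1, 1, 1, 1] : Matrix (Fin 1) (Fin 6) F5[X])) ∧
      HasParameters 6 1 0 (rowCode (!![1, 4, 4, 4, 1, 1] : Matrix (Fin 1) (Fin 6) F5[X])) ∧
      ∀ a c : F5[X], IsCoprime a c →
        IsEncoder (encId a c) (rowCode (encId a c)) ∧
        HasParameters 6 2 (max (2 * a.natDegree) (2 * c.natDegree)) (rowCode (encId a c))) ∧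
    -- reduction of an arbitrary automorphism to these two cases
    (∀ σ : A5 ≃ₐ[F5] A5, ∃ σ₀ : A5 ≃ₐ[F5] A5,
      ((σ₀ = AlgEquiv.refl ∧ σ ε₁ = ε₁ ∧ σ ε₂ = ε₂) ∨
        (σ₀ = signAut ∧ σ ε₁ = ε₂ ∧ σ ε₂ = ε₁)) ∧
      ∃ u : A5ˣ, (∀ a : A5, σ a = ↑u⁻¹ * σ₀ a * ↑u) ∧
        ∃ θ : SkewPoly σ ≃+* SkewPoly σ₀,
          (∀ a : A5, θ (const σ a) = const σ₀ a) ∧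
          θ (zvar σ) = zvar σ₀ * const σ₀ ↑u ∧
          (∀ C : Submodule F5[X] (Fin 6 → F5[X]),
            IsMinimalGroupConvCode s3 σ C ↔
              ∃ C₀ : Submodule F5[X] (Fin 6 → F5[X]), IsMinimalGroupConvCode s3 σ₀ C₀ ∧
                θ '' (rho s3 σ '' C) = rho s3 σ₀ '' C₀) ∧
          -- `θ` preserves the weight if `σ` permutes the group elements up to scalars
          ((∀ g : S3, ∃ (h : S3) (k : F5),
              σ (MonoidAlgebra.single g 1) = MonoidAlgebra.single h k) →
            ∀ y y₀ : Fin 6 → F5[X], θ (rho s3 σ y) = rho s3 σ₀ y₀ → weight y = weight y₀)) ∧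
    -- the parameters of all minimal codes
    (∀ (σ : A5 ≃ₐ[F5] A5) (C : Submodule F5[X] (Fin 6 → F5[X])),
      IsMinimalGroupConvCode s3 σ C →
        ∃ t : ℕ,
          (HasParameters 6 1 t C ∧ HasForneyIndices C ![t]) ∨
          (HasParameters 6 2 (2 * t) C ∧ HasForneyIndices C ![t, t])) ∧
    -- every `t` occurs
    (∀ t : ℕ,
      (∃ C : Submodule F5[X] (Fin 6 → F5[X]),
        IsMinimalGroupConvCode s3 signAut C ∧ HasParameters 6 1 t C) ∧
      (∃ C : Submodule F5[X] (Fin 6 → F5[X]),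
        IsMinimalGroupConvCode s3 signAut C ∧ HasParameters 6 2 (2 * t) C) ∧
      (∃ C : Submodule F5[X] (Fin 6 → F5[X]),
        IsMinimalGroupConvCode s3 AlgEquiv.refl C ∧ HasParameters 6 2 (2 * t) C)) := by
  have := fact_prime_five
  obtain ⟨hs1, hs2, hs3⟩ := isDecomposition_sign.components isMinimal_sign_iff (E := encSign)
    (by
      rintro D ⟨f, -, rfl | rfl⟩
      · exact snd_eq_zero_of_mem_encSym f
      · exact snd_eq_zero_of_mem_encAlt f)
    (by
      rintro D ⟨f, hf, rfl | rfl⟩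
      · exact isDecomposition_sign.exists_fst_ne_zero (i := 0)
          (fun h0 => ne_zero_of_isCoprime_reflect hf (congr_fun h0 0))
          (snd_eq_zero_of_mem_encSym f)
      · exact isDecomposition_sign.exists_fst_ne_zero (i := 0)
          (fun h0 => ne_zero_of_isCoprime_reflect hf (congr_fun h0 0))
          (snd_eq_zero_of_mem_encAlt f))
    isRowSpanCode_encSign
  obtain ⟨hr1, hr2, hr3⟩ := isDecomposition_refl.components isMinimal_refl_iff (E := encId)
    (by
      rintro D (rfl | rfl) y hy
      · exact ((mem_rowCode_ones _ _ isUnit_one y).1 hy).2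
      · exact ((mem_rowCode_signs _ _ isUnit_one y).1 hy).2)
    (by
      rintro D (rfl | rfl)
      · exact isDecomposition_refl.exists_fst_ne_zero (i := 0)
          (fun h0 => one_ne_zero (congr_fun h0 0))
          fun y hy => ((mem_rowCode_ones _ _ isUnit_one y).1 hy).2
      · exact isDecomposition_refl.exists_fst_ne_zero (i := 0)
          (fun h0 => one_ne_zero (congr_fun h0 0))
          fun y hy => ((mem_rowCode_signs _ _ isUnit_one y).1 hy).2)
    isRowSpanCode_encId
  refine ⟨⟨signAut_ε₁, signAut_ε₂, swapEquiv signAut_swaps psi2_mul_signMatrix isUnit_signMatrix,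
      ?_, ?_, ?_, ?_, ?_, ?_, ?_, ?_, ?_, ?_, hs1, hs2, hs3⟩,
    fun f hf => ⟨(parameters_encSym hf (isMinimal_encSym hf).isConvCode).1,
      (parameters_encSym hf (isMinimal_encSym hf).isConvCode).2.1,
      (parameters_encAlt hf (isMinimal_encAlt hf).isConvCode).1,
      (parameters_encAlt hf (isMinimal_encAlt hf).isConvCode).2.1⟩,
    fun a c hac => parameters_encSign hac,
    ⟨fixEquiv refl_fixes psi2_mul_one_refl isUnit_one,
      ?_, ?_, ?_, ?_, ?_, ?_, ?_, hr1, hr2, hr3⟩,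
    ⟨(parameters_ones ((isMinimal_refl_iff _).2 (Or.inl (Or.inl rfl))).isConvCode).1,
      (parameters_signs ((isMinimal_refl_iff _).2 (Or.inl (Or.inr rfl))).isConvCode).1,
      fun a c hac => parameters_encId hac⟩,
    fun σ => ?_, exists_parameters, fun t => ⟨?_, ?_, ?_⟩⟩
  · rw [swapEquiv_apply, swapHom_zvar]; rfl
  · have h2 : (Polynomial.C 2 : F5[X]) = 2 := map_ofNat Polynomial.C 2
    have h3 : (Polynomial.C 3 : F5[X]) = 3 := map_ofNat Polynomial.C 3
    have h4 : (Polynomial.C 4 : F5[X]) = 4 := map_ofNat Polynomial.C 4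
    rw [swapEquiv_apply, swapHom_zvar, signMatrix, constMatrix_fin_two, h2, h3, h4, map_one]
  · rw [swapEquiv_apply, swapHom_const, coe_diagHom]; simp
  · rw [swapEquiv_apply, swapHom_const]; simp
  · rw [swapEquiv_apply, swapHom_const, coe_diagHom]; simp
  · rw [swapEquiv_apply, swapHom_const]; simp
  · rw [swapEquiv_apply, isDecomposition_sign.map_const (by simp) (by simp), psi2_ε₃,
      constMatrix_fin_two]
    simp
  · rw [swapEquiv_apply, isDecomposition_sign.map_const (by simp) (by simp), psi2_ε₃₄,
      constMatrix_fin_two]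
    simp
  · rw [swapEquiv_apply, isDecomposition_sign.map_const (by simp) (by simp), psi2_ε₄₃,
      constMatrix_fin_two]
    simp
  · rw [swapEquiv_apply, isDecomposition_sign.map_const (by simp) (by simp), psi2_ε₄,
      constMatrix_fin_two]
    simp
  · rw [fixEquiv_apply, fixHom_zvar, map_one]
  · rw [fixEquiv_apply, fixHom_const]; simp
  · rw [fixEquiv_apply, fixHom_const]; simp
  · rw [fixEquiv_apply, isDecomposition_refl.map_const (by simp) (by simp), psi2_ε₃,
      constMatrix_fin_two]
    simp
  · rw [fixEquiv_apply, isDecomposition_refl.map_const (by simp) (by simp), psi2_ε₃₄,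
      constMatrix_fin_two]
    simp
  · rw [fixEquiv_apply, isDecomposition_refl.map_const (by simp) (by simp), psi2_ε₄₃,
      constMatrix_fin_two]
    simp
  · rw [fixEquiv_apply, isDecomposition_refl.map_const (by simp) (by simp), psi2_ε₄,
      constMatrix_fin_two]
    simp
  · obtain ⟨σ₀, hσ₀, u, h, hu⟩ := exists_conj_unit σ
    refine ⟨σ₀, hσ₀, u, h, theta u h, theta_const u h, theta_zvar u h,
      isMinimalGroupConvCode_iff_exists_image s3 σ (theta u h), fun hmon y y₀ hy => ?_⟩
    obtain ⟨x, hx⟩ := hu hmon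
    refine weight_eq_of_theta s3 h hx (fun g => ?_) hy
    -- Both model automorphisms multiply group elements by the nonzero scalars ±1.
    rcases hσ₀ with ⟨rfl, -⟩ | ⟨rfl, -⟩
    · exact ⟨1, one_ne_zero, rfl⟩
    · refine ⟨_, ?_, signAut_single g 1⟩
      rcases Int.units_eq_one_or (Equiv.Perm.sign g) with h1 | h1 <;> simp [h1]
  · obtain ⟨f, hf, rfl⟩ := exists_isCoprime_reflect t
    exact ⟨_, isMinimal_encSym hf, (parameters_encSym hf (isMinimal_encSym hf).isConvCode).2.1⟩
  -- The pair (zᵗ, 1) is coprime with larger degree t, also for t = 0.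
  · have hac : IsCoprime (Polynomial.X ^ t : F5[X]) 1 := isCoprime_one_right
    have hp := (parameters_encSign hac).2
    rw [Polynomial.natDegree_X_pow, Polynomial.natDegree_one, mul_zero,
      max_eq_left (Nat.zero_le _)] at hp
    exact ⟨_, isMinimal_encSign hac, hp⟩
  · have hac : IsCoprime (Polynomial.X ^ t : F5[X]) 1 := isCoprime_one_right
    have hp := (parameters_encId hac).2
    rw [Polynomial.natDegree_X_pow, Polynomial.natDegree_one, mul_zero,
      max_eq_left (Nat.zero_le _)] at hp
    exact ⟨_, isMinimal_encId hac, hp⟩
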